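/- **Setting.** Let $X_1,\dots,X_{n_X}\sim\mu$ and $Y_1,\dots,Y_{n_Y}\sim\nu$ be independent random vectors in $\mathbb R^d$, where $\mu,\nu$ are Borel probability measures with finite first moment; put $n=n_X+n_Y$. Each sample is split (independently of the data; the split is treated as fixed) into a fitting part, with index sets $I^X_{fit},I^Y_{fit}$, and a test part (the complement), with index sets $I^X_{te},I^Y_{te}$ of sizes $n^X_{te},n^Y_{te}$. Write $\mathcal D_{fit}$ for the fitting data. For $D\in\mathbb N$, a width vector $p=(p_0,\dots,p_{D+1})$ with $p_0=k$, $p_{D+1}=1$, $s\in\mathbb N$ and $B\in\mathbb R$, let $\mathcal N(D,p,s,B)$ be the set of functions $\phi=L_D\circ\sigma\circ L_{D-1}\circ\cdots\circ\sigma\circ L_0:\mathbb R^k\to\mathbb R$ with $\sigma$ the coordinatewise ReLU, $L_\ell(x)=A_\ell x+b_\ell$, all entries of the $A_\ell,b_\ell$ at most $1$ in absolute value, at most $s$ of these entries nonzero, and $\sup_x|\phi(x)|\le B$. Let $m\ge1$ and let $(k_j,\varpi_j)$, $j=1,\dots,m$, be candidate pairs with $1\le k_j\le\varpi_j\le k_jd$.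 For every $j$ let $\hat U_j$, a measurable function of $\mathcal D_{fit}$, maximize $$U\mapsto\min_{\pi}\sum_{i\in I^X_{fit}}\sum_{l\in I^Y_{fit}}\pi_{il}\|U^{\top}(X_i-Y_l)\|_2$$ over $\{U\in\mathbb R^{d\times k_j}:U^\top U=I_{k_j},\ \|U\|_0\le\varpi_j\}$, where $\|U\|_0$ is the number of nonzero entries and $\pi$ ranges over the nonnegative matrices with row sums $1/|I^X_{fit}|$ and column sums $1/|I^Y_{fit}|$; and let $\hat f_j$, also depending measurably on $\mathcal D_{fit}$, maximize $$f\mapsto|I^X_{fit}|^{-1}\sum_{i\in I^X_{fit}}f(\hat U_j^\top X_i)-|I^Y_{fit}|^{-1}\sum_{l\in I^Y_{fit}}f(\hat U_j^\top Y_l)$$ over a class $\mathcal N(D_j,p_j,s_j,B_j)$. Put $\hat g_j(x)=\hat f_j(\hat U_j^\top x)$, let $\hat S\in\mathbb R^m$ have the entries $\hat S_j=\frac1{n^X_{te}}\sum_{i\in I^X_{te}}\hat g_j(X_i)-\frac1{n^Y_{te}}\sum_{i\in I^Y_{te}}\hat g_j(Y_i)$, and let $a=\big(\frac{n^X_{te}n^Y_{te}}{n^X_{te}+n^Y_{te}}\big)^{1/2}$,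 $\Sigma=\operatorname{Var}(a\hat S\mid\mathcal D_{fit})$, $$\hat\Sigma=\tfrac{n^Y_{te}}{n^X_{te}+n^Y_{te}}\hat V_X+\tfrac{n^X_{te}}{n^X_{te}+n^Y_{te}}\hat V_Y,\qquad T_n^{(0)}=\max_{j\le m}a\,|e_j^\top\hat\Sigma^{-1/2}\hat S|,$$ where $\hat V_X,\hat V_Y$ are the empirical covariance matrices (normalized by $1/n^X_{te}$ and $1/n^Y_{te}$) of $(\hat g_1,\dots,\hat g_m)$ on the two test samples, and $\hat\Sigma^{-1/2}:=0$ if $\hat\Sigma$ is singular. Fix $m$ and constants $0<c_1\le c_2<1$, $c_1',c_2'\in(0,\infty)$. Assume $n_X/n,\ |I^X_{fit}|/n_X,\ |I^Y_{fit}|/n_Y\in[c_1,c_2]$, that almost surely all eigenvalues of $\Sigma$ lie in $[c_1',c_2']$, and the null hypothesis $\mu=\nu$. Let $Z\sim N(0,I_m)$. For $\eta>0$ call the networks *$\eta$-bounded* if $B_j=4(k_j\varpi_j)^{1/2}\eta\,(2\log(dn))^{1/2}$ for all $j$ (depths, widths and sparsities $D_j,p_j,s_j$ being arbitrary). **Claim.**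 1. If $n\to\infty$ with $d$, $\eta>0$ and the pairs $(k_j,\varpi_j)$ fixed and $\eta$-bounded networks (everything else may vary with $n$), then $T_n^{(0)}$ converges in distribution to $\max_{j\le m}|Z_j|$. 2. More generally, $T_n^{(0)}$ converges in distribution to $\max_{j\le m}|Z_j|$ as $n\to\infty$ when everything, including $d$, $\mu$, the pairs $(k_j,\varpi_j)$ and the networks, may vary with $n$ and the network bounds are arbitrary with $B_j=o(\sqrt n)$ for every $j$. 3. There is a constant $c>0$, depending only on $m,c_1,c_2,c_1',c_2'$, such that for every $\eta>0$ and $\eta$-bounded networks $$\sup_{t\in\mathbb R}\Big|\mathbb P(T_n^{(0)}\le t)-\mathbb P\big(\max_{j\le m}|Z_j|\le t\big)\Big|\le c\,\frac{k_\circ^{3/2}\eta^3(\varpi_\circ\log(dn))^{3/2}+k_\circ\eta^2\varpi_\circ\log(dn)\log n}{\sqrt n},$$ where $k_\circ=\max_jk_j$ and $\varpi_\circ=\max_j\varpi_j$. -/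

import Mathlib

open MeasureTheory ProbabilityTheory Filter Topology Matrix

universe u

noncomputable section

namespace NeuralWasserstein

/-! ### ReLU networks -/

/-- Weights and biases of a ReLU network with width vector `p 0, p 1, …`. Layer `ℓ` is the affine map
`x ↦ A ℓ x + b ℓ` from `ℝ ^ p ℓ` to `ℝ ^ p (ℓ + 1)`. A network with `D` hidden layers only uses
`ℓ = 0, …, D`. -/
structure NetworkParams (p : ℕ → ℕ) where
  A : ∀ ℓ : ℕ, Matrix (Fin (p (ℓ + 1))) (Fin (p ℓ)) ℝ
  b : ∀ ℓ : ℕ, Fin (p (ℓ + 1)) → ℝ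

/-- `N.realize x D = L_D ∘ σ ∘ L_{D-1} ∘ ⋯ ∘ σ ∘ L_0 (x)`, where `σ` is the coordinatewise ReLU. -/
def NetworkParams.realize {p : ℕ → ℕ} (N : NetworkParams p) (x : Fin (p 0) → ℝ) :
    ∀ D : ℕ, Fin (p (D + 1)) → ℝ
  | 0 => N.A 0 *ᵥ x + N.b 0
  | D + 1 => N.A (D + 1) *ᵥ (fun i => max (N.realize x D i) 0) + N.b (D + 1)

/-- The number of nonzero entries of a matrix. -/
def matrixL0 {a b : ℕ} (A : Matrix (Fin a) (Fin b) ℝ) : ℕ :=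
  Set.ncard {q : Fin a × Fin b | A q.1 q.2 ≠ 0}

/-- The number of nonzero entries of a vector. -/
def vectorL0 {a : ℕ} (v : Fin a → ℝ) : ℕ :=
  Set.ncard {i : Fin a | v i ≠ 0}

/-- The class `𝒩(D, p, s, B)` of real-valued functions on `ℝ ^ k` that are realized by a ReLU network
with `D` hidden layers and width vector `(p 0, …, p (D + 1))`, `p 0 = k`, `p (D + 1) = 1`, with all
weights and biases bounded by one in absolute value, at most `s` of them nonzero, and with sup norm at
most `B`. -/
def reluClass (k D : ℕ) (p : ℕ → ℕ) (s : ℕ) (B : ℝ) : Set ((Fin k → ℝ) → ℝ) :=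
  {φ | ∃ (h0 : p 0 = k) (h1 : p (D + 1) = 1) (N : NetworkParams p),
    (∀ x, φ x = N.realize (fun i => x (Fin.cast h0 i)) D (Fin.cast h1.symm 0)) ∧
    (∀ ℓ ≤ D, (∀ i j, |N.A ℓ i j| ≤ 1) ∧ ∀ i, |N.b ℓ i| ≤ 1) ∧
    ∑ ℓ ∈ Finset.range (D + 1), (matrixL0 (N.A ℓ) + vectorL0 (N.b ℓ)) ≤ s ∧
    ∀ x, |φ x| ≤ B}

/-! ### Sparse projections and the empirical projection Wasserstein distance -/

/-- The `k × k`-orthonormal `d × k` matrices with at most `ϖ` nonzero entries. -/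
def sparseStiefel (d k : ℕ) (ϖ : ℝ) : Set (Matrix (Fin d) (Fin k) ℝ) :=
  {U | Uᵀ * U = 1 ∧ (matrixL0 U : ℝ) ≤ ϖ}

/-- The projected point `Uᵀ x`. -/
def project {d k : ℕ} (U : Matrix (Fin d) (Fin k) ℝ) (x : EuclideanSpace ℝ (Fin d)) :
    Fin k → ℝ :=
  Uᵀ *ᵥ (x.ofLp)

/-- Couplings (transport plans) of the uniform distributions on the index sets `ι` and `κ`. -/
def uniformCouplings (ι κ : Type) [Fintype ι] [Fintype κ] : Set (ι → κ → ℝ) :=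
  {π | (∀ i j, 0 ≤ π i j) ∧ (∀ j, ∑ i, π i j = 1 / (Fintype.card κ : ℝ)) ∧
    ∀ i, ∑ j, π i j = 1 / (Fintype.card ι : ℝ)}

/-- The optimal transport cost between the empirical distributions of the samples `x` and `y` after
projection by `U`, with cost the Euclidean norm. -/
def projectedOT {ι κ : Type} [Fintype ι] [Fintype κ] {d k : ℕ}
    (x : ι → EuclideanSpace ℝ (Fin d)) (y : κ → EuclideanSpace ℝ (Fin d))
    (U : Matrix (Fin d) (Fin k) ℝ) : ℝ :=
  sInf ((fun π : ι → κ → ℝ => ∑ i, ∑ j, π i j * ‖WithLp.toLp 2 (project U (x i - y j))‖) ''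
    uniformCouplings ι κ)

/-- The difference of the empirical means of `f(Uᵀ ·)` over the samples `x` and `y`. -/
def meanDiff {ι κ : Type} [Fintype ι] [Fintype κ] {d k : ℕ}
    (x : ι → EuclideanSpace ℝ (Fin d)) (y : κ → EuclideanSpace ℝ (Fin d))
    (U : Matrix (Fin d) (Fin k) ℝ) (f : (Fin k → ℝ) → ℝ) : ℝ :=
  (Fintype.card ι : ℝ)⁻¹ * ∑ i, f (project U (x i)) -
    (Fintype.card κ : ℝ)⁻¹ * ∑ j, f (project U (y j))

/-! ### The two-sample experiment -/

/-- The data of a two-sample experiment with `m` candidate hyperparameter pairs: the dimension, the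
sample sizes, the split of the two samples into fitting indices and test indices (the complements),
the candidate pairs `(k j, ϖ j)`, the parameters of the candidate network classes, the estimators of
the projection and of the witness function (as functions of the fitting data), the population
distributions and the samples. The requirements on these data are stated in the predicates below. -/
structure Experiment (m : ℕ) where
  d : ℕ
  nX : ℕ
  nY : ℕ
  fitX : Finset (Fin nX)
  fitY : Finset (Fin nY)
  k : Fin m → ℕ
  ϖ : Fin m → ℝ
  depth : Fin m → ℕ
  width : Fin m → ℕ → ℕ
  sparsity : Fin m → ℕ
  bound : Fin m → ℝ
  U : ∀ j : Fin m, (fitX → EuclideanSpace ℝ (Fin d)) × (fitY → EuclideanSpace ℝ (Fin d)) →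
    Matrix (Fin d) (Fin (k j)) ℝ
  f : ∀ j : Fin m, (fitX → EuclideanSpace ℝ (Fin d)) × (fitY → EuclideanSpace ℝ (Fin d)) →
    (Fin (k j) → ℝ) → ℝ
  μ : Measure (EuclideanSpace ℝ (Fin d))
  ν : Measure (EuclideanSpace ℝ (Fin d))
  Ω : Type u
  [mΩ : MeasurableSpace Ω]
  P : Measure Ω
  [isProb : IsProbabilityMeasure P]
  X : Fin nX → Ω → EuclideanSpace ℝ (Fin d)
  Y : Fin nY → Ω → EuclideanSpace ℝ (Fin d)

attribute [instance] Experiment.mΩ Experiment.isProb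

namespace Experiment

variable {m : ℕ} (E : Experiment.{u} m)

/-- The total sample size. -/
def n : ℕ := E.nX + E.nY

/-- The sample space of the fitting data. -/
abbrev FitSpace : Type :=
  (E.fitX → EuclideanSpace ℝ (Fin E.d)) × (E.fitY → EuclideanSpace ℝ (Fin E.d))

/-- The fitting data. -/
def fitData (ω : E.Ω) : E.FitSpace := (fun i => E.X i ω, fun j => E.Y j ω)

/-- The test indices of the first sample. -/
def testX : Finset (Fin E.nX) := E.fitXᶜ

/-- The test indices of the second sample. -/
def testY : Finset (Fin E.nY) := E.fitYᶜ

/-- The size of the test part of the first sample, as a real number. -/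
def tX : ℝ := (E.testX.card : ℝ)

/-- The size of the test part of the second sample, as a real number. -/
def tY : ℝ := (E.testY.card : ℝ)

/-- The samples are independent, the `X i` have law `μ` and the `Y j` have law `ν`, where `μ` and `ν`
are probability measures with finite first moment. -/
structure IsSampling : Prop where
  probX : IsProbabilityMeasure E.μ
  probY : IsProbabilityMeasure E.ν
  momentX : Integrable (fun x => ‖x‖) E.μ
  momentY : Integrable (fun y => ‖y‖) E.ν
  measX : ∀ i, Measurable (E.X i)
  measY : ∀ j, Measurable (E.Y j)
  lawX : ∀ i, HasLaw (E.X i) E.μ E.P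
  lawY : ∀ j, HasLaw (E.Y j) E.ν E.P
  indep : iIndepFun (fun s : Fin E.nX ⊕ Fin E.nY => Sum.elim E.X E.Y s) E.P

/-- The candidate pairs satisfy `1 ≤ k ≤ ϖ ≤ k d`, and for every candidate and all fitting data the
estimated projection maximizes the empirical projected transport cost over the `ℓ⁰`-constrained
Stiefel manifold, and the estimated witness function maximizes the difference of means of the projected
fitting data over the candidate network class. The estimators depend measurably on the data. -/
structure IsEll0Procedure : Prop where
  one_le_k : ∀ j, 1 ≤ E.k j
  k_le : ∀ j, (E.k j : ℝ) ≤ E.ϖ j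
  le_kd : ∀ j, E.ϖ j ≤ (E.k j : ℝ) * E.d
  U_mem : ∀ j D, E.U j D ∈ sparseStiefel E.d (E.k j) (E.ϖ j)
  U_max : ∀ j D, IsMaxOn (projectedOT D.1 D.2) (sparseStiefel E.d (E.k j) (E.ϖ j)) (E.U j D)
  U_meas : ∀ j a l, Measurable fun D => E.U j D a l
  f_mem : ∀ j D, E.f j D ∈ reluClass (E.k j) (E.depth j) (E.width j) (E.sparsity j) (E.bound j)
  f_max : ∀ j D, IsMaxOn (meanDiff D.1 D.2 (E.U j D))
    (reluClass (E.k j) (E.depth j) (E.width j) (E.sparsity j) (E.bound j)) (E.f j D)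
  f_meas : ∀ j, Measurable fun q : E.FitSpace × (Fin (E.k j) → ℝ) => E.f j q.1 q.2

/-- The network classes have sup-norm bound `4 (k ϖ)^{1/2} θ`, where
`θ = η (2 log (d n))^{1/2}` is the truncation level. -/
def HasEll0Bound (η : ℝ) : Prop :=
  ∀ j, E.bound j =
    4 * Real.sqrt (E.k j * E.ϖ j) * (η * Real.sqrt (2 * Real.log ((E.d : ℝ) * E.n)))

/-- The null hypothesis. -/
def Null : Prop := E.μ = E.ν

/-- The sample size condition. -/
structure SampleSizes (c₁ c₂ : ℝ) : Prop where
  ratio : (E.nX : ℝ) / ((E.nX : ℝ) + E.nY) ∈ Set.Icc c₁ c₂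
  fitX : (E.fitX.card : ℝ) / E.nX ∈ Set.Icc c₁ c₂
  fitY : (E.fitY.card : ℝ) / E.nY ∈ Set.Icc c₁ c₂

/-! ### The test statistic -/

/-- The estimated discriminative function `ĝ_j = f̂_j ∘ Û_jᵀ`. -/
def ghat (j : Fin m) (ω : E.Ω) (x : EuclideanSpace ℝ (Fin E.d)) : ℝ :=
  E.f j (E.fitData ω) (project (E.U j (E.fitData ω)) x)

/-- The mean of `ĝ_j` over the test part of the first sample. -/
def meanX (j : Fin m) (ω : E.Ω) : ℝ := E.tX⁻¹ * ∑ i ∈ E.testX, E.ghat j ω (E.X i ω)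

/-- The mean of `ĝ_j` over the test part of the second sample. -/
def meanY (j : Fin m) (ω : E.Ω) : ℝ := E.tY⁻¹ * ∑ i ∈ E.testY, E.ghat j ω (E.Y i ω)

/-- The vector `Ŝ = (S(ĝ_1), …, S(ĝ_m))`. -/
def S (ω : E.Ω) : Fin m → ℝ := fun j => E.meanX j ω - E.meanY j ω

/-- The scaling factor `(n_X n_Y / (n_X + n_Y))^{1/2}` (sizes of the test samples). -/
def scale : ℝ := Real.sqrt (E.tX * E.tY / (E.tX + E.tY))

/-- The `σ`-algebra generated by the fitting data. -/
abbrev fitSigma : MeasurableSpace E.Ω := MeasurableSpace.comap E.fitData inferInstance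

/-- The conditional covariance matrix `Σ` of the scaled vector `Ŝ` given the fitting data. -/
def condCov (ω : E.Ω) : Matrix (Fin m) (Fin m) ℝ := Matrix.of fun i j =>
  (E.P[fun ω' =>
      (E.scale * E.S ω' i - (E.P[fun ω'' => E.scale * E.S ω'' i | E.fitSigma]) ω') *
      (E.scale * E.S ω' j - (E.P[fun ω'' => E.scale * E.S ω'' j | E.fitSigma]) ω') |
    E.fitSigma]) ω

/-- Almost surely, all eigenvalues of the (symmetric) matrix `Σ` lie in `[c₁', c₂']`. -/
def CovBounds (c₁' c₂' : ℝ) : Prop :=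
  ∀ᵐ ω ∂E.P, spectrum ℝ (E.condCov ω) ⊆ Set.Icc c₁' c₂'

/-- The sample estimate `Σ̂` of `Σ`. -/
def sampleCov (ω : E.Ω) : Matrix (Fin m) (Fin m) ℝ := Matrix.of fun a b =>
  E.tY / (E.tX + E.tY) * (E.tX⁻¹ * ∑ i ∈ E.testX,
      (E.ghat a ω (E.X i ω) - E.meanX a ω) * (E.ghat b ω (E.X i ω) - E.meanX b ω)) +
  E.tX / (E.tX + E.tY) * (E.tY⁻¹ * ∑ i ∈ E.testY,
      (E.ghat a ω (E.Y i ω) - E.meanY a ω) * (E.ghat b ω (E.Y i ω) - E.meanY b ω))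

/-- The statistic `T = max_j scale * |e_jᵀ Σ̂^{-1/2} Ŝ|`, where `Σ̂^{-1/2}` is the inverse of the
positive semidefinite square root of `Σ̂` (with value `0` in the case that `Σ̂` is singular). -/
def T (ω : E.Ω) : ℝ :=
  ⨆ j : Fin m, E.scale * |((cfc Real.sqrt (E.sampleCov ω))⁻¹ *ᵥ E.S ω) j|

/-- The largest projection dimension among the candidates. -/
def kMax : ℝ := ⨆ j : Fin m, (E.k j : ℝ)

/-- The largest sparsity parameter among the candidates. -/
def ϖMax : ℝ := ⨆ j : Fin m, E.ϖ j

/-- The standing assumptions: the samples, the procedure, the sample size condition, the eigenvalue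
condition, and the null hypothesis. -/
structure Admissible (c₁ c₂ c₁' c₂' : ℝ) : Prop where
  sampling : E.IsSampling
  procedure : E.IsEll0Procedure
  sizes : E.SampleSizes c₁ c₂
  cov : E.CovBounds c₁' c₂'
  null : E.Null

end Experiment

/-- The standard normal distribution `N(0, I_m)`. -/
def stdNormal (m : ℕ) : Measure (Fin m → ℝ) := Measure.pi fun _ => gaussianReal 0 1

instance (m : ℕ) : IsProbabilityMeasure (stdNormal m) := by
  unfold stdNormal; infer_instance

/-- `max_j |z_j|`. -/
def maxAbs {m : ℕ} (z : Fin m → ℝ) : ℝ := ⨆ j : Fin m, |z j|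

end NeuralWasserstein

end

set_option linter.unusedSectionVars false

namespace NeuralWasserstein

/-! ### Gaussian analysis -/

/-! Conditionally on the fitting data the estimated functions are fixed bounded functions, and under
the null hypothesis the test data are one i.i.d. sample. The statistic is then a studentized
two-sample mean of bounded vectors in `ℝ ^ m` with a well-conditioned covariance matrix. Everything
follows from a bound of order `β (1 + log (1 / β))`, with `β = B / √N`, `B` a bound on the functions
and `N` proportional to `n`, on the distance between its distribution function and that of `maxAbs`.
This bound is uniform in the fitting data, so it survives averaging over them.

For the sum standardized by the true covariance, `{max ≤ t}` is the event that a normalized sum of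
independent vectors with isotropic covariances lies in the box `[-t, t] ^ m` (`berry_esseen_box`).
The indicator of the box is replaced by its heat flow `heatProd`, an explicit product of differences
of Gaussian distribution functions. Removing one summand of variance `v` while running the heat flow
for an extra time `v` is Lindeberg's replacement: by the heat equation the second-order terms agree
(`lindeberg_step`). The derivatives of the flow live near the boundary of the box, where they are
controlled by `layer`, and the sum puts mass only of order `√r` in a layer of width `√r`
(`integral_cauchyK_sum_le`). A step at time `r` therefore costs about `β v / r`. Summed from time `β
^ 2` to time `1 + β ^ 2`, this is `β log (1 / β)` up to constants (`lindeberg_induction`).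

Studentization is a perturbation. Bernstein's inequality at level `log (1 / β)` controls means and
covariances outside an event of probability of order `β`, and the matrix square root is Lipschitz
away from singular matrices (`inv_sqrt_perturbation`). The statistic thus moves by at most order `β
log (1 / β)`, which a sandwich of boxes absorbs.

For the explicit rate, the eigenvalue condition forces `B` to be bounded below. Hence `β` is at most
a constant times `B ^ 2 / √n`, and `log (1 / β)` is at most of order `log n`
(`exists_berry_esseen_log`). -/

/-- The odd primitive of the standard Gaussian density. -/
noncomputable def gaussE (x : ℝ) : ℝ := ∫ u in (0:ℝ)..x, gaussianPDFReal 0 1 u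

/-- `x ↦ gaussE x` and its first four derivatives. -/
noncomputable def gaussH : ℕ → ℝ → ℝ
  | 0, u => gaussE u
  | 1, u => gaussianPDFReal 0 1 u
  | 2, u => -u * gaussianPDFReal 0 1 u
  | 3, u => (u ^ 2 - 1) * gaussianPDFReal 0 1 u
  | 4, u => (-u ^ 3 + 3 * u) * gaussianPDFReal 0 1 u
  | _, _ => 0

lemma gaussianPDFReal_std (x : ℝ) :
    gaussianPDFReal 0 1 x = (√(2 * Real.pi))⁻¹ * Real.exp (-x ^ 2 / 2) := by
  simp [gaussianPDFReal]

lemma continuous_gaussianPDFReal_std : Continuous (gaussianPDFReal 0 1) := by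
  have : gaussianPDFReal 0 1 = fun x => (√(2 * Real.pi))⁻¹ * Real.exp (-x ^ 2 / 2) :=
    funext gaussianPDFReal_std
  rw [this]; fun_prop

lemma hasDerivAt_gaussianPDFReal_std (x : ℝ) :
    HasDerivAt (gaussianPDFReal 0 1) (-x * gaussianPDFReal 0 1 x) x := by
  have : gaussianPDFReal 0 1 = fun x => (√(2 * Real.pi))⁻¹ * Real.exp (-x ^ 2 / 2) :=
    funext gaussianPDFReal_std
  rw [this]
  have h : HasDerivAt (fun x : ℝ => -x ^ 2 / 2) (-x) x := by
    have := ((hasDerivAt_pow 2 x).neg).div_const 2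
    exact this.congr_deriv (by norm_num; ring)
  exact ((h.exp).const_mul ((√(2 * Real.pi))⁻¹)).congr_deriv (by ring)

lemma hasDerivAt_gaussE (x : ℝ) : HasDerivAt gaussE (gaussianPDFReal 0 1 x) x :=
  intervalIntegral.integral_hasDerivAt_right
    (continuous_gaussianPDFReal_std.intervalIntegrable _ _)
    continuous_gaussianPDFReal_std.stronglyMeasurable.stronglyMeasurableAtFilter
    continuous_gaussianPDFReal_std.continuousAt

lemma continuous_gaussE : Continuous gaussE :=
  continuous_iff_continuousAt.2 fun x => (hasDerivAt_gaussE x).continuousAt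

lemma hasDerivAt_gaussH {a : ℕ} (ha : a ≤ 3) (x : ℝ) :
    HasDerivAt (gaussH a) (gaussH (a + 1) x) x := by
  have hφ := hasDerivAt_gaussianPDFReal_std x
  interval_cases a
  · exact hasDerivAt_gaussE x
  · exact hφ
  · exact (((hasDerivAt_id x).neg).mul hφ).congr_deriv (by simp [gaussH]; ring)
  · exact ((((hasDerivAt_pow 2 x)).sub_const 1).mul hφ).congr_deriv (by simp [gaussH]; ring)

/-- This is the Hermite recursion. Differentiating `gaussH a (x / √r) / √r ^ a` in `r` produces
exactly its right-hand side, so it is the heat equation for `heatPsi`. -/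
lemma gaussH_heat {a : ℕ} (ha : a ≤ 2) (u : ℝ) :
    gaussH (a + 2) u = -u * gaussH (a + 1) u - a * gaussH a u := by
  interval_cases a <;> simp [gaussH] <;> ring

/-- The cube is chosen so that two factors `1 + u ^ 2` absorb the polynomial factors in `gaussH` and
one is left over as the Cauchy profile. -/
lemma gaussianPDFReal_std_le (u : ℝ) :
    (1 + u ^ 2) ^ 3 * gaussianPDFReal 0 1 u ≤ 48 := by
  rw [gaussianPDFReal_std]
  have h1 : (√(2 * Real.pi))⁻¹ ≤ 1 := by
    apply inv_le_one_of_one_le₀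
    rw [Real.one_le_sqrt]
    nlinarith [Real.pi_gt_three]
  -- The cubic term of the exponential series at `u ^ 2 / 2` is `u ^ 6 / 48`; this is the origin of
  -- the constant 48.
  have h2 := Real.sum_le_exp_of_nonneg (x := u ^ 2 / 2) (by positivity) 4
  simp [Finset.sum_range_succ, Nat.factorial] at h2
  have h3 : (1 + u ^ 2) ^ 3 ≤ 48 * Real.exp (u ^ 2 / 2) := by
    nlinarith [sq_nonneg u, sq_nonneg (u ^ 2), mul_nonneg (sq_nonneg u) (sq_nonneg (u ^ 2))]
  have h4 : Real.exp (-u ^ 2 / 2) * Real.exp (u ^ 2 / 2) = 1 := by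
    rw [← Real.exp_add]; simp; ring
  calc (1 + u ^ 2) ^ 3 * ((√(2 * Real.pi))⁻¹ * Real.exp (-u ^ 2 / 2))
      ≤ (1 + u ^ 2) ^ 3 * (1 * Real.exp (-u ^ 2 / 2)) := by gcongr
    _ ≤ (48 * Real.exp (u ^ 2 / 2)) * (1 * Real.exp (-u ^ 2 / 2)) := by gcongr
    _ = 48 * (Real.exp (-u ^ 2 / 2) * Real.exp (u ^ 2 / 2)) := by ring
    _ = 48 := by rw [h4]; ring

lemma abs_gaussH_le {a : ℕ} (h1 : 1 ≤ a) (h4 : a ≤ 4) (u : ℝ) :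
    |gaussH a u| ≤ 192 * (1 / (1 + u ^ 2)) := by
  have hp := gaussianPDFReal_std_le u
  have h0 : 0 ≤ gaussianPDFReal 0 1 u := gaussianPDFReal_nonneg _ _ _
  have key : ∀ c : ℝ, |c| ≤ 4 * (1 + u ^ 2) ^ 2 →
      |c * gaussianPDFReal 0 1 u| ≤ 192 * (1 / (1 + u ^ 2)) := by
    intro c hc
    rw [abs_mul, abs_of_nonneg h0, mul_one_div, le_div_iff₀ (by positivity)]
    calc |c| * gaussianPDFReal 0 1 u * (1 + u ^ 2)
        ≤ (4 * (1 + u ^ 2) ^ 2) * gaussianPDFReal 0 1 u * (1 + u ^ 2) := by gcongr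
      _ = 4 * ((1 + u ^ 2) ^ 3 * gaussianPDFReal 0 1 u) := by ring
      _ ≤ 192 := by linarith
  interval_cases a
  · have := key 1 (by rw [abs_one]; nlinarith [sq_nonneg u, sq_nonneg (u ^ 2)])
    simpa [gaussH] using this
  · exact key _ (by rw [abs_le]; constructor <;> nlinarith [sq_nonneg (u - 1), sq_nonneg (u + 1), sq_nonneg (u ^ 2)])
  · exact key _ (by rw [abs_le]; constructor <;> nlinarith [sq_nonneg u, sq_nonneg (u ^ 2)])
  · refine key _ ?_
    have e : 4 * (1 + u ^ 2) ^ 2 = 4 + 8 * u ^ 2 + 4 * u ^ 4 := by ring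
    rw [e, abs_le]
    constructor <;>
      nlinarith [sq_nonneg (u * (u - 1)), sq_nonneg (u * (u + 1)), sq_nonneg (u - 1),
        sq_nonneg (u + 1), sq_nonneg (u ^ 2), sq_nonneg u]

lemma gaussE_neg (x : ℝ) : gaussE (-x) = -gaussE x := by
  have : ∀ y, HasDerivAt (fun y => gaussE (-y) + gaussE y) 0 y := by
    intro y
    have h1 := (hasDerivAt_gaussE (-y)).scomp y (hasDerivAt_neg y)
    have h2 := h1.add (hasDerivAt_gaussE y)
    exact h2.congr_deriv (by simp [gaussianPDFReal_std])
  have h := is_const_of_deriv_eq_zero (fun y => (this y).differentiableAt)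
    (fun y => (this y).deriv) x 0
  simp [gaussE] at h ⊢
  linarith

lemma gaussianReal_Icc (a b : ℝ) (hab : a ≤ b) :
    (gaussianReal 0 1).real (Set.Icc a b) = gaussE b - gaussE a := by
  rw [measureReal_def, gaussianReal_apply_eq_integral _ (by norm_num), ENNReal.toReal_ofReal]
  · rw [integral_Icc_eq_integral_Ioc, ← intervalIntegral.integral_of_le hab, gaussE, gaussE,
      intervalIntegral.integral_interval_sub_left]
    · exact continuous_gaussianPDFReal_std.intervalIntegrable _ _
    · exact continuous_gaussianPDFReal_std.intervalIntegrable _ _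
  · exact setIntegral_nonneg measurableSet_Icc fun x _ => gaussianPDFReal_nonneg _ _ _

lemma gaussE_mono : Monotone gaussE :=
  monotone_of_deriv_nonneg (fun x => (hasDerivAt_gaussE x).differentiableAt)
    fun x => by rw [(hasDerivAt_gaussE x).deriv]; exact gaussianPDFReal_nonneg _ _ _

lemma gaussE_zero : gaussE 0 = 0 := by simp [gaussE]

lemma gaussE_le_half (x : ℝ) : gaussE x ≤ 1 / 2 := by
  rcases le_total 0 x with hx | hx
  · have h := gaussianReal_Icc (-x) x (by linarith)
    rw [gaussE_neg] at h
    have := measureReal_le_one (μ := gaussianReal 0 1) (s := Set.Icc (-x) x)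
    linarith
  · have := gaussE_mono hx
    rw [gaussE_zero] at this; linarith

/-- Markov's inequality for `1 + y ^ 2`, whose Gaussian mean is 2: the two-sided tail beyond `x` has
mass `2 (1 / 2 - gaussE x)`. This crude tail is all that the Cauchy profile requires. -/
lemma half_sub_gaussE_le {x : ℝ} (hx : 0 ≤ x) : 1 / 2 - gaussE x ≤ 1 / (1 + x ^ 2) := by
  have h := gaussianReal_Icc (-x) x (by linarith)
  rw [gaussE_neg] at h
  have hm : (1 + x ^ 2) * (gaussianReal 0 1).real {y | 1 + x ^ 2 ≤ 1 + y ^ 2} ≤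
      ∫ y, (1 + y ^ 2) ∂(gaussianReal 0 1) := by
    have hint : Integrable (fun y : ℝ => y ^ 2) (gaussianReal 0 1) :=
      (memLp_id_gaussianReal (μ := 0) (v := 1) 2).integrable_sq
    exact mul_meas_ge_le_integral_of_nonneg (ae_of_all _ fun y => by change (0:ℝ) ≤ 1 + y ^ 2; positivity)
      ((integrable_const 1).add hint) (1 + x ^ 2)
  have hI : ∫ y, (1 + y ^ 2) ∂(gaussianReal 0 1) = 2 := by
    have hint : Integrable (fun y : ℝ => y ^ 2) (gaussianReal 0 1) :=
      (memLp_id_gaussianReal (μ := 0) (v := 1) 2).integrable_sq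
    rw [integral_add (integrable_const 1) hint]
    have hv := variance_fun_id_gaussianReal (μ := 0) (v := 1)
    rw [variance_eq_integral (by fun_prop)] at hv
    simp at hv
    simp [hv]; norm_num
  have hc : (gaussianReal 0 1).real (Set.Icc (-x) x)ᶜ ≤
      (gaussianReal 0 1).real {y | 1 + x ^ 2 ≤ 1 + y ^ 2} := by
    refine measureReal_mono (fun y hy => ?_)
    simp only [Set.mem_compl_iff, Set.mem_Icc, not_and_or, not_le] at hy
    simp only [Set.mem_ofPred_eq]
    rcases hy with hy | hy <;> nlinarith
  rw [probReal_compl_eq_one_sub measurableSet_Icc, h] at hc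
  rw [hI] at hm
  have hpos : 0 < 1 + x ^ 2 := by positivity
  have : (1 + x ^ 2) * (1 - (gaussE x - -gaussE x)) ≤ 2 := le_trans (by gcongr) hm
  rw [le_div_iff₀ hpos]
  nlinarith

lemma abs_gaussE_le_half (x : ℝ) : |gaussE x| ≤ 1 / 2 := by
  rw [abs_le]
  refine ⟨?_, gaussE_le_half x⟩
  have := gaussE_le_half (-x)
  rw [gaussE_neg] at this; linarith

lemma gaussE_sub_le {x y : ℝ} (h : x ≤ y) : gaussE y - gaussE x ≤ y - x := by
  have h1 : ∀ u, gaussianPDFReal 0 1 u ≤ 1 := by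
    intro u
    rw [gaussianPDFReal_std]
    have h1 : (√(2 * Real.pi))⁻¹ ≤ 1 := by
      apply inv_le_one_of_one_le₀
      rw [Real.one_le_sqrt]
      nlinarith [Real.pi_gt_three]
    have h2 : Real.exp (-u ^ 2 / 2) ≤ 1 := by
      rw [Real.exp_le_one_iff]; nlinarith [sq_nonneg u]
    calc _ ≤ (1:ℝ) * 1 := by gcongr
      _ = 1 := by norm_num
  have := (convex_univ (𝕜 := ℝ) (E := ℝ)).image_sub_le_mul_sub_of_deriv_le (f := gaussE) (C := 1)
    continuous_gaussE.continuousOn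
    (fun x _ => (hasDerivAt_gaussE x).differentiableAt.differentiableWithinAt)
    (fun x _ => by rw [(hasDerivAt_gaussE x).deriv]; exact h1 x) x trivial y trivial h
  linarith

/-! ### Heat flow of the indicator of a box -/

/-- The Cauchy profile with scale `√r`. -/
noncomputable def cauchyK (r x : ℝ) : ℝ := 1 / (1 + x ^ 2 / r)

/-- The `a`-th spatial derivative of the heat flow `gaussE (x / √r)`. -/
noncomputable def heatPsi (a : ℕ) (r x : ℝ) : ℝ := gaussH a (x / √r) / √r ^ a

/-- The `a`-th spatial derivative of the heat flow of the indicator of `[-t, t]`. -/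
noncomputable def heatBox (t : ℝ) (a : ℕ) (r x : ℝ) : ℝ := heatPsi a r (x + t) - heatPsi a r (x - t)

/-- The partial derivative with multi-index `a` of the heat flow of the indicator of the box
`[-t, t] ^ m`. -/
noncomputable def heatProd {m : ℕ} (t : ℝ) (a : Fin m → ℕ) (r : ℝ) (w : Fin m → ℝ) : ℝ :=
  ∏ j, heatBox t (a j) r (w j)

/-- A profile concentrated near the boundary of `[-t, t] ^ m`. -/
noncomputable def layer {m : ℕ} (t r : ℝ) (w : Fin m → ℝ) : ℝ :=
  ∑ j, (cauchyK r (w j + t) + cauchyK r (w j - t))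

lemma cauchyK_pos {r : ℝ} (hr : 0 < r) (x : ℝ) : 0 < cauchyK r x := by
  unfold cauchyK; positivity

lemma cauchyK_le_one {r : ℝ} (hr : 0 < r) (x : ℝ) : cauchyK r x ≤ 1 := by
  unfold cauchyK
  rw [div_le_one (by positivity)]
  have : 0 ≤ x ^ 2 / r := by positivity
  linarith

lemma continuous_cauchyK {r : ℝ} (hr : 0 < r) : Continuous (cauchyK r) := by
  unfold cauchyK
  refine continuous_const.div (by fun_prop) fun x => ?_
  positivity

/-- The reason for a Cauchy profile rather than a Gaussian one: having polynomial tails, it changes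
only by a constant factor under shifts of at most its own width `√r`. Remainders evaluated at
intermediate points can thus be bounded at the base point. -/
lemma cauchyK_shift {r x y : ℝ} (hr : 0 < r) (h : (y - x) ^ 2 ≤ r) :
    cauchyK r y ≤ 3 * cauchyK r x := by
  unfold cauchyK
  rw [mul_one_div, div_le_div_iff₀ (by positivity) (by positivity)]
  have h1 : x ^ 2 ≤ 2 * y ^ 2 + 2 * r := by nlinarith [sq_nonneg (y - x + y)]
  have h2 : x ^ 2 / r ≤ 2 * (y ^ 2 / r) + 2 := by
    rw [div_le_iff₀ hr]
    field_simp
    linarith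
  have h3 : 0 ≤ y ^ 2 / r := by positivity
  linarith

lemma cauchyK_scale {r r' x : ℝ} (hr : 0 < r) (h : r ≤ r') (h' : r' ≤ 2 * r) :
    cauchyK r' x ≤ 2 * cauchyK r x := by
  unfold cauchyK
  have hr' : 0 < r' := by linarith
  rw [mul_one_div, div_le_div_iff₀ (by positivity) (by positivity)]
  have h2 : x ^ 2 / r ≤ 2 * (x ^ 2 / r') := by
    rw [mul_div_assoc', div_le_div_iff₀ hr hr']
    nlinarith [sq_nonneg x]
  have h3 : 0 ≤ x ^ 2 / r' := by positivity
  linarith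

lemma heatPsi_hasDerivAt {a : ℕ} (ha : a ≤ 3) {r : ℝ} (hr : 0 < r) (x : ℝ) :
    HasDerivAt (heatPsi a r) (heatPsi (a + 1) r x) x := by
  have hs : 0 < √r := Real.sqrt_pos.2 hr
  have h := ((hasDerivAt_gaussH ha (x / √r)).comp x ((hasDerivAt_id x).div_const (√r))).div_const
    (√r ^ a)
  exact h.congr_deriv (by unfold heatPsi; field_simp; ring)

lemma heatPsi_hasDerivAt_time {a : ℕ} (ha : a ≤ 2) {r : ℝ} (hr : 0 < r) (x : ℝ) :
    HasDerivAt (fun r => heatPsi a r x) (heatPsi (a + 2) r x / 2) r := by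
  have hs : 0 < √r := Real.sqrt_pos.2 hr
  have h1 : HasDerivAt Real.sqrt (1 / (2 * √r)) r := Real.hasDerivAt_sqrt hr.ne'
  have h2 : HasDerivAt (fun r => x / √r) (-(x * (1 / (2 * √r))) / √r ^ 2) r := by
    exact ((hasDerivAt_const r x).div h1 hs.ne').congr_deriv (by ring)
  have h3 := (hasDerivAt_gaussH (by omega : a ≤ 3) (x / √r)).comp r h2
  have h4 := h3.div (h1.pow a) (pow_pos hs a).ne'
  refine h4.congr_deriv ?_
  unfold heatPsi
  rw [gaussH_heat ha]
  rcases a with _ | a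
  · simp; field_simp
  · simp only [Nat.add_sub_cancel]
    simp only [Function.comp, Pi.pow_apply]
    push_cast
    field_simp
    ring

lemma abs_heatPsi_le {a : ℕ} (h1 : 1 ≤ a) (h4 : a ≤ 4) {r : ℝ} (hr : 0 < r) (x : ℝ) :
    |heatPsi a r x| ≤ 192 / √r ^ a * cauchyK r x := by
  have hs : 0 < √r := Real.sqrt_pos.2 hr
  have h := abs_gaussH_le h1 h4 (x / √r)
  rw [div_pow, Real.sq_sqrt hr.le] at h
  unfold heatPsi cauchyK
  rw [abs_div, abs_of_pos (by positivity : 0 < √r ^ a), div_mul_eq_mul_div]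
  gcongr

lemma abs_gaussE_sub_half_le {r : ℝ} (hr : 0 < r) {x : ℝ} (hx : 0 ≤ x) :
    1 / 2 - gaussE (x / √r) ≤ cauchyK r x := by
  have h := half_sub_gaussE_le (x := x / √r) (by positivity)
  rwa [div_pow, Real.sq_sqrt hr.le] at h

lemma heatPsi_zero (r x : ℝ) : heatPsi 0 r x = gaussE (x / √r) := by
  simp [heatPsi, gaussH]

lemma cauchyK_neg (r x : ℝ) : cauchyK r (-x) = cauchyK r x := by
  simp [cauchyK]

lemma heatBox_zero_nonneg {t : ℝ} (ht : 0 ≤ t) (r x : ℝ) : 0 ≤ heatBox t 0 r x := by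
  unfold heatBox
  rw [heatPsi_zero, heatPsi_zero]
  have := gaussE_mono (a := (x - t) / √r) (b := (x + t) / √r) (by gcongr; linarith)
  linarith

lemma heatBox_zero_le_one (t r x : ℝ) : heatBox t 0 r x ≤ 1 := by
  unfold heatBox
  rw [heatPsi_zero, heatPsi_zero]
  have h1 := abs_le.1 (abs_gaussE_le_half ((x - t) / √r))
  have h2 := abs_le.1 (abs_gaussE_le_half ((x + t) / √r))
  linarith [h1.1, h2.2]

/-- Inside the interval the error is the sum of the Gaussian tails beyond the two endpoints;
outside, it is at most the tail beyond the nearer endpoint. -/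
lemma abs_indicator_sub_heatBox_le {t r : ℝ} (hr : 0 < r) (ht : 0 ≤ t) (x : ℝ) :
    |(if |x| ≤ t then 1 else 0) - heatBox t 0 r x| ≤ cauchyK r (x + t) + cauchyK r (x - t) := by
  have hk1 := cauchyK_pos hr (x + t)
  have hk2 := cauchyK_pos hr (x - t)
  have hn := heatBox_zero_nonneg ht r x
  have hl := heatBox_zero_le_one t r x
  have neg : ∀ y, gaussE (-y / √r) = -gaussE (y / √r) := fun y => by rw [neg_div, gaussE_neg]
  have half : ∀ y, gaussE (y / √r) ≤ 1 / 2 := fun y => gaussE_le_half _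
  unfold heatBox at *
  rw [heatPsi_zero, heatPsi_zero] at *
  split_ifs with h
  · rw [abs_le] at h
    have a1 := abs_gaussE_sub_half_le hr (x := x + t) (by linarith)
    have a2 := abs_gaussE_sub_half_le hr (x := -(x - t)) (by linarith)
    rw [neg, cauchyK_neg] at a2
    rw [abs_of_nonneg (by linarith)]
    linarith
  · rw [zero_sub, abs_neg, abs_of_nonneg hn]
    rw [not_le, lt_abs] at h
    rcases h with h | h
    · have a2 := abs_gaussE_sub_half_le hr (x := x - t) (by linarith)
      have := half (x + t)
      linarith
    · have a1 := abs_gaussE_sub_half_le hr (x := -(x + t)) (by linarith)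
      rw [neg, cauchyK_neg] at a1
      have := half (-(x - t))
      rw [neg] at this
      linarith

lemma heatBox_hasDerivAt (t : ℝ) {a : ℕ} (ha : a ≤ 3) {r : ℝ} (hr : 0 < r) (x : ℝ) :
    HasDerivAt (heatBox t a r) (heatBox t (a + 1) r x) x :=
  ((heatPsi_hasDerivAt ha hr (x + t)).comp_add_const x t).sub
    ((heatPsi_hasDerivAt ha hr (x - t)).comp_sub_const x t)

lemma heatBox_hasDerivAt_time (t : ℝ) {a : ℕ} (ha : a ≤ 2) {r : ℝ} (hr : 0 < r) (x : ℝ) :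
    HasDerivAt (fun r => heatBox t a r x) (heatBox t (a + 2) r x / 2) r :=
  ((heatPsi_hasDerivAt_time ha hr (x + t)).sub
    (heatPsi_hasDerivAt_time ha hr (x - t))).congr_deriv (by unfold heatBox; ring)

lemma continuous_heatBox (t : ℝ) {a : ℕ} (ha : a ≤ 3) {r : ℝ} (hr : 0 < r) :
    Continuous (heatBox t a r) :=
  continuous_iff_continuousAt.2 fun x => (heatBox_hasDerivAt t ha hr x).continuousAt

lemma abs_heatBox_le (t : ℝ) {a : ℕ} (h1 : 1 ≤ a) (h4 : a ≤ 4) {r : ℝ} (hr : 0 < r) (x : ℝ) :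
    |heatBox t a r x| ≤ 192 / √r ^ a * (cauchyK r (x + t) + cauchyK r (x - t)) := by
  unfold heatBox
  have a1 := abs_heatPsi_le h1 h4 hr (x + t)
  have a2 := abs_heatPsi_le h1 h4 hr (x - t)
  calc _ ≤ |heatPsi a r (x + t)| + |heatPsi a r (x - t)| := abs_sub _ _
    _ ≤ _ := by rw [mul_add]; linarith

lemma abs_heatBox_le_const {t : ℝ} (ht : 0 ≤ t) {a : ℕ} (h4 : a ≤ 4) {r : ℝ} (hr : 0 < r) (x : ℝ) :
    |heatBox t a r x| ≤ 384 / √r ^ a := by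
  rcases Nat.eq_zero_or_pos a with rfl | h1
  · rw [abs_of_nonneg (heatBox_zero_nonneg ht r x), pow_zero]
    linarith [heatBox_zero_le_one t r x]
  · have hs : 0 < √r := Real.sqrt_pos.2 hr
    calc _ ≤ _ := abs_heatBox_le t h1 h4 hr x
      _ ≤ 192 / √r ^ a * (1 + 1) := by
        gcongr
        · exact cauchyK_le_one hr _
        · exact cauchyK_le_one hr _
      _ = _ := by ring

variable {m : ℕ}

lemma layer_nonneg (t : ℝ) {r : ℝ} (hr : 0 < r) (w : Fin m → ℝ) : 0 ≤ layer t r w :=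
  Finset.sum_nonneg fun _ _ => add_nonneg (cauchyK_pos hr _).le (cauchyK_pos hr _).le

lemma layer_le (t : ℝ) {r : ℝ} (hr : 0 < r) (w : Fin m → ℝ) : layer t r w ≤ 2 * m := by
  unfold layer
  calc _ ≤ ∑ _j : Fin m, (1 + 1 : ℝ) :=
        Finset.sum_le_sum fun _ _ => add_le_add (cauchyK_le_one hr _) (cauchyK_le_one hr _)
    _ = _ := by simp; ring

lemma continuous_layer (t : ℝ) {r : ℝ} (hr : 0 < r) : Continuous (layer (m := m) t r) := by
  have := continuous_cauchyK hr
  unfold layer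
  fun_prop

lemma layer_shift (t : ℝ) {r : ℝ} (hr : 0 < r) {w w' : Fin m → ℝ}
    (h : ∀ j, (w' j - w j) ^ 2 ≤ r) : layer t r w' ≤ 3 * layer t r w := by
  unfold layer
  rw [Finset.mul_sum]
  refine Finset.sum_le_sum fun j _ => ?_
  rw [mul_add]
  refine add_le_add (cauchyK_shift hr ?_) (cauchyK_shift hr ?_)
  · convert h j using 2; ring
  · convert h j using 2; ring

lemma layer_scale (t : ℝ) {r r' : ℝ} (hr : 0 < r) (h : r ≤ r') (h' : r' ≤ 2 * r)
    (w : Fin m → ℝ) : layer t r' w ≤ 2 * layer t r w := by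
  unfold layer
  rw [Finset.mul_sum]
  refine Finset.sum_le_sum fun j _ => ?_
  rw [mul_add]
  exact add_le_add (cauchyK_scale hr h h') (cauchyK_scale hr h h')

/-- A coordinate that is differentiated at least once contributes a factor concentrated near its two
faces; the remaining factors are bounded by their uniform size. -/
lemma abs_heatProd_le {t : ℝ} (ht : 0 ≤ t) {a : Fin m → ℕ} (h4 : ∀ j, a j ≤ 4) {r : ℝ}
    (hr : 0 < r) (w : Fin m → ℝ) {i : Fin m} (hi : 1 ≤ a i) :
    |heatProd t a r w| ≤ 384 ^ m / √r ^ (∑ j, a j) * layer t r w := by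
  have hs : 0 < √r := Real.sqrt_pos.2 hr
  unfold heatProd
  rw [Finset.abs_prod]
  have hq : cauchyK r (w i + t) + cauchyK r (w i - t) ≤ layer t r w :=
    Finset.single_le_sum (f := fun j => cauchyK r (w j + t) + cauchyK r (w j - t))
      (fun j _ => add_nonneg (cauchyK_pos hr _).le (cauchyK_pos hr _).le) (Finset.mem_univ i)
  have hq0 := layer_nonneg t hr w
  rw [← Finset.mul_prod_erase _ _ (Finset.mem_univ i)]
  calc _ ≤ (384 / √r ^ (a i) * layer t r w) * ∏ j ∈ Finset.univ.erase i, (384 / √r ^ (a j)) := by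
        gcongr with j hj
        · refine (abs_heatBox_le t hi (h4 i) hr (w i)).trans ?_
          gcongr
          · exact add_nonneg (cauchyK_pos hr _).le (cauchyK_pos hr _).le
          · norm_num
        · exact abs_heatBox_le_const ht (h4 j) hr _
    _ = (∏ j, (384 / √r ^ (a j))) * layer t r w := by
        rw [← Finset.mul_prod_erase _ _ (Finset.mem_univ i)]; ring
    _ = _ := by
        rw [Finset.prod_div_distrib, Finset.prod_pow_eq_pow_sum]
        simp

lemma heatProd_hasDerivAt_line (t : ℝ) {a : Fin m → ℕ} (ha : ∀ j, a j ≤ 3) {r : ℝ} (hr : 0 < r)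
    (w x : Fin m → ℝ) (θ : ℝ) :
    HasDerivAt (fun θ : ℝ => heatProd t a r (w + θ • x))
      (∑ j, x j * heatProd t (a + Pi.single j 1) r (w + θ • x)) θ := by
  unfold heatProd
  have h1 : ∀ j ∈ Finset.univ, HasDerivAt (fun θ : ℝ => heatBox t (a j) r ((w + θ • x) j))
      (heatBox t (a j + 1) r ((w + θ • x) j) * x j) θ := by
    intro j _
    have h2 : HasDerivAt (fun θ : ℝ => (w + θ • x) j) (x j) θ := by
      simpa using ((hasDerivAt_id θ).mul_const (x j)).const_add (w j)
    exact (heatBox_hasDerivAt t (ha j) hr _).comp θ h2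
  refine (HasDerivAt.fun_finsetProd h1).congr_deriv ?_
  refine Finset.sum_congr rfl fun j _ => ?_
  rw [← Finset.mul_prod_erase (a := j) _ _ (Finset.mem_univ j)]
  have : ∏ k ∈ Finset.univ.erase j, heatBox t ((a + Pi.single j 1 : Fin m → ℕ) k) r ((w + θ • x) k) =
      ∏ k ∈ Finset.univ.erase j, heatBox t (a k) r ((w + θ • x) k) := by
    refine Finset.prod_congr rfl fun k hk => ?_
    rw [Pi.add_apply, Pi.single_eq_of_ne (Finset.ne_of_mem_erase hk), add_zero]
  rw [this]
  simp only [Pi.add_apply, Pi.single_eq_same, smul_eq_mul]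
  ring

lemma heatProd_hasDerivAt_time (t : ℝ) {a : Fin m → ℕ} (ha : ∀ j, a j ≤ 2) {r : ℝ} (hr : 0 < r)
    (w : Fin m → ℝ) :
    HasDerivAt (fun r => heatProd t a r w)
      (∑ j, heatProd t (a + Pi.single j 2) r w / 2) r := by
  unfold heatProd
  refine (HasDerivAt.fun_finsetProd
    (fun j _ => heatBox_hasDerivAt_time t (ha j) hr (w j))).congr_deriv ?_
  refine Finset.sum_congr rfl fun j _ => ?_
  rw [← Finset.mul_prod_erase (a := j) _ _ (Finset.mem_univ j)]
  have : ∏ k ∈ Finset.univ.erase j, heatBox t ((a + Pi.single j 2 : Fin m → ℕ) k) r (w k) =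
      ∏ k ∈ Finset.univ.erase j, heatBox t (a k) r (w k) := by
    refine Finset.prod_congr rfl fun k hk => ?_
    rw [Pi.add_apply, Pi.single_eq_of_ne (Finset.ne_of_mem_erase hk), add_zero]
  rw [this]
  simp only [Pi.add_apply, Pi.single_eq_same, smul_eq_mul]
  ring

lemma continuous_heatProd (t : ℝ) {a : Fin m → ℕ} (ha : ∀ j, a j ≤ 3) {r : ℝ} (hr : 0 < r) :
    Continuous (heatProd t a r) := by
  unfold heatProd
  exact continuous_finsetProd _ fun j _ =>
    (continuous_heatBox t (ha j) hr).comp (continuous_apply j)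

/-! ### Taylor expansions of the heat flow of a box -/

lemma abs_sub_le_of_hasDerivAt {g g' : ℝ → ℝ} {a b M : ℝ} (hab : a ≤ b)
    (hg : ∀ θ ∈ Set.Icc a b, HasDerivAt g (g' θ) θ) (hM : ∀ θ ∈ Set.Icc a b, |g' θ| ≤ M)
    {θ : ℝ} (hθ : θ ∈ Set.Icc a b) : |g θ - g a| ≤ M * (θ - a) := by
  have := (convex_Icc a b).norm_image_sub_le_of_norm_hasDerivWithin_le (f := g) (f' := g') (C := M)
    (fun x hx => (hg x hx).hasDerivWithinAt) (fun x hx => hM x hx)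
    (Set.left_mem_Icc.2 hab) hθ
  simpa [Real.norm_eq_abs, abs_of_nonneg (sub_nonneg.2 hθ.1)] using this

lemma abs_taylor_two_le {g g1 g2 : ℝ → ℝ} {a b M : ℝ} (hab : a ≤ b)
    (h1 : ∀ θ ∈ Set.Icc a b, HasDerivAt g (g1 θ) θ)
    (h2 : ∀ θ ∈ Set.Icc a b, HasDerivAt g1 (g2 θ) θ) (hM : ∀ θ ∈ Set.Icc a b, |g2 θ| ≤ M)
    {θ : ℝ} (hθ : θ ∈ Set.Icc a b) :
    |g θ - g a - (θ - a) * g1 a| ≤ M * (b - a) * (θ - a) := by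
  have hM0 : 0 ≤ M := (abs_nonneg _).trans (hM a (Set.left_mem_Icc.2 hab))
  have key := abs_sub_le_of_hasDerivAt (g := fun θ => g θ - (θ - a) * g1 a)
    (g' := fun θ => g1 θ - g1 a) (M := M * (b - a)) hab
    (fun θ hθ => ((h1 θ hθ).sub (((hasDerivAt_id θ).sub_const a).mul_const (g1 a))).congr_deriv
      (by simp))
    (fun θ hθ => (abs_sub_le_of_hasDerivAt hab h2 hM hθ).trans (by gcongr; exact hθ.2)) hθ
  simp only [sub_self, zero_mul, sub_zero] at key
  convert key using 2; ring

lemma abs_taylor_three_le {g g1 g2 g3 : ℝ → ℝ} {M : ℝ}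
    (h1 : ∀ θ, HasDerivAt g (g1 θ) θ) (h2 : ∀ θ, HasDerivAt g1 (g2 θ) θ)
    (h3 : ∀ θ, HasDerivAt g2 (g3 θ) θ) (hM : ∀ θ ∈ Set.Icc (0:ℝ) 1, |g3 θ| ≤ M) :
    |g 1 - g 0 - g1 0 - g2 0 / 2| ≤ M := by
  have hM0 : 0 ≤ M := (abs_nonneg _).trans (hM 0 (by simp))
  have key := abs_sub_le_of_hasDerivAt (g := fun θ => g θ - θ * g1 0 - θ ^ 2 / 2 * g2 0)
    (g' := fun θ => g1 θ - g1 0 - θ * g2 0) (M := M) zero_le_one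
    (fun θ _ => (((h1 θ).sub ((hasDerivAt_id θ).mul_const (g1 0))).sub
      (((hasDerivAt_pow 2 θ).div_const 2).mul_const (g2 0))).congr_deriv (by simp))
    (fun θ hθ => by
      have := abs_taylor_two_le zero_le_one (fun θ _ => h2 θ) (fun θ _ => h3 θ) hM hθ
      simp only [sub_zero, mul_one] at this
      exact this.trans (by nlinarith [hθ.2]))
    (Set.right_mem_Icc.2 zero_le_one)
  simp only [sub_zero, mul_one] at key
  convert key using 2; ring

variable {m : ℕ}

lemma single_le_one (i j : Fin m) : (Pi.single i 1 : Fin m → ℕ) j ≤ 1 := by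
  rw [Pi.single_apply]; split_ifs <;> simp

lemma single_le_two (i j : Fin m) : (Pi.single i 2 : Fin m → ℕ) j ≤ 2 := by
  rw [Pi.single_apply]; split_ifs <;> simp

/-- Third-order Taylor expansion along the segment from `w` to `w + x`. The third derivatives have
size `√r ^ (-3)` times the layer at an intermediate point, and since `x` moves each coordinate by at
most `√r`, returning to `w` costs the factor 3. -/
lemma heatProd_expand {t : ℝ} (ht : 0 ≤ t) {r : ℝ} (hr : 0 < r) (w x : Fin m → ℝ)
    (hx : ∀ j, x j ^ 2 ≤ r) :
    |heatProd t 0 r (w + x) - heatProd t 0 r w - ∑ j, x j * heatProd t (Pi.single j 1) r w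
      - (∑ j, ∑ k, x j * x k * heatProd t (Pi.single j 1 + Pi.single k 1) r w) / 2| ≤
    3 * 384 ^ m / √r ^ 3 * (∑ j, |x j|) ^ 3 * layer t r w := by
  have hs : 0 < √r := Real.sqrt_pos.2 hr
  have h1 : ∀ θ : ℝ, HasDerivAt (fun θ : ℝ => heatProd t 0 r (w + θ • x))
      (∑ j, x j * heatProd t (0 + Pi.single j 1) r (w + θ • x)) θ := fun θ =>
    heatProd_hasDerivAt_line t (by simp) hr w x θ
  have h2 : ∀ θ : ℝ, HasDerivAt
      (fun θ : ℝ => ∑ j, x j * heatProd t (0 + Pi.single j 1) r (w + θ • x))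
      (∑ j, x j * ∑ k, x k * heatProd t (0 + Pi.single j 1 + Pi.single k 1) r (w + θ • x)) θ :=
    fun θ => HasDerivAt.fun_sum fun j _ => (heatProd_hasDerivAt_line t (fun k => by
      have := single_le_one j k
      simp only [zero_add]; omega) hr w x θ).const_mul _
  have h3 : ∀ θ : ℝ, HasDerivAt
      (fun θ : ℝ => ∑ j, x j * ∑ k, x k *
        heatProd t (0 + Pi.single j 1 + Pi.single k 1) r (w + θ • x))
      (∑ j, x j * ∑ k, x k * ∑ l, x l *
        heatProd t (0 + Pi.single j 1 + Pi.single k 1 + Pi.single l 1) r (w + θ • x)) θ :=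
    fun θ => HasDerivAt.fun_sum fun j _ => (HasDerivAt.fun_sum fun k _ =>
      (heatProd_hasDerivAt_line t (fun l => by
      have := single_le_one j l
      have := single_le_one k l
      simp only [zero_add, Pi.add_apply]; omega) hr w x θ).const_mul _).const_mul _
  have hM : ∀ θ ∈ Set.Icc (0:ℝ) 1, |∑ j, x j * ∑ k, x k * ∑ l, x l *
        heatProd t (0 + Pi.single j 1 + Pi.single k 1 + Pi.single l 1) r (w + θ • x)| ≤
      3 * 384 ^ m / √r ^ 3 * (∑ j, |x j|) ^ 3 * layer t r w := by
    intro θ hθ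
    have hl : layer t r (w + θ • x) ≤ 3 * layer t r w := by
      refine layer_shift t hr fun j => ?_
      have : (w + θ • x) j - w j = θ * x j := by simp
      rw [this, mul_pow]
      calc θ ^ 2 * x j ^ 2 ≤ 1 * x j ^ 2 := by
            gcongr; exact pow_le_one₀ hθ.1 hθ.2
        _ ≤ r := by rw [one_mul]; exact hx j
    set M := 3 * 384 ^ m / √r ^ 3 * layer t r w with hMdef
    have hM : ∀ j k l, |heatProd t (0 + Pi.single j 1 + Pi.single k 1 + Pi.single l 1) r
        (w + θ • x)| ≤ M := by
      intro j k l
      have hb := abs_heatProd_le ht (a := 0 + Pi.single j 1 + Pi.single k 1 + Pi.single l 1)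
        (fun i => by
          have := single_le_one j i
          have := single_le_one k i
          have := single_le_one l i
          simp only [zero_add, Pi.add_apply]; omega) hr (w + θ • x) (i := j) (by simp; omega)
      have e : ∑ i, (0 + Pi.single j 1 + Pi.single k 1 + Pi.single l 1 : Fin m → ℕ) i = 3 := by
        simp [Finset.sum_add_distrib]
      rw [e] at hb
      calc _ ≤ _ := hb
        _ ≤ 384 ^ m / √r ^ 3 * (3 * layer t r w) := by gcongr
        _ = M := by rw [hMdef]; ring
    calc _ ≤ ∑ j, |x j| * ∑ k, |x k| * ∑ l, |x l| * M := by
          refine (Finset.abs_sum_le_sum_abs _ _).trans (Finset.sum_le_sum fun j _ => ?_)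
          rw [abs_mul]; gcongr
          refine (Finset.abs_sum_le_sum_abs _ _).trans (Finset.sum_le_sum fun k _ => ?_)
          rw [abs_mul]; gcongr
          refine (Finset.abs_sum_le_sum_abs _ _).trans (Finset.sum_le_sum fun l _ => ?_)
          rw [abs_mul]; gcongr
          exact hM j k l
      _ = _ := by
          simp only [← Finset.sum_mul, hMdef]; ring
  have key := abs_taylor_three_le h1 h2 h3 hM
  simp only [one_smul, zero_smul, add_zero, zero_add] at key
  convert key using 3
  refine congrArg₂ _ ?_ rfl
  refine Finset.sum_congr rfl fun j _ => ?_
  rw [Finset.mul_sum]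
  exact Finset.sum_congr rfl fun k _ => by ring

/-- Two time derivatives are fourth-order space derivatives, which gives the factor `r ^ (-2)`; `v ≤
r` keeps the time within `[r, 2 r]`, where the layers are comparable. The linear term, `v / 2` times
the Laplacian, is the mean second-order term of `heatProd_expand` for a centred increment of
covariance `v • 1`. -/
lemma heatProd_expand_time {t : ℝ} (ht : 0 ≤ t) {r v : ℝ} (hr : 0 < r) (hv : 0 ≤ v) (hvr : v ≤ r)
    (w : Fin m → ℝ) :
    |heatProd t 0 (r + v) w - heatProd t 0 r w
      - v * ((∑ j, heatProd t (Pi.single j 1 + Pi.single j 1) r w) / 2)| ≤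
    m ^ 2 * 384 ^ m * v ^ 2 / r ^ 2 * layer t r w := by
  have h1 : ∀ s ∈ Set.Icc r (r + v), HasDerivAt (fun s => heatProd t 0 s w)
      (∑ j, heatProd t (0 + Pi.single j 2) s w / 2) s := fun s hs =>
    heatProd_hasDerivAt_time t (by simp) (by linarith [hs.1]) w
  have h2 : ∀ s ∈ Set.Icc r (r + v), HasDerivAt
      (fun s => ∑ j, heatProd t (0 + Pi.single j 2) s w / 2)
      (∑ j, (∑ k, heatProd t (0 + Pi.single j 2 + Pi.single k 2) s w / 2) / 2) s := fun s hs =>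
    HasDerivAt.fun_sum fun j _ => (heatProd_hasDerivAt_time t (fun k => by
      have := single_le_two j k
      simp only [zero_add]; omega) (by linarith [hs.1]) w).div_const 2
  have hM : ∀ s ∈ Set.Icc r (r + v),
      |∑ j, (∑ k, heatProd t (0 + Pi.single j 2 + Pi.single k 2) s w / 2) / 2| ≤
      m ^ 2 * 384 ^ m / r ^ 2 * layer t r w := by
    intro s hs
    have hs0 : 0 < s := by linarith [hs.1]
    have hb : ∀ j k, |heatProd t (0 + Pi.single j 2 + Pi.single k 2) s w| ≤
        384 ^ m / r ^ 2 * (2 * layer t r w) := by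
      intro j k
      have hb := abs_heatProd_le ht (a := 0 + Pi.single j 2 + Pi.single k 2)
        (fun i => by
          have := single_le_two j i
          have := single_le_two k i
          simp only [zero_add, Pi.add_apply]; omega) hs0 w (i := j) (by simp; omega)
      have e : ∑ i, (0 + Pi.single j 2 + Pi.single k 2 : Fin m → ℕ) i = 4 := by
        simp [Finset.sum_add_distrib]
      rw [e] at hb
      have e2 : √s ^ 4 = s ^ 2 := by
        rw [show √s ^ 4 = (√s ^ 2) ^ 2 by ring, Real.sq_sqrt hs0.le]
      rw [e2] at hb
      refine hb.trans ?_
      have := layer_scale t hr hs.1 (by linarith [hs.2]) w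
      have := layer_nonneg t hs0 w
      have := hs.1
      gcongr
    calc _ ≤ ∑ j : Fin m, (∑ k : Fin m, 384 ^ m / r ^ 2 * (2 * layer t r w) / 2) / 2 := by
          refine (Finset.abs_sum_le_sum_abs _ _).trans (Finset.sum_le_sum fun j _ => ?_)
          rw [abs_div, abs_two]; gcongr
          refine (Finset.abs_sum_le_sum_abs _ _).trans (Finset.sum_le_sum fun k _ => ?_)
          rw [abs_div, abs_two]; gcongr
          exact hb j k
      _ = m ^ 2 * 384 ^ m / r ^ 2 * layer t r w / 2 := by
          simp; ring
      _ ≤ _ := by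
          have := layer_nonneg t hr w
          exact half_le_self (by positivity)
  have key := abs_taylor_two_le (by linarith) h1 h2 hM (Set.right_mem_Icc.2 (by linarith))
  have e : ∀ j : Fin m, (0 + Pi.single j 2 : Fin m → ℕ) = Pi.single j 1 + Pi.single j 1 := by
    intro j; rw [← Pi.single_add, zero_add]
  simp only [e, add_sub_cancel_left, ← Finset.sum_div] at key
  refine key.trans (le_of_eq ?_)
  ring

/-! ### A concentration inequality for sums of bounded independent variables -/

section Concentration

variable {Ω : Type*} {mΩ : MeasurableSpace Ω} {P : Measure Ω} [IsProbabilityMeasure P]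

lemma integrable_of_abs_le {f : Ω → ℝ} (hf : Measurable f) {C : ℝ} (hC : ∀ ω, |f ω| ≤ C) :
    Integrable f P :=
  Integrable.of_bound hf.aestronglyMeasurable C (ae_of_all _ hC)

lemma memLp_of_abs_le {f : Ω → ℝ} (hf : Measurable f) {C : ℝ} (hC : ∀ ω, |f ω| ≤ C)
    (p : ENNReal) : MemLp f p P :=
  MemLp.of_bound hf.aestronglyMeasurable C (ae_of_all _ hC)

lemma integral_abs_le_of_sq {f : Ω → ℝ} (hf : Measurable f) {C : ℝ} (hC : ∀ ω, |f ω| ≤ C)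
    {a : ℝ} (ha : 0 < a) (h : ∫ ω, f ω ^ 2 ∂P ≤ a ^ 2) : ∫ ω, |f ω| ∂P ≤ a := by
  have hi2 : Integrable (fun ω => f ω ^ 2) P :=
    (memLp_of_abs_le hf hC 2).integrable_sq
  calc ∫ ω, |f ω| ∂P ≤ ∫ ω, (a / 2 + f ω ^ 2 / (2 * a)) ∂P := by
        refine integral_mono (integrable_of_abs_le hf hC).abs
          ((integrable_const _).add (hi2.div_const _)) fun ω => ?_
        have : |f ω| ≤ a / 2 + |f ω| ^ 2 / (2 * a) := by
          have h1 : a / 2 + |f ω| ^ 2 / (2 * a) - |f ω| = (|f ω| - a) ^ 2 / (2 * a) := by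
            field_simp; ring
          have h2 : 0 ≤ (|f ω| - a) ^ 2 / (2 * a) := by positivity
          linarith
        simpa using this
    _ = a / 2 + (∫ ω, f ω ^ 2 ∂P) / (2 * a) := by
        rw [integral_add (integrable_const _) (hi2.div_const _), integral_const, integral_div]
        simp
    _ ≤ a / 2 + a ^ 2 / (2 * a) := by gcongr
    _ = a := by field_simp; ring

/-- The function `√r * arctan ((· - t) / √r)` is a bounded primitive of the Cauchy profile, and the
profile is at least a third of its value at `u` over a step of length at most `√r`. -/
lemma arctan_increment {r : ℝ} (hr : 0 < r) (t u η : ℝ) (hη : η ^ 2 ≤ r) :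
    η ^ 2 * cauchyK r (u - t) / 3 ≤
      η * (√r * Real.arctan ((u - t) / √r) - √r * Real.arctan ((u - η - t) / √r)) := by
  have hs : 0 < √r := Real.sqrt_pos.2 hr
  have hd : ∀ θ : ℝ, HasDerivAt (fun θ => -η * (√r * Real.arctan ((u - θ * η - t) / √r)))
      (η ^ 2 * cauchyK r (u - θ * η - t)) θ := by
    intro θ
    have h1 : HasDerivAt (fun θ : ℝ => (u - θ * η - t) / √r) (-η / √r) θ := by
      have := ((((hasDerivAt_id θ).mul_const η).const_sub u).sub_const t).div_const (√r)
      exact this.congr_deriv (by simp)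
    refine ((h1.arctan.const_mul (√r)).const_mul (-η)).congr_deriv ?_
    unfold cauchyK
    rw [div_pow, Real.sq_sqrt hr.le]
    field_simp
  have key := (convex_Icc (0:ℝ) 1).mul_sub_le_image_sub_of_le_deriv
    (f := fun θ => -η * (√r * Real.arctan ((u - θ * η - t) / √r)))
    (C := η ^ 2 * cauchyK r (u - t) / 3)
    (fun θ _ => (hd θ).continuousAt.continuousWithinAt)
    (fun θ _ => (hd θ).differentiableAt.differentiableWithinAt)
    (fun θ hθ => by
      rw [interior_Icc] at hθ
      rw [(hd θ).deriv, mul_div_assoc]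
      have : cauchyK r (u - t) ≤ 3 * cauchyK r (u - θ * η - t) := by
        refine cauchyK_shift hr ?_
        calc (u - t - (u - θ * η - t)) ^ 2 = θ ^ 2 * η ^ 2 := by ring
          _ ≤ 1 * η ^ 2 := by gcongr; exact pow_le_one₀ hθ.1.le hθ.2.le
          _ ≤ r := by linarith
      gcongr
      linarith)
    0 (by simp) 1 (by simp) zero_le_one
  simp only [zero_mul, one_mul, sub_zero, mul_one] at key
  linarith

variable {ι : Type*}

lemma integral_mul_leave_one_out [DecidableEq ι] {η : ι → Ω → ℝ} (hind : iIndepFun η P)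
    (hm : ∀ i, Measurable (η i)) (h0 : ∀ i, ∫ ω, η i ω ∂P = 0) {s : Finset ι} {i : ι} (hi : i ∈ s)
    {f : ℝ → ℝ} (hf : Measurable f) :
    ∫ ω, η i ω * f (∑ j ∈ s, η j ω - η i ω) ∂P = 0 := by
  have hI := (hind.indepFun_finsetSum_of_notMem hm (Finset.notMem_erase i s)).symm
  have e : ∀ ω, ∑ j ∈ s, η j ω - η i ω = (∑ j ∈ s.erase i, η j) ω := by
    intro ω
    rw [Finset.sum_apply, ← Finset.add_sum_erase _ _ hi]; ring
  have hI2 : IndepFun (η i) (f ∘ (∑ j ∈ s.erase i, η j)) P := hI.comp measurable_id hf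
  have hm2 : Measurable (∑ j ∈ s.erase i, η j) := by
    rw [Finset.sum_fn]; exact Finset.measurable_sum _ fun j _ => hm j
  have := hI2.integral_fun_mul_eq_mul_integral
    (hm i).aestronglyMeasurable (hf.comp hm2).aestronglyMeasurable
  simp only [e]
  rw [h0 i, zero_mul] at this
  exact this

lemma integral_sum_sq {X : ι → Ω → ℝ} (hXi : iIndepFun X P) {C : ℝ} (hXm : ∀ i, Measurable (X i))
    (hXb : ∀ i ω, |X i ω| ≤ C) (hX0 : ∀ i, ∫ ω, X i ω ∂P = 0) (s : Finset ι) :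
    ∫ ω, (∑ i ∈ s, X i ω) ^ 2 ∂P = ∑ i ∈ s, ∫ ω, X i ω ^ 2 ∂P := by
  have h := IndepFun.variance_sum (s := s) (fun i _ => memLp_of_abs_le (P := P) (hXm i) (hXb i) 2)
    (fun i _ j _ hij => hXi.indepFun hij)
  have hm2 : Measurable (∑ j ∈ s, X j) := by
    rw [Finset.sum_fn]; exact Finset.measurable_sum _ fun j _ => hXm j
  rw [variance_of_integral_eq_zero hm2.aemeasurable] at h
  · simp only [Finset.sum_apply] at h
    rw [h]
    refine Finset.sum_congr rfl fun i _ => ?_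
    rw [variance_of_integral_eq_zero (hXm i).aemeasurable (hX0 i)]
  · simp only [Finset.sum_apply]
    rw [integral_finsetSum _ fun i _ => integrable_of_abs_le (hXm i) (hXb i)]
    exact Finset.sum_eq_zero fun i _ => hX0 i

/-- A Stein-type concentration argument. With `U` the sum and `f` the arctangent primitive of the
profile, `E[U f(U)] = ∑ E[η i (f(U) - f(U - η i))]`, because `η i` is centred and independent of `U
- η i`. The right side is at least a third of `E[(∑ η i ^ 2) K]`, where `∑ η i ^ 2` is close to `σ ^
2`; the left side is at most `√r (π / 2) σ`, since `f` is bounded. -/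
theorem integral_cauchyK_sum_le [DecidableEq ι] {η : ι → Ω → ℝ} (hind : iIndepFun η P)
    (hm : ∀ i, Measurable (η i)) {β : ℝ} (hb : ∀ i ω, |η i ω| ≤ β) (h0 : ∀ i, ∫ ω, η i ω ∂P = 0)
    (s : Finset ι) {r : ℝ} (hr : 0 < r) (hβr : β ^ 2 ≤ r) {σ : ℝ} (hσ : 0 < σ)
    (hσ2 : ∑ i ∈ s, ∫ ω, η i ω ^ 2 ∂P = σ ^ 2) (t : ℝ) :
    ∫ ω, cauchyK r (∑ i ∈ s, η i ω - t) ∂P ≤ 6 * √r / σ := by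
  have hs : 0 < √r := Real.sqrt_pos.2 hr
  set U : Ω → ℝ := fun ω => ∑ i ∈ s, η i ω with hU
  have hUm : Measurable U := Finset.measurable_sum _ fun i _ => hm i
  have hUb : ∀ ω, |U ω| ≤ ∑ _i ∈ s, β := fun ω =>
    (Finset.abs_sum_le_sum_abs _ _).trans (Finset.sum_le_sum fun i _ => hb i ω)
  set f : ℝ → ℝ := fun u => √r * Real.arctan ((u - t) / √r) with hf
  have hfm : Measurable f := by fun_prop
  have hfb : ∀ u, |f u| ≤ √r * (Real.pi / 2) := by
    intro u
    rw [hf, abs_mul, abs_of_pos hs]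
    gcongr
    exact abs_le.2 ⟨(Real.neg_pi_div_two_lt_arctan _).le, (Real.arctan_lt_pi_div_two _).le⟩
  set K : Ω → ℝ := fun ω => cauchyK r (U ω - t) with hK
  have hKm : Measurable K := (continuous_cauchyK hr).measurable.comp (hUm.sub_const t)
  have hK0 : ∀ ω, 0 ≤ K ω := fun ω => (cauchyK_pos hr _).le
  have hK1 : ∀ ω, K ω ≤ 1 := fun ω => cauchyK_le_one hr _
  have hβ0 : ∀ i ω, η i ω ^ 2 ≤ β ^ 2 := fun i ω => sq_le_sq' (abs_le.1 (hb i ω)).1 (abs_le.1 (hb i ω)).2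
  have hi1 : ∀ i, Integrable (fun ω => η i ω ^ 2 * K ω / 3) P := fun i =>
    integrable_of_abs_le (C := β ^ 2 * 1 / 3) (by have := hm i; fun_prop) fun ω => by
      rw [abs_of_nonneg (by have := hK0 ω; positivity)]
      have := hβ0 i ω; have := hK0 ω; have := hK1 ω
      gcongr
  have hi2 : ∀ i, Integrable (fun ω => η i ω * f (U ω)) P := fun i =>
    integrable_of_abs_le (C := β * (√r * (Real.pi / 2))) (by have := hm i; fun_prop) fun ω => by
      rw [abs_mul]
      have := (abs_nonneg _).trans (hb i ω)
      gcongr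
      · exact hb i ω
      · exact hfb _
  have hi3 : ∀ i, Integrable (fun ω => η i ω * f (U ω - η i ω)) P := fun i =>
    integrable_of_abs_le (C := β * (√r * (Real.pi / 2))) (by have := hm i; fun_prop) fun ω => by
      rw [abs_mul]
      have := (abs_nonneg _).trans (hb i ω)
      gcongr
      · exact hb i ω
      · exact hfb _
  have hz : ∀ i ∈ s, ∫ ω, η i ω * f (U ω - η i ω) ∂P = 0 := fun i hi =>
    integral_mul_leave_one_out hind hm h0 hi hfm
  -- upper bound
  have hU2 : ∫ ω, U ω ^ 2 ∂P = σ ^ 2 := by rw [← hσ2]; exact integral_sum_sq hind hm hb h0 s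
  have hEU : ∫ ω, |U ω| ∂P ≤ σ := integral_abs_le_of_sq hUm hUb hσ hU2.le
  have hup : ∫ ω, U ω * f (U ω) ∂P ≤ √r * (Real.pi / 2) * σ := by
    calc ∫ ω, U ω * f (U ω) ∂P ≤ ∫ ω, √r * (Real.pi / 2) * |U ω| ∂P := by
          refine integral_mono ?_ ((integrable_of_abs_le hUm hUb).abs.const_mul _) fun ω => ?_
          · have : (fun ω => U ω * f (U ω)) = fun ω => ∑ i ∈ s, η i ω * f (U ω) := by
              funext ω; rw [hU, Finset.sum_mul]
            rw [this]
            exact integrable_finsetSum _ fun i _ => hi2 i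
          · calc U ω * f (U ω) ≤ |U ω * f (U ω)| := le_abs_self _
              _ = |f (U ω)| * |U ω| := by rw [abs_mul, mul_comm]
              _ ≤ _ := by gcongr; exact hfb _
      _ ≤ _ := by rw [integral_const_mul]; gcongr
  -- lower bound
  have hlow : ∑ i ∈ s, ∫ ω, η i ω ^ 2 * K ω / 3 ∂P ≤ ∫ ω, U ω * f (U ω) ∂P := by
    calc _ ≤ ∑ i ∈ s, ∫ ω, (η i ω * f (U ω) - η i ω * f (U ω - η i ω)) ∂P := by
          refine Finset.sum_le_sum fun i _ => ?_
          refine integral_mono (hi1 i) ((hi2 i).sub (hi3 i)) fun ω => ?_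
          have := arctan_increment hr t (U ω) (η i ω) ((hβ0 i ω).trans hβr)
          rw [← mul_sub]
          exact this
      _ = ∑ i ∈ s, ∫ ω, η i ω * f (U ω) ∂P := by
          refine Finset.sum_congr rfl fun i hi => ?_
          rw [integral_sub (hi2 i) (hi3 i), hz i hi, sub_zero]
      _ = _ := by
          rw [← integral_finsetSum _ fun i _ => hi2 i]
          simp only [hU, Finset.sum_mul]
  -- the sum of squares concentrates
  set v : ι → ℝ := fun i => ∫ ω, η i ω ^ 2 ∂P with hv
  have hvβ : ∀ i, v i ≤ β ^ 2 := fun i => by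
    calc v i ≤ ∫ _, β ^ 2 ∂P := integral_mono (memLp_of_abs_le (hm i) (hb i) 2).integrable_sq
          (integrable_const _) fun ω => hβ0 i ω
      _ = β ^ 2 := by simp
  have hv0 : ∀ i, 0 ≤ v i := fun i => integral_nonneg fun ω => sq_nonneg _
  set D : ι → Ω → ℝ := fun i ω => η i ω ^ 2 - v i with hD
  have hDm : ∀ i, Measurable (D i) := fun i => ((hm i).pow_const 2).sub_const _
  have hDb : ∀ i ω, |D i ω| ≤ β ^ 2 := fun i ω => by
    rw [hD, abs_le]
    constructor
    · have := sq_nonneg (η i ω); have := hvβ i; simp only; linarith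
    · have := hβ0 i ω; have := hv0 i; simp only; linarith
  have hisq : ∀ i, Integrable (fun ω => η i ω ^ 2) P := fun i =>
    (memLp_of_abs_le (hm i) (hb i) 2).integrable_sq
  have hD0 : ∀ i, ∫ ω, D i ω ∂P = 0 := fun i => by
    rw [hD]; simp only
    rw [integral_sub (hisq i) (integrable_const _)]
    simp [hv]
  have hDi : iIndepFun D P := hind.comp (fun i x => x ^ 2 - v i) fun i => by fun_prop
  -- The variance of `η i ^ 2` is at most its second moment, hence at most `β ^ 2 * v i ≤ r * v i`.
  have hD2 : ∫ ω, (∑ i ∈ s, D i ω) ^ 2 ∂P ≤ (√r * σ) ^ 2 := by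
    rw [integral_sum_sq hDi hDm hDb hD0 s, mul_pow, Real.sq_sqrt hr.le, ← hσ2, Finset.mul_sum]
    refine Finset.sum_le_sum fun i _ => ?_
    calc ∫ ω, D i ω ^ 2 ∂P ≤ ∫ ω, ((β ^ 2 - 2 * v i) * η i ω ^ 2 + v i ^ 2) ∂P := by
          refine integral_mono (memLp_of_abs_le (hDm i) (hDb i) 2).integrable_sq
            (((hisq i).const_mul _).add (integrable_const _)) fun ω => ?_
          have := hβ0 i ω
          simp only [hD]
          nlinarith [sq_nonneg (η i ω)]
      _ = (β ^ 2 - 2 * v i) * v i + v i ^ 2 := by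
          rw [integral_add ((hisq i).const_mul _) (integrable_const _), integral_const_mul]
          simp [hv]
      _ ≤ r * v i := by nlinarith [hv0 i]
  have hDs : ∀ ω, |∑ i ∈ s, D i ω| ≤ ∑ _i ∈ s, β ^ 2 := fun ω =>
    (Finset.abs_sum_le_sum_abs _ _).trans (Finset.sum_le_sum fun i _ => hDb i ω)
  have hDsm : Measurable fun ω => ∑ i ∈ s, D i ω := Finset.measurable_sum _ fun i _ => hDm i
  have hDabs := integral_abs_le_of_sq hDsm hDs (by positivity) hD2
  have hKi : Integrable K P := integrable_of_abs_le (C := 1) hKm fun ω => by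
    rw [abs_of_nonneg (hK0 ω)]; exact hK1 ω
  -- As `0 ≤ K ≤ 1`, replacing `∑ η i ^ 2` by `σ ^ 2` costs at most the mean absolute deviation,
  -- which is at most `√r * σ`.
  have hfin : σ ^ 2 * ∫ ω, K ω ∂P - √r * σ ≤ 3 * ∑ i ∈ s, ∫ ω, η i ω ^ 2 * K ω / 3 ∂P := by
    calc σ ^ 2 * ∫ ω, K ω ∂P - √r * σ
        ≤ σ ^ 2 * ∫ ω, K ω ∂P - ∫ ω, |∑ i ∈ s, D i ω| ∂P := by gcongr
      _ = ∫ ω, (σ ^ 2 * K ω - |∑ i ∈ s, D i ω|) ∂P := by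
          rw [integral_sub (hKi.const_mul _) (integrable_of_abs_le hDsm hDs).abs,
            integral_const_mul]
      _ ≤ ∫ ω, 3 * ∑ i ∈ s, η i ω ^ 2 * K ω / 3 ∂P := by
          refine integral_mono ((hKi.const_mul _).sub (integrable_of_abs_le hDsm hDs).abs)
            ((integrable_finsetSum _ fun i _ => hi1 i).const_mul _) fun ω => ?_
          have e : 3 * ∑ i ∈ s, η i ω ^ 2 * K ω / 3 = (∑ i ∈ s, D i ω + σ ^ 2) * K ω := by
            rw [← hσ2, ← Finset.sum_add_distrib, Finset.sum_mul, Finset.mul_sum]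
            refine Finset.sum_congr rfl fun i _ => ?_
            simp only [hD, hv]; ring
          have h1 := neg_abs_le (∑ i ∈ s, D i ω)
          have h2 := hK0 ω
          have h3 := hK1 ω
          have h4 := abs_nonneg (∑ i ∈ s, D i ω)
          simp only [e]
          nlinarith
      _ = _ := by
          rw [integral_const_mul, integral_finsetSum _ fun i _ => hi1 i]
  -- The two contributions add up to `1 + 3 π / 2 < 6`.
  have hpi := Real.pi_lt_d2
  rw [le_div_iff₀ hσ]
  have hfinal : σ ^ 2 * ∫ ω, K ω ∂P ≤ (√r * 6) * σ := by nlinarith [mul_pos hs hσ]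
  change (∫ ω, K ω ∂P) * σ ≤ 6 * √r
  have : σ * ((∫ ω, K ω ∂P) * σ) ≤ σ * (6 * √r) := by linarith
  exact le_of_mul_le_mul_left this hσ

end Concentration

/-! ### Lindeberg's method for boxes -/

section Lindeberg

variable {Ω : Type*} {mΩ : MeasurableSpace Ω} {P : Measure Ω} [IsProbabilityMeasure P]
  {ι : Type*} {m : ℕ}

/-- Independent centred random vectors in `ℝ ^ m`, bounded by `β` in each coordinate, with
isotropic covariances `v i • 1`. -/
structure IsotropicArray (P : Measure Ω) (ξ : ι → Ω → Fin m → ℝ) (β : ℝ) (v : ι → ℝ) : Prop where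
  indep : iIndepFun ξ P
  meas : ∀ i, Measurable (ξ i)
  bound : ∀ i ω j, |ξ i ω j| ≤ β
  mean : ∀ i j, ∫ ω, ξ i ω j ∂P = 0
  cov : ∀ i j k, ∫ ω, ξ i ω j * ξ i ω k ∂P = if j = k then v i else 0

namespace IsotropicArray

variable {ξ : ι → Ω → Fin m → ℝ} {β : ℝ} {v : ι → ℝ}

lemma meas_coord (h : IsotropicArray P ξ β v) (i : ι) (j : Fin m) :
    Measurable fun ω => ξ i ω j := (measurable_pi_apply j).comp (h.meas i)

lemma integral_sq (h : IsotropicArray P ξ β v) (i : ι) (j : Fin m) :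
    ∫ ω, ξ i ω j ^ 2 ∂P = v i := by
  have := h.cov i j j
  simp only [if_true] at this
  rw [← this]
  simp only [sq]

lemma sq_le (h : IsotropicArray P ξ β v) (i : ι) (ω : Ω) (j : Fin m) : ξ i ω j ^ 2 ≤ β ^ 2 :=
  sq_le_sq' (abs_le.1 (h.bound i ω j)).1 (abs_le.1 (h.bound i ω j)).2

lemma integrable_sq (h : IsotropicArray P ξ β v) (i : ι) (j : Fin m) :
    Integrable (fun ω => ξ i ω j ^ 2) P :=
  (memLp_of_abs_le (h.meas_coord i j) (fun ω => h.bound i ω j) 2).integrable_sq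

lemma var_nonneg (h : IsotropicArray P ξ β v) (hm : 0 < m) (i : ι) : 0 ≤ v i := by
  rw [← h.integral_sq i ⟨0, hm⟩]
  exact integral_nonneg fun ω => sq_nonneg _

lemma var_le (h : IsotropicArray P ξ β v) (hm : 0 < m) (i : ι) : v i ≤ β ^ 2 := by
  rw [← h.integral_sq i ⟨0, hm⟩]
  calc _ ≤ ∫ _, β ^ 2 ∂P := integral_mono (h.integrable_sq i _)
          (integrable_const _) fun ω => h.sq_le i ω _
      _ = β ^ 2 := by simp

lemma measurable_sum (h : IsotropicArray P ξ β v) (s : Finset ι) :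
    Measurable fun ω => ∑ i ∈ s, ξ i ω :=
  Finset.measurable_sum _ fun i _ => h.meas i

/-- The mass near the boundary of the box. -/
lemma integral_layer_le [DecidableEq ι] (h : IsotropicArray P ξ β v) (s : Finset ι) {r : ℝ}
    (hr : 0 < r) (hβr : β ^ 2 ≤ r) {σ : ℝ} (hσ : 0 < σ) (hσ2 : ∑ i ∈ s, v i = σ ^ 2) (t : ℝ) :
    ∫ ω, layer t r (∑ i ∈ s, ξ i ω) ∂P ≤ 12 * m * √r / σ := by
  have hj : ∀ (j : Fin m) (t : ℝ), ∫ ω, cauchyK r ((∑ i ∈ s, ξ i ω) j - t) ∂P ≤ 6 * √r / σ := by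
    intro j t
    simp only [Finset.sum_apply]
    refine integral_cauchyK_sum_le (η := fun i ω => ξ i ω j)
      (h.indep.comp (fun _ x => x j) fun _ => measurable_pi_apply j) (fun i => h.meas_coord i j)
      (fun i ω => h.bound i ω j) (fun i => h.mean i j) s hr hβr hσ ?_ t
    rw [← hσ2]
    exact Finset.sum_congr rfl fun i _ => h.integral_sq i j
  have hint : ∀ (j : Fin m) (t : ℝ),
      Integrable (fun ω => cauchyK r ((∑ i ∈ s, ξ i ω) j - t)) P := by
    intro j t
    refine integrable_of_abs_le (C := 1) ((continuous_cauchyK hr).measurable.comp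
      (((measurable_pi_apply j).comp (h.measurable_sum s)).sub_const t)) fun ω => ?_
    rw [abs_of_pos (cauchyK_pos hr _)]; exact cauchyK_le_one hr _
  have hint' : ∀ (j : Fin m), Integrable (fun ω => cauchyK r ((∑ i ∈ s, ξ i ω) j + t)) P := by
    intro j; simpa using hint j (-t)
  have hj' : ∀ (j : Fin m), ∫ ω, cauchyK r ((∑ i ∈ s, ξ i ω) j + t) ∂P ≤ 6 * √r / σ := by
    intro j; simpa using hj j (-t)
  unfold layer
  have hadd : ∀ j : Fin m, Integrable (fun ω => cauchyK r ((∑ i ∈ s, ξ i ω) j + t) +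
      cauchyK r ((∑ i ∈ s, ξ i ω) j - t)) P := fun j => (hint' j).add (hint j t)
  rw [integral_finsetSum _ fun j _ => hadd j]
  calc _ ≤ ∑ _j : Fin m, (6 * √r / σ + 6 * √r / σ) := by
        refine Finset.sum_le_sum fun j _ => ?_
        rw [integral_add (hint' j) (hint j t)]
        exact add_le_add (hj' j) (hj j t)
    _ = _ := by simp; ring

lemma indepFun_sum [DecidableEq ι] (h : IsotropicArray P ξ β v) {s : Finset ι} {i : ι}
    (hi : i ∉ s) : IndepFun (ξ i) (fun ω => ∑ j ∈ s, ξ j ω) P := by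
  have := (h.indep.indepFun_finsetSum_of_notMem h.meas hi).symm
  rwa [Finset.sum_fn] at this

lemma integral_mul_sum [DecidableEq ι] (h : IsotropicArray P ξ β v) {s : Finset ι} {i : ι}
    (hi : i ∉ s) {f g : (Fin m → ℝ) → ℝ} (hf : Measurable f) (hg : Measurable g) :
    ∫ ω, f (ξ i ω) * g (∑ j ∈ s, ξ j ω) ∂P =
      (∫ ω, f (ξ i ω) ∂P) * ∫ ω, g (∑ j ∈ s, ξ j ω) ∂P :=
  ((h.indepFun_sum hi).comp hf hg).integral_fun_mul_eq_mul_integral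
    (hf.comp (h.meas i)).aestronglyMeasurable
    (hg.comp (h.measurable_sum s)).aestronglyMeasurable

end IsotropicArray

lemma abs_heatProd_zero_le {t : ℝ} (ht : 0 ≤ t) (r : ℝ) (w : Fin m → ℝ) :
    |heatProd t 0 r w| ≤ 1 := by
  unfold heatProd
  rw [Finset.abs_prod]
  refine Finset.prod_le_one (fun _ _ => abs_nonneg _) fun j _ => ?_
  rw [Pi.zero_apply, abs_of_nonneg (heatBox_zero_nonneg ht _ _)]
  exact heatBox_zero_le_one _ _ _

lemma abs_heatProd_le_const {t : ℝ} (ht : 0 ≤ t) {a : Fin m → ℕ} (h4 : ∀ j, a j ≤ 4) {r : ℝ}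
    (hr : 0 < r) (w : Fin m → ℝ) : |heatProd t a r w| ≤ ∏ j, (384 / √r ^ (a j)) := by
  unfold heatProd
  rw [Finset.abs_prod]
  exact Finset.prod_le_prod (fun _ _ => abs_nonneg _) fun j _ =>
    abs_heatBox_le_const ht (h4 j) hr _

lemma sum_abs_pow_three_le {x : Fin m → ℝ} {β : ℝ} (hx : ∀ j, |x j| ≤ β) :
    (∑ j, |x j|) ^ 3 ≤ m ^ 2 * β * ∑ j, x j ^ 2 := by
  have h1 : ∑ j, |x j| ≤ m * β := by
    calc _ ≤ ∑ _j : Fin m, β := Finset.sum_le_sum fun j _ => hx j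
      _ = _ := by simp
  have h2 : (∑ j, |x j|) ^ 2 ≤ m * ∑ j, x j ^ 2 := by
    have := sq_sum_le_card_mul_sum_sq (s := Finset.univ) (f := fun j => |x j|)
    simpa using this
  have h0 : 0 ≤ ∑ j, |x j| := Finset.sum_nonneg fun j _ => abs_nonneg _
  calc (∑ j, |x j|) ^ 3 = (∑ j, |x j|) * (∑ j, |x j|) ^ 2 := by ring
    _ ≤ (m * β) * (m * ∑ j, x j ^ 2) := by gcongr; exact h0.trans h1
    _ = _ := by ring

/-- The constant of one replacement step. -/
noncomputable def stepConst (m : ℕ) : ℝ := (3 * m ^ 3 + m ^ 2) * 384 ^ m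

/-- Running the heat flow for an extra time `v i` plays the role of adding an independent Gaussian
vector of covariance `v i • 1`, so no Gaussian vector has to be constructed. In the expansion in `ξ
i` the first-order term vanishes by centring and independence, and the isotropic covariance turns
the second-order term into `v i / 2` times the Laplacian, which is the first-order term of the
expansion in time. Only the two remainders are left. -/
theorem lindeberg_step [DecidableEq ι] {ξ : ι → Ω → Fin m → ℝ} {β : ℝ} {v : ι → ℝ}
    (h : IsotropicArray P ξ β v) (hm : 0 < m) {t : ℝ} (ht : 0 ≤ t) {s : Finset ι} {i : ι}
    (hi : i ∉ s) (hβ : 0 ≤ β) {r : ℝ} (hr : 0 < r) (hβr : β ^ 2 ≤ r) :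
    |∫ ω, heatProd t 0 r (∑ j ∈ s, ξ j ω + ξ i ω) ∂P -
        ∫ ω, heatProd t 0 (r + v i) (∑ j ∈ s, ξ j ω) ∂P| ≤
      stepConst m * β * v i / √r ^ 3 * ∫ ω, layer t r (∑ j ∈ s, ξ j ω) ∂P := by
  have hs : 0 < √r := Real.sqrt_pos.2 hr
  have hv0 := h.var_nonneg hm i
  have hvβ := h.var_le hm i
  set S : Ω → Fin m → ℝ := fun ω => ∑ j ∈ s, ξ j ω with hS
  have hSm : Measurable S := h.measurable_sum s
  have hlm : Measurable (layer (m := m) t r) := (continuous_layer t hr).measurable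
  have hli : Integrable (fun ω => layer t r (S ω)) P :=
    integrable_of_abs_le (C := 2 * m) (hlm.comp hSm) fun ω => by
      rw [abs_of_nonneg (layer_nonneg t hr _)]; exact layer_le t hr _
  have ha1 : ∀ (j : Fin m) l, (Pi.single j 1 : Fin m → ℕ) l ≤ 3 := fun j l =>
    (single_le_one j l).trans (by norm_num)
  have ha2 : ∀ (j k : Fin m) l, (Pi.single j 1 + Pi.single k 1 : Fin m → ℕ) l ≤ 3 := by
    intro j k l
    have := single_le_one j l
    have := single_le_one k l
    simp only [Pi.add_apply]; omega
  have hPm : ∀ (a : Fin m → ℕ) (r' : ℝ), 0 < r' → (∀ l, a l ≤ 3) → Measurable (heatProd t a r') :=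
    fun a r' hr' ha => (continuous_heatProd t ha hr').measurable
  have hPi : ∀ (a : Fin m → ℕ), (∀ l, a l ≤ 3) → Integrable (fun ω => heatProd t a r (S ω)) P :=
    fun a ha => integrable_of_abs_le ((hPm a r hr ha).comp hSm)
      fun ω => abs_heatProd_le_const ht (fun l => (ha l).trans (by norm_num)) hr _
  have hFi : ∀ r', 0 < r' → Integrable (fun ω => heatProd t 0 r' (S ω)) P := fun r' hr' =>
    integrable_of_abs_le (C := 1) ((hPm 0 r' hr' (by simp)).comp hSm)
      fun ω => abs_heatProd_zero_le ht _ _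
  have hFi' : Integrable (fun ω => heatProd t 0 r (S ω + ξ i ω)) P :=
    integrable_of_abs_le (C := 1) ((hPm 0 r hr (by simp)).comp (hSm.add (h.meas i)))
      fun ω => abs_heatProd_zero_le ht _ _
  -- first order
  have hi1 : ∀ j, Integrable (fun ω => ξ i ω j * heatProd t (Pi.single j 1) r (S ω)) P :=
    fun j => (hPi _ (ha1 j)).bdd_mul (c := β) (h.meas_coord i j).aestronglyMeasurable
      (ae_of_all _ fun ω => h.bound i ω j)
  have h1 : ∀ j, ∫ ω, ξ i ω j * heatProd t (Pi.single j 1) r (S ω) ∂P = 0 := fun j => by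
    have := h.integral_mul_sum hi (measurable_pi_apply j) (hPm _ r hr (ha1 j))
    rw [this, h.mean i j, zero_mul]
  -- second order
  have hi2 : ∀ j k, Integrable
      (fun ω => ξ i ω j * ξ i ω k * heatProd t (Pi.single j 1 + Pi.single k 1) r (S ω)) P :=
    fun j k => (hPi _ (ha2 j k)).bdd_mul (c := β * β)
      ((h.meas_coord i j).mul (h.meas_coord i k)).aestronglyMeasurable
      (ae_of_all _ fun ω => by
        rw [norm_mul]
        exact mul_le_mul (h.bound i ω j) (h.bound i ω k) (norm_nonneg _) hβ)
  have h2 : ∀ j k, ∫ ω, ξ i ω j * ξ i ω k *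
      heatProd t (Pi.single j 1 + Pi.single k 1) r (S ω) ∂P =
      if j = k then v i * ∫ ω, heatProd t (Pi.single j 1 + Pi.single j 1) r (S ω) ∂P else 0 := by
    intro j k
    have := h.integral_mul_sum hi (f := fun x => x j * x k) (by fun_prop) (hPm _ r hr (ha2 j k))
    rw [this, h.cov i j k]
    split_ifs with hjk
    · rw [hjk]
    · rw [zero_mul]
  -- remainders
  set R1 : Ω → ℝ := fun ω => heatProd t 0 r (S ω + ξ i ω) - heatProd t 0 r (S ω)
    - ∑ j, ξ i ω j * heatProd t (Pi.single j 1) r (S ω)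
    - (∑ j, ∑ k, ξ i ω j * ξ i ω k * heatProd t (Pi.single j 1 + Pi.single k 1) r (S ω)) / 2
    with hR1
  set R2 : Ω → ℝ := fun ω => heatProd t 0 (r + v i) (S ω) - heatProd t 0 r (S ω)
    - v i * ((∑ j, heatProd t (Pi.single j 1 + Pi.single j 1) r (S ω)) / 2) with hR2
  have hI1 : ∫ ω, R1 ω ∂P = ∫ ω, heatProd t 0 r (S ω + ξ i ω) ∂P - ∫ ω, heatProd t 0 r (S ω) ∂P
      - (∑ j, v i * ∫ ω, heatProd t (Pi.single j 1 + Pi.single j 1) r (S ω) ∂P) / 2 := by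
    have e1 : Integrable (fun ω => ∑ j, ξ i ω j * heatProd t (Pi.single j 1) r (S ω)) P :=
      integrable_finsetSum _ fun j _ => hi1 j
    have e2 : ∀ j, Integrable (fun ω => ∑ k, ξ i ω j * ξ i ω k *
        heatProd t (Pi.single j 1 + Pi.single k 1) r (S ω)) P := fun j =>
      integrable_finsetSum _ fun k _ => hi2 j k
    have e3 : Integrable (fun ω => (∑ j, ∑ k, ξ i ω j * ξ i ω k *
        heatProd t (Pi.single j 1 + Pi.single k 1) r (S ω)) / 2) P :=
      (integrable_finsetSum _ fun j _ => e2 j).div_const 2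
    have e4 : Integrable (fun ω => heatProd t 0 r (S ω + ξ i ω) - heatProd t 0 r (S ω)) P :=
      hFi'.sub (hFi r hr)
    have e5 : Integrable (fun ω => heatProd t 0 r (S ω + ξ i ω) - heatProd t 0 r (S ω)
        - ∑ j, ξ i ω j * heatProd t (Pi.single j 1) r (S ω)) P := e4.sub e1
    simp only [hR1]
    rw [integral_sub e5 e3, integral_sub e4 e1,
      integral_sub hFi' (hFi r hr), integral_finsetSum _ fun j _ => hi1 j, integral_div,
      integral_finsetSum _ fun j _ => e2 j, Finset.sum_eq_zero fun j _ => h1 j, sub_zero]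
    congr 2
    refine Finset.sum_congr rfl fun j _ => ?_
    rw [integral_finsetSum _ fun k _ => hi2 j k]
    simp only [h2, Finset.sum_ite_eq, Finset.mem_univ, if_true]
  have hI2 : ∫ ω, R2 ω ∂P = ∫ ω, heatProd t 0 (r + v i) (S ω) ∂P - ∫ ω, heatProd t 0 r (S ω) ∂P
      - (∑ j, v i * ∫ ω, heatProd t (Pi.single j 1 + Pi.single j 1) r (S ω) ∂P) / 2 := by
    have e1 : Integrable (fun ω => ∑ j, heatProd t (Pi.single j 1 + Pi.single j 1) r (S ω)) P :=
      integrable_finsetSum _ fun j _ => hPi _ (ha2 j j)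
    have hrv : 0 < r + v i := by linarith
    have e4 : Integrable (fun ω => heatProd t 0 (r + v i) (S ω) - heatProd t 0 r (S ω)) P :=
      (hFi _ hrv).sub (hFi r hr)
    simp only [hR2]
    rw [integral_sub e4 ((e1.div_const 2).const_mul _), integral_sub (hFi _ hrv) (hFi r hr),
      integral_const_mul, integral_div,
      integral_finsetSum _ fun j _ => hPi _ (ha2 j j), ← Finset.mul_sum]
    ring
  have hi1' : Integrable R1 P := by
    refine (((hFi'.sub (hFi r hr)).sub (integrable_finsetSum _ fun j _ => hi1 j))).sub
      (Integrable.div_const ?_ 2)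
    exact integrable_finsetSum _ fun j _ => integrable_finsetSum _ fun k _ => hi2 j k
  have hi2' : Integrable R2 P :=
    ((hFi _ (by linarith)).sub (hFi r hr)).sub
      (((integrable_finsetSum _ fun j _ => hPi _ (ha2 j j)).div_const 2).const_mul _)
  set L := ∫ ω, layer t r (S ω) ∂P with hL
  have hL0 : 0 ≤ L := integral_nonneg fun ω => layer_nonneg t hr _
  -- One factor of the cubic remainder is bounded by `β`; the other two leave squares `ξ i ω j ^ 2`,
  -- which are independent of the partial sum and integrate to `v i`.
  have hb1 : |∫ ω, R1 ω ∂P| ≤ 3 * m ^ 3 * 384 ^ m * β * v i / √r ^ 3 * L := by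
    have hi3 : ∀ j, Integrable (fun ω => ξ i ω j ^ 2 * layer t r (S ω)) P := fun j =>
      hli.bdd_mul (c := β ^ 2) ((h.meas_coord i j).pow_const 2).aestronglyMeasurable
        (ae_of_all _ fun ω => by
          rw [Real.norm_eq_abs, abs_of_nonneg (sq_nonneg _)]; exact h.sq_le i ω j)
    calc |∫ ω, R1 ω ∂P| ≤ ∫ ω, |R1 ω| ∂P := abs_integral_le_integral_abs
      _ ≤ ∫ ω, 3 * 384 ^ m / √r ^ 3 * (m ^ 2 * β) * ∑ j, ξ i ω j ^ 2 * layer t r (S ω) ∂P := by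
          refine integral_mono hi1'.abs ((integrable_finsetSum _ fun j _ => hi3 j).const_mul _)
            fun ω => ?_
          have := heatProd_expand ht hr (S ω) (ξ i ω) fun j => (h.sq_le i ω j).trans hβr
          refine this.trans ?_
          have h3 := sum_abs_pow_three_le (h.bound i ω)
          have := layer_nonneg t hr (S ω)
          rw [← Finset.sum_mul]
          calc _ ≤ 3 * 384 ^ m / √r ^ 3 * (m ^ 2 * β * ∑ j, ξ i ω j ^ 2) * layer t r (S ω) := by
                gcongr
            _ = _ := by ring
      _ = _ := by
          rw [integral_const_mul, integral_finsetSum _ fun j _ => hi3 j]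
          have : ∀ j, ∫ ω, ξ i ω j ^ 2 * layer t r (S ω) ∂P = v i * L := fun j => by
            have := h.integral_mul_sum hi (f := fun x => x j ^ 2) (by fun_prop) hlm
            rw [this, h.integral_sq i j]
          simp only [this]
          simp; ring
  have hb2 : |∫ ω, R2 ω ∂P| ≤ m ^ 2 * 384 ^ m * β * v i / √r ^ 3 * L := by
    -- The inequalities `v i ≤ β ^ 2` and `β ≤ √r` bring the time remainder to the same form as the
    -- spatial one.
    have hk : v i ^ 2 / r ^ 2 ≤ β * v i / √r ^ 3 := by
      have e : r ^ 2 = √r ^ 3 * √r := by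
        rw [← pow_succ, show √r ^ (3 + 1) = (√r ^ 2) ^ 2 by ring, Real.sq_sqrt hr.le]
      have hβs : β ≤ √r := Real.le_sqrt_of_sq_le hβr
      rw [e, div_le_div_iff₀ (by positivity) (by positivity)]
      have : v i ^ 2 ≤ β * v i * √r := by
        calc v i ^ 2 = v i * v i := by ring
          _ ≤ β ^ 2 * v i := by gcongr
          _ = β * v i * β := by ring
          _ ≤ _ := by gcongr
      calc v i ^ 2 * √r ^ 3 ≤ (β * v i * √r) * √r ^ 3 := by gcongr
        _ = _ := by ring
    calc |∫ ω, R2 ω ∂P| ≤ ∫ ω, |R2 ω| ∂P := abs_integral_le_integral_abs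
      _ ≤ ∫ ω, m ^ 2 * 384 ^ m * v i ^ 2 / r ^ 2 * layer t r (S ω) ∂P :=
          integral_mono hi2'.abs (hli.const_mul _) fun ω =>
            heatProd_expand_time ht hr hv0 (hvβ.trans hβr) (S ω)
      _ = m ^ 2 * 384 ^ m * (v i ^ 2 / r ^ 2) * L := by rw [integral_const_mul]; ring
      _ ≤ m ^ 2 * 384 ^ m * (β * v i / √r ^ 3) * L := by gcongr
      _ = _ := by ring
  have e : ∫ ω, heatProd t 0 r (S ω + ξ i ω) ∂P - ∫ ω, heatProd t 0 (r + v i) (S ω) ∂P =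
      ∫ ω, R1 ω ∂P - ∫ ω, R2 ω ∂P := by rw [hI1, hI2]; ring
  calc |∫ ω, heatProd t 0 r (S ω + ξ i ω) ∂P - ∫ ω, heatProd t 0 (r + v i) (S ω) ∂P|
      = |∫ ω, R1 ω ∂P - ∫ ω, R2 ω ∂P| := by rw [e]
    _ ≤ |∫ ω, R1 ω ∂P| + |∫ ω, R2 ω ∂P| := abs_sub _ _
    _ ≤ 3 * m ^ 3 * 384 ^ m * β * v i / √r ^ 3 * L + m ^ 2 * 384 ^ m * β * v i / √r ^ 3 * L :=
        add_le_add hb1 hb2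
    _ = _ := by unfold stepConst; ring

end Lindeberg

/-! ### A Berry-Esseen bound for boxes -/

section BerryEsseen

variable {Ω : Type*} {mΩ : MeasurableSpace Ω} {P : Measure Ω} [IsProbabilityMeasure P]
  {ι : Type*} {m : ℕ}

lemma integrable_layer (t : ℝ) {r : ℝ} (hr : 0 < r) {X : Ω → Fin m → ℝ} (hX : Measurable X) :
    Integrable (fun ω => layer t r (X ω)) P :=
  integrable_of_abs_le (C := 2 * m) ((continuous_layer t hr).measurable.comp hX) fun ω => by
    rw [abs_of_nonneg (layer_nonneg t hr _)]; exact layer_le t hr _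

/-- Each removed summand is traded for heat time, so `r + ∑ v` is preserved. The layer estimate
reduces the cost of a step from `β v / √r ^ 3` to a multiple of `β v / r`, and these costs telescope
to a logarithm. The condition `1 ≤ r + ∑ v` ensures that either the heat time or the remaining
variance is of order one. -/
theorem lindeberg_induction [DecidableEq ι] {ξ : ι → Ω → Fin m → ℝ} {β : ℝ} {v : ι → ℝ}
    (h : IsotropicArray P ξ β v) (hm : 0 < m) {t : ℝ} (ht : 0 ≤ t) (hβ : 0 ≤ β) (s : Finset ι) :
    ∀ {r : ℝ}, 0 < r → β ^ 2 ≤ r → 1 ≤ r + ∑ i ∈ s, v i →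
    |∫ ω, heatProd t 0 r (∑ j ∈ s, ξ j ω) ∂P - heatProd (m := m) t 0 (r + ∑ i ∈ s, v i) 0| ≤
      stepConst m * (48 * m) * β * (Real.log (r + ∑ i ∈ s, v i) - Real.log r) := by
  induction s using Finset.induction_on with
  | empty => intro r hr _ _; simp
  | insert i s hi ih =>
    intro r hr hβr h1
    have hs : 0 < √r := Real.sqrt_pos.2 hr
    have hv0 := h.var_nonneg hm i
    have hvβ := h.var_le hm i
    have hC : 0 ≤ stepConst m := by unfold stepConst; positivity
    rw [Finset.sum_insert hi] at h1 ⊢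
    have hstep := lindeberg_step h hm ht hi hβ hr hβr
    have hih := ih (r := r + v i) (by linarith) (by linarith) (by linarith)
    set V := ∑ i ∈ s, v i with hV
    have hV0 : 0 ≤ V := Finset.sum_nonneg fun i _ => h.var_nonneg hm i
    have e : r + v i + V = r + (v i + V) := by ring
    rw [e] at hih
    have hm1 : (1:ℝ) ≤ m := by exact_mod_cast hm
    -- If the remaining variance `V` is at most `1 / 4`, then `v i ≤ r` gives `2 r ≥ 3 / 4`, so `√r
    -- ≥ 1 / 2` and the trivial bound `2 m` on the layer suffices. Otherwise `√V ≥ 1 / 2` and the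
    -- concentration inequality applies.
    have hL : ∫ ω, layer t r (∑ j ∈ s, ξ j ω) ∂P ≤ 24 * m * √r := by
      by_cases hc : V ≤ 1 / 4
      · have hr4 : (1 / 2) ^ 2 ≤ r := by nlinarith
        have hs2 : 1 / 2 ≤ √r := Real.le_sqrt_of_sq_le hr4
        have hlay : ∀ ω, layer t r (∑ j ∈ s, ξ j ω) ≤ 2 * m := fun ω => layer_le t hr _
        calc _ ≤ ∫ _, (2 * m : ℝ) ∂P := integral_mono
              (integrable_layer t hr (h.measurable_sum s))
              (integrable_const _) hlay
          _ = 2 * m := by simp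
          _ ≤ _ := by nlinarith
      · have hσ : 1 / 2 ≤ √V := Real.le_sqrt_of_sq_le (by linarith)
        refine (h.integral_layer_le s hr hβr (by linarith : 0 < √V)
          (Real.sq_sqrt hV0).symm t).trans ?_
        rw [div_le_iff₀ (by linarith)]
        have : 0 ≤ (m:ℝ) * √r := by positivity
        nlinarith
    -- From `1 - 1 / x ≤ log x` at `x = (r + v i) / r`; the factor 2 comes from `r + v i ≤ 2 r`.
    have hlog : v i / r ≤ 2 * (Real.log (r + v i) - Real.log r) := by
      have hl := Real.one_sub_inv_le_log_of_pos (x := (r + v i) / r) (by positivity)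
      rw [Real.log_div (by positivity) hr.ne', inv_div] at hl
      have e2 : 1 - r / (r + v i) = v i / (r + v i) := by field_simp; ring
      have e3 : v i / (2 * r) ≤ v i / (r + v i) := by gcongr; linarith
      have e4 : v i / r = 2 * (v i / (2 * r)) := by field_simp
      linarith
    have hst : |∫ ω, heatProd t 0 r (∑ j ∈ s, ξ j ω + ξ i ω) ∂P -
        ∫ ω, heatProd t 0 (r + v i) (∑ j ∈ s, ξ j ω) ∂P| ≤
        stepConst m * (48 * m) * β * (Real.log (r + v i) - Real.log r) := by
      calc _ ≤ _ := hstep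
        _ ≤ stepConst m * β * v i / √r ^ 3 * (24 * m * √r) := by gcongr
        _ = stepConst m * (24 * m) * β * (v i / r) := by
            have : r = √r ^ 2 := (Real.sq_sqrt hr.le).symm
            have e5 : v i / r = v i / √r ^ 2 := by rw [Real.sq_sqrt hr.le]
            rw [e5]; field_simp
        _ ≤ stepConst m * (24 * m) * β * (2 * (Real.log (r + v i) - Real.log r)) := by gcongr
        _ = _ := by ring
    have e6 : ∀ ω, ∑ j ∈ insert i s, ξ j ω = ∑ j ∈ s, ξ j ω + ξ i ω := fun ω => by
      rw [Finset.sum_insert hi, add_comm]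
    simp only [e6]
    calc _ ≤ |∫ ω, heatProd t 0 r (∑ j ∈ s, ξ j ω + ξ i ω) ∂P -
          ∫ ω, heatProd t 0 (r + v i) (∑ j ∈ s, ξ j ω) ∂P| +
          |∫ ω, heatProd t 0 (r + v i) (∑ j ∈ s, ξ j ω) ∂P - heatProd t 0 (r + (v i + V)) 0| :=
          abs_sub_le _ _ _
      _ ≤ _ := by linarith

lemma abs_prod_sub_prod_le {ι : Type*} [DecidableEq ι] (s : Finset ι) {a b : ι → ℝ}
    (ha : ∀ i, |a i| ≤ 1) (hb : ∀ i, |b i| ≤ 1) :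
    |∏ i ∈ s, a i - ∏ i ∈ s, b i| ≤ ∑ i ∈ s, |a i - b i| := by
  induction s using Finset.induction_on with
  | empty => simp
  | insert i s hi ih =>
    rw [Finset.prod_insert hi, Finset.prod_insert hi, Finset.sum_insert hi]
    have hp : |∏ i ∈ s, a i| ≤ 1 := by
      rw [Finset.abs_prod]
      exact Finset.prod_le_one (fun _ _ => abs_nonneg _) fun j _ => ha j
    have e : a i * ∏ i ∈ s, a i - b i * ∏ i ∈ s, b i =
        (a i - b i) * ∏ i ∈ s, a i + b i * (∏ i ∈ s, a i - ∏ i ∈ s, b i) := by ring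
    rw [e]
    refine (abs_add_le _ _).trans ?_
    rw [abs_mul, abs_mul]
    have h1 := mul_le_mul_of_nonneg_left hp (abs_nonneg (a i - b i))
    have h2 := mul_le_mul_of_nonneg_right (hb i) (abs_nonneg (∏ i ∈ s, a i - ∏ i ∈ s, b i))
    linarith

/-- The indicator of the box `[-t, t] ^ m`. -/
noncomputable def boxInd (t : ℝ) (w : Fin m → ℝ) : ℝ := ∏ j, if |w j| ≤ t then 1 else 0

lemma boxInd_eq (t : ℝ) (w : Fin m → ℝ) :
    boxInd t w = {w : Fin m → ℝ | ∀ j, |w j| ≤ t}.indicator (fun _ => (1 : ℝ)) w := by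
  unfold boxInd
  by_cases h : ∀ j, |w j| ≤ t
  · rw [Set.indicator_of_mem (by exact h)]
    exact Finset.prod_eq_one fun j _ => by rw [if_pos (h j)]
  · rw [Set.indicator_of_notMem (by exact h)]
    push Not at h
    obtain ⟨j, hj⟩ := h
    exact Finset.prod_eq_zero (Finset.mem_univ j) (by rw [if_neg (not_le.2 hj)])

lemma measurableSet_box (t : ℝ) : MeasurableSet {w : Fin m → ℝ | ∀ j, |w j| ≤ t} := by
  rw [Set.ofPred_forall]
  exact MeasurableSet.iInter fun j => measurableSet_le (by fun_prop) measurable_const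

lemma abs_boxInd_sub_le {t r : ℝ} (ht : 0 ≤ t) (hr : 0 < r) (w : Fin m → ℝ) :
    |boxInd t w - heatProd t 0 r w| ≤ layer t r w := by
  unfold boxInd heatProd layer
  refine (abs_prod_sub_prod_le _ (fun j => ?_) fun j => ?_).trans
    (Finset.sum_le_sum fun j _ => abs_indicator_sub_heatBox_le hr ht (w j))
  · split_ifs <;> simp
  · rw [Pi.zero_apply, abs_of_nonneg (heatBox_zero_nonneg ht _ _)]
    exact heatBox_zero_le_one _ _ _

lemma heatProd_origin {t : ℝ} (ht : 0 ≤ t) :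
    heatProd (m := m) t 0 1 0 = (gaussianReal 0 1).real (Set.Icc (-t) t) ^ m := by
  unfold heatProd heatBox
  simp [heatPsi_zero, gaussianReal_Icc (-t) t (by linarith)]

lemma abs_heatProd_time_le {t : ℝ} (ht : 0 ≤ t) {v : ℝ} (hv : 0 ≤ v) (hv1 : v ≤ 1) :
    |heatProd (m := m) t 0 (1 + v) 0 - heatProd (m := m) t 0 1 0| ≤ (2 * m ^ 3 + m ^ 2) * 384 ^ m * v := by
  have h := heatProd_expand_time (m := m) ht one_pos hv hv1 0
  have hl := layer_le (m := m) t one_pos 0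
  have hl0 := layer_nonneg (m := m) t one_pos 0
  have h2 : |∑ j : Fin m, heatProd t (Pi.single j 1 + Pi.single j 1) 1 (0 : Fin m → ℝ)| ≤
      ∑ _j : Fin m, 384 ^ m * (2 * m : ℝ) := by
    refine (Finset.abs_sum_le_sum_abs _ _).trans (Finset.sum_le_sum fun j _ => ?_)
    have hb := abs_heatProd_le ht (a := Pi.single j 1 + Pi.single j 1) (fun i => by
      have := single_le_one j i
      simp only [Pi.add_apply]; omega) one_pos (0 : Fin m → ℝ) (i := j) (by simp)
    simp only [Real.sqrt_one, one_pow, div_one] at hb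
    exact hb.trans (by gcongr)
  simp only [Finset.sum_const, Finset.card_univ, Fintype.card_fin, nsmul_eq_mul] at h2
  set A := ∑ j : Fin m, heatProd t (Pi.single j 1 + Pi.single j 1) 1 (0 : Fin m → ℝ)
  set x := heatProd (m := m) t 0 (1 + v) 0 - heatProd t 0 1 0
  calc |x| = |(x - v * (A / 2)) + v * (A / 2)| := by congr 1; ring
    _ ≤ |x - v * (A / 2)| + |v * (A / 2)| := abs_add_le _ _
    _ ≤ m ^ 2 * 384 ^ m * v ^ 2 / 1 ^ 2 * layer t 1 0 + v * (m * (384 ^ m * (2 * m)) / 2) := by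
        refine add_le_add h ?_
        rw [abs_mul, abs_of_nonneg hv, abs_div, abs_two]
        gcongr
    _ ≤ m ^ 2 * 384 ^ m * (v * 1) / 1 ^ 2 * (2 * m) + v * (m * (384 ^ m * (2 * m)) / 2) := by
        rw [sq v]
        gcongr
    _ = _ := by ring

/-- The constant in the Berry-Esseen bound. -/
noncomputable def berryConst (m : ℕ) : ℝ :=
  stepConst m * (48 * m) * 2 + (2 * m ^ 3 + m ^ 2) * 384 ^ m + 12 * m

lemma berryConst_pos (hm : 0 < m) : 0 < berryConst m := by
  unfold berryConst stepConst; positivity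

/-- The flow starts at time `β ^ 2`, the smallest at which one summand stays within the width of the
layer. Three errors occur: smoothing the indicator (the mass of a layer of width `β`), the Lindeberg
replacement, and the surplus time `β ^ 2` at the end. At time 1 and at the origin the flow is the
Gaussian mass of the box. -/
theorem berry_esseen_box [Fintype ι] {ξ : ι → Ω → Fin m → ℝ} {β : ℝ} {v : ι → ℝ}
    (h : IsotropicArray P ξ β v) (hm : 0 < m) {t : ℝ} (ht : 0 ≤ t) (hβ : 0 < β) (hβ1 : β ≤ 1)
    (hv : ∑ i, v i = 1) :
    |P.real {ω | ∀ j, |(∑ i, ξ i ω) j| ≤ t} - (gaussianReal 0 1).real (Set.Icc (-t) t) ^ m| ≤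
      berryConst m * β * (1 + Real.log (1 / β)) := by
  classical
  have hr : 0 < β ^ 2 := by positivity
  have hW := h.measurable_sum Finset.univ
  set W : Ω → Fin m → ℝ := fun ω => ∑ i, ξ i ω with hWdef
  have hC : 0 ≤ stepConst m := by unfold stepConst; positivity
  have h1 := lindeberg_induction h hm ht hβ.le Finset.univ hr le_rfl (by rw [hv]; linarith)
  rw [hv] at h1
  have h2 := h.integral_layer_le Finset.univ hr le_rfl one_pos (by rw [hv]; norm_num) t
  rw [Real.sqrt_sq hβ.le, div_one] at h2
  have h3 := abs_heatProd_time_le (m := m) ht hr.le (pow_le_one₀ hβ.le hβ1)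
  rw [heatProd_origin ht, add_comm (1:ℝ)] at h3
  have hbi : Integrable (fun ω => boxInd t (W ω)) P := by
    simp only [boxInd_eq]
    exact integrable_of_abs_le (C := 1)
      ((measurable_const.indicator (measurableSet_box t)).comp hW) fun ω => by
        simp only [Set.indicator_apply]; split_ifs <;> simp
  have hFi : Integrable (fun ω => heatProd t 0 (β ^ 2) (W ω)) P :=
    integrable_of_abs_le (C := 1) ((continuous_heatProd t (by simp) hr).measurable.comp hW)
      fun ω => abs_heatProd_zero_le ht _ _
  have hli : Integrable (fun ω => layer t (β ^ 2) (W ω)) P := integrable_layer t hr hW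
  have hP : P.real {ω | ∀ j, |W ω j| ≤ t} = ∫ ω, boxInd t (W ω) ∂P := by
    simp only [boxInd_eq]
    exact (integral_indicator_one (hW (measurableSet_box t))).symm
  have h4 : |∫ ω, boxInd t (W ω) ∂P - ∫ ω, heatProd t 0 (β ^ 2) (W ω) ∂P| ≤ 12 * m * β := by
    rw [← integral_sub hbi hFi]
    refine abs_integral_le_integral_abs.trans (le_trans ?_ h2)
    exact integral_mono (hbi.sub hFi).abs hli fun ω => abs_boxInd_sub_le ht hr _
  have hlog : Real.log (β ^ 2 + 1) - Real.log (β ^ 2) ≤ 2 * (1 + Real.log (1 / β)) := by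
    have := Real.log_le_sub_one_of_pos (x := β ^ 2 + 1) (by positivity)
    have hb2 : β ^ 2 ≤ 1 := pow_le_one₀ hβ.le hβ1
    rw [Real.log_pow, one_div, Real.log_inv]
    push_cast
    linarith
  have hlog0 : 0 ≤ Real.log (1 / β) := Real.log_nonneg (by rw [le_div_iff₀ hβ]; linarith)
  have hb2 : β ^ 2 ≤ β := by nlinarith
  change |P.real {ω | ∀ j, |W ω j| ≤ t} - _| ≤ _
  rw [hP]
  have h1' : |∫ ω, heatProd t 0 (β ^ 2) (W ω) ∂P - heatProd (m := m) t 0 (β ^ 2 + 1) 0| ≤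
      stepConst m * (48 * m) * 2 * β * (1 + Real.log (1 / β)) := by
    refine h1.trans ?_
    calc _ ≤ stepConst m * (48 * m) * β * (2 * (1 + Real.log (1 / β))) := by gcongr
      _ = _ := by ring
  have h3' : (2 * m ^ 3 + m ^ 2) * 384 ^ m * β ^ 2 ≤
      (2 * m ^ 3 + m ^ 2) * 384 ^ m * β * (1 + Real.log (1 / β)) := by
    rw [mul_assoc _ β]
    gcongr
    nlinarith [mul_nonneg hβ.le hlog0]
  have h4' : 12 * m * β ≤ 12 * m * β * (1 + Real.log (1 / β)) := by
    have : 0 ≤ 12 * m * β * Real.log (1 / β) := by positivity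
    linarith
  have tri := abs_sub_le (∫ ω, boxInd t (W ω) ∂P) (∫ ω, heatProd t 0 (β ^ 2) (W ω) ∂P)
    ((gaussianReal 0 1).real (Set.Icc (-t) t) ^ m)
  have tri2 := abs_sub_le (∫ ω, heatProd t 0 (β ^ 2) (W ω) ∂P) (heatProd (m := m) t 0 (β ^ 2 + 1) 0)
    ((gaussianReal 0 1).real (Set.Icc (-t) t) ^ m)
  have e : berryConst m * β * (1 + Real.log (1 / β)) =
      stepConst m * (48 * m) * 2 * β * (1 + Real.log (1 / β)) +
      (2 * m ^ 3 + m ^ 2) * 384 ^ m * β * (1 + Real.log (1 / β)) +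
      12 * m * β * (1 + Real.log (1 / β)) := by unfold berryConst; ring
  rw [e]
  linarith

end BerryEsseen

/-! ### An exponential tail bound -/

section Bernstein

variable {Ω : Type*} {mΩ : MeasurableSpace Ω} {P : Measure Ω} [IsProbabilityMeasure P] {ι : Type*}

/-- Chernoff's bound with `exp y ≤ 1 + y + y ^ 2` for `|y| ≤ 1`; the condition `l * M ≤ 1` keeps
every exponent in this range. -/
lemma bernstein_one_sided {h : ι → Ω → ℝ} (hind : iIndepFun h P)
    (hm : ∀ i, Measurable (h i)) {M : ℝ} (hb : ∀ i ω, |h i ω| ≤ M) (h0 : ∀ i, ∫ ω, h i ω ∂P = 0)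
    {w : ℝ} (hw : ∀ i, ∫ ω, h i ω ^ 2 ∂P ≤ w) (s : Finset ι) {l : ℝ} (hl : 0 ≤ l)
    (hlM : l * M ≤ 1) (u : ℝ) :
    P.real {ω | u ≤ ∑ i ∈ s, h i ω} ≤ Real.exp (-l * u + l ^ 2 * (s.card * w)) := by
  have hbd : ∀ i ω, |l * h i ω| ≤ 1 := fun i ω => by
    rw [abs_mul, abs_of_nonneg hl]
    exact (mul_le_mul_of_nonneg_left (hb i ω) hl).trans hlM
  have hmgf : ∀ i, mgf (h i) P l ≤ Real.exp (l ^ 2 * w) := by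
    intro i
    have hi1 : Integrable (h i) P := integrable_of_abs_le (hm i) (hb i)
    have hi2 : Integrable (fun ω => h i ω ^ 2) P := (memLp_of_abs_le (hm i) (hb i) 2).integrable_sq
    have hi3 : Integrable (fun ω => 1 + l * h i ω) P := (integrable_const _).add (hi1.const_mul _)
    calc mgf (h i) P l = ∫ ω, Real.exp (l * h i ω) ∂P := rfl
      _ ≤ ∫ ω, (1 + l * h i ω + l ^ 2 * h i ω ^ 2) ∂P := by
          refine integral_mono (integrable_of_abs_le (C := Real.exp 1)
            (by have := hm i; fun_prop) fun ω => ?_) (hi3.add (hi2.const_mul _)) fun ω => ?_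
          · rw [abs_of_pos (Real.exp_pos _)]
            exact Real.exp_le_exp.2 ((le_abs_self _).trans (hbd i ω))
          · have := (abs_le.1 (Real.abs_exp_sub_one_sub_id_le (hbd i ω))).2
            simp only
            linarith [mul_pow l (h i ω) 2]
      _ = 1 + l ^ 2 * ∫ ω, h i ω ^ 2 ∂P := by
          rw [integral_add hi3 (hi2.const_mul _),
            integral_add (integrable_const _) (hi1.const_mul _), integral_const_mul,
            integral_const_mul, h0 i]
          simp
      _ ≤ 1 + l ^ 2 * w := by gcongr; exact hw i
      _ ≤ _ := by linarith [Real.add_one_le_exp (l ^ 2 * w)]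
  have hS : Measurable (∑ i ∈ s, h i) := by
    rw [Finset.sum_fn]; exact Finset.measurable_sum _ fun i _ => hm i
  have hint : Integrable (fun ω => Real.exp (l * (∑ i ∈ s, h i) ω)) P := by
    refine integrable_of_abs_le (C := Real.exp (∑ _i ∈ s, 1)) (by fun_prop) fun ω => ?_
    rw [abs_of_pos (Real.exp_pos _), Finset.sum_apply, Finset.mul_sum]
    exact Real.exp_le_exp.2 (Finset.sum_le_sum fun i _ => (le_abs_self _).trans (hbd i ω))
  have key := measure_ge_le_exp_mul_mgf u hl hint
  rw [hind.mgf_sum hm] at key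
  simp only [Finset.sum_apply] at key
  refine key.trans ?_
  rw [Real.exp_add]
  gcongr
  calc ∏ i ∈ s, mgf (h i) P l ≤ ∏ _i ∈ s, Real.exp (l ^ 2 * w) :=
        Finset.prod_le_prod (fun _ _ => mgf_nonneg) fun i _ => hmgf i
    _ = _ := by
        rw [Finset.prod_const, ← Real.exp_nat_mul]; congr 1; ring

theorem bernstein {h : ι → Ω → ℝ} (hind : iIndepFun h P)
    (hm : ∀ i, Measurable (h i)) {M : ℝ} (hb : ∀ i ω, |h i ω| ≤ M) (h0 : ∀ i, ∫ ω, h i ω ∂P = 0)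
    {w : ℝ} (hw : ∀ i, ∫ ω, h i ω ^ 2 ∂P ≤ w) (s : Finset ι) {l : ℝ} (hl : 0 ≤ l)
    (hlM : l * M ≤ 1) (u : ℝ) :
    P.real {ω | u ≤ |∑ i ∈ s, h i ω|} ≤ 2 * Real.exp (-l * u + l ^ 2 * (s.card * w)) := by
  have h1 := bernstein_one_sided hind hm hb h0 hw s hl hlM u
  have h2 := bernstein_one_sided (h := fun i ω => -h i ω)
    (hind.comp (fun _ x => -x) fun _ => measurable_neg) (fun i => (hm i).neg)
    (fun i ω => by rw [abs_neg]; exact hb i ω) (fun i => by rw [integral_neg, h0 i, neg_zero])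
    (fun i => by simpa using hw i) s hl hlM u
  have hsub : {ω | u ≤ |∑ i ∈ s, h i ω|} ⊆
      {ω | u ≤ ∑ i ∈ s, h i ω} ∪ {ω | u ≤ ∑ i ∈ s, -h i ω} := by
    intro ω hω
    simp only [Set.mem_ofPred_eq, Set.mem_union, Finset.sum_neg_distrib] at hω ⊢
    exact le_abs.1 hω
  calc _ ≤ _ := measureReal_mono hsub
    _ ≤ _ := measureReal_union_le _ _
    _ ≤ _ := by linarith

/-- The mean of `N ≥ 1` centred independent variables exceeds `2 √(w L / N)` with
probability at most `2 exp (-L)`. -/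
theorem bernstein_mean {h : ι → Ω → ℝ} (hind : iIndepFun h P)
    (hm : ∀ i, Measurable (h i)) {M : ℝ} (hb : ∀ i ω, |h i ω| ≤ M) (h0 : ∀ i, ∫ ω, h i ω ∂P = 0)
    {w : ℝ} (hw0 : 0 < w) (hw : ∀ i, ∫ ω, h i ω ^ 2 ∂P ≤ w) {s : Finset ι} (hs : s.Nonempty)
    {L : ℝ} (hL : 0 ≤ L) (hM : 0 ≤ M) (hLM : L * M ^ 2 ≤ s.card * w) :
    P.real {ω | 2 * √(w * L / s.card) ≤ |(s.card : ℝ)⁻¹ * ∑ i ∈ s, h i ω|} ≤ 2 * Real.exp (-L) := by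
  have hN : (0:ℝ) < s.card := by exact_mod_cast hs.card_pos
  set N : ℝ := (s.card : ℝ)
  -- The minimizer of `-l * u + l ^ 2 * (N * w)` at `u = 2 √(N w L)`, with minimum `-L`. The
  -- hypothesis `hLM` says that this `l` satisfies `l * M ≤ 1`.
  set l := √(L / (N * w)) with hl
  have hl2 : l ^ 2 = L / (N * w) := Real.sq_sqrt (by positivity)
  have hlM : l * M ≤ 1 := by
    rw [← abs_of_nonneg (by positivity : 0 ≤ l * M), ← sq_le_one_iff_abs_le_one, mul_pow, hl2,
      div_mul_eq_mul_div, div_le_one (by positivity)]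
    exact hLM
  have key := bernstein hind hm hb h0 hw s (Real.sqrt_nonneg _) hlM (N * (2 * √(w * L / N)))
  have e1 : l * √(w * L / N) = L / N := by
    rw [hl, ← Real.sqrt_mul (by positivity)]
    have : L / (N * w) * (w * L / N) = (L / N) ^ 2 := by field_simp
    rw [this, Real.sqrt_sq (by positivity)]
  have e2 : -l * (N * (2 * √(w * L / N))) + l ^ 2 * (N * w) = -L := by
    rw [hl2]
    calc _ = -2 * N * (l * √(w * L / N)) + L / (N * w) * (N * w) := by ring
      _ = _ := by rw [e1]; field_simp; ring
  rw [e2] at key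
  refine le_trans (measureReal_mono fun ω hω => ?_) key
  simp only [Set.mem_ofPred_eq] at hω ⊢
  rw [abs_mul, abs_of_pos (inv_pos.2 hN), le_inv_mul_iff₀ hN] at hω
  exact hω

end Bernstein

/-! ### Square roots of matrices -/

section MatrixSqrt

variable {m : ℕ}

open scoped MatrixOrder in
lemma quadForm_cfc_le {V : Matrix (Fin m) (Fin m) ℝ} {f g : ℝ → ℝ}
    (hf : Continuous f) (hg : Continuous g) (h : ∀ x ∈ spectrum ℝ V, f x ≤ g x)
    (x : Fin m → ℝ) : x ⬝ᵥ (cfc f V *ᵥ x) ≤ x ⬝ᵥ (cfc g V *ᵥ x) := by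
  have h1 : cfc f V ≤ cfc g V := cfc_mono h hf.continuousOn hg.continuousOn
  have h2 := (Matrix.le_iff.1 h1).dotProduct_mulVec_nonneg x
  simp only [star_trivial, sub_mulVec, dotProduct_sub] at h2
  linarith

lemma quadForm_cfc_const {V : Matrix (Fin m) (Fin m) ℝ} (hV : V.IsHermitian) (c : ℝ)
    (x : Fin m → ℝ) : x ⬝ᵥ (cfc (fun _ => c) V *ᵥ x) = c * (x ⬝ᵥ x) := by
  rw [cfc_const c V hV.isSelfAdjoint, Algebra.algebraMap_eq_smul_one, smul_mulVec, one_mulVec, dotProduct_smul,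
    smul_eq_mul]

lemma quadForm_ge {V : Matrix (Fin m) (Fin m) ℝ} (hV : V.IsHermitian) {a : ℝ}
    (h : ∀ x ∈ spectrum ℝ V, a ≤ x) (x : Fin m → ℝ) : a * (x ⬝ᵥ x) ≤ x ⬝ᵥ (V *ᵥ x) := by
  have := quadForm_cfc_le (V := V) (f := fun _ => a) (g := id) continuous_const continuous_id h x
  rwa [quadForm_cfc_const hV, cfc_id ℝ V hV.isSelfAdjoint] at this

lemma quadForm_le {V : Matrix (Fin m) (Fin m) ℝ} (hV : V.IsHermitian) {b : ℝ}
    (h : ∀ x ∈ spectrum ℝ V, x ≤ b) (x : Fin m → ℝ) : x ⬝ᵥ (V *ᵥ x) ≤ b * (x ⬝ᵥ x) := by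
  have := quadForm_cfc_le (V := V) (f := id) (g := fun _ => b) continuous_id continuous_const h x
  rwa [quadForm_cfc_const hV, cfc_id ℝ V hV.isSelfAdjoint] at this

lemma quadForm_sqrt_ge {V : Matrix (Fin m) (Fin m) ℝ} (hV : V.IsHermitian) {a : ℝ}
    (h : ∀ x ∈ spectrum ℝ V, a ≤ x) (x : Fin m → ℝ) :
    √a * (x ⬝ᵥ x) ≤ x ⬝ᵥ (cfc Real.sqrt V *ᵥ x) := by
  have := quadForm_cfc_le (V := V) (f := fun _ => √a) (g := Real.sqrt) continuous_const
    Real.continuous_sqrt (fun x hx => Real.sqrt_le_sqrt (h x hx)) x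
  rwa [quadForm_cfc_const hV] at this

lemma isHermitian_sqrt (V : Matrix (Fin m) (Fin m) ℝ) : (cfc Real.sqrt V).IsHermitian :=
  (cfc_predicate (p := IsSelfAdjoint) Real.sqrt V : IsSelfAdjoint (cfc Real.sqrt V))

lemma sqrt_mul_sqrt {V : Matrix (Fin m) (Fin m) ℝ} (hV : V.PosSemidef) :
    cfc Real.sqrt V * cfc Real.sqrt V = V := by
  have hs := (posSemidef_iff_isHermitian_and_spectrum_nonneg.1 hV).2
  rw [← cfc_mul Real.sqrt Real.sqrt V Real.continuous_sqrt.continuousOn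
    Real.continuous_sqrt.continuousOn]
  conv_rhs => rw [← cfc_id ℝ V hV.1.isSelfAdjoint]
  refine cfc_congr fun x hx => ?_
  exact Real.mul_self_sqrt (hs hx)

/-- The squared Frobenius norm. -/
def frobSq (M : Matrix (Fin m) (Fin m) ℝ) : ℝ := ∑ i, ∑ j, M i j ^ 2

lemma trace_mul_mul_eq (E M : Matrix (Fin m) (Fin m) ℝ) (hE : Eᵀ = E) :
    (E * M * E).trace = ∑ j, (fun i => E i j) ⬝ᵥ (M *ᵥ fun i => E i j) := by
  have hs : ∀ i j, E i j = E j i := fun i j => by conv_lhs => rw [← hE, transpose_apply]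
  simp only [trace, diag_apply, mul_assoc, mul_apply, dotProduct, mulVec]
  refine Finset.sum_congr rfl fun j _ => Finset.sum_congr rfl fun i _ => ?_
  rw [hs j i]

/-- The square root is Lipschitz, in the Frobenius norm, away from singular matrices. -/
theorem frobSq_sub_le {A A' : Matrix (Fin m) (Fin m) ℝ} (hA : Aᵀ = A) (hA' : A'ᵀ = A') {α : ℝ}
    (hα : 0 < α) (h : ∀ x, α * (x ⬝ᵥ x) ≤ x ⬝ᵥ (A *ᵥ x)) (h' : ∀ x, 0 ≤ x ⬝ᵥ (A' *ᵥ x)) :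
    α ^ 2 * frobSq (A' - A) ≤ frobSq (A' * A' - A * A) := by
  set E := A' - A with hEdef
  set D := A' * A' - A * A with hD
  have hE : Eᵀ = E := by rw [hEdef, transpose_sub, hA, hA']
  -- The difference of the squares is linear in `E`. Pairing with `E` under the trace yields two
  -- quadratic terms, one nonnegative and one at least `α * frobSq E`; Young's inequality for the
  -- pairing of `E` and `D` then concludes.
  have hDE : D = A' * E + E * A := by rw [hD, hEdef]; noncomm_ring
  have hs : ∀ i j, E i j = E j i := fun i j => by conv_lhs => rw [← hE, transpose_apply]
  have e1 : (E * D).trace = (E * A' * E).trace + (E * A * E).trace := by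
    rw [hDE, mul_add, trace_add, ← mul_assoc, trace_mul_comm (E * A) E]
  have e2 : (E * D).trace = ∑ i, ∑ j, E i j * D i j := by
    simp only [trace, diag_apply, mul_apply]
    rw [Finset.sum_comm]
    exact Finset.sum_congr rfl fun i _ => Finset.sum_congr rfl fun j _ => by rw [hs j i]
  have e3 : 0 ≤ (E * A' * E).trace := by
    rw [trace_mul_mul_eq _ _ hE]
    exact Finset.sum_nonneg fun j _ => h' _
  have e4 : α * frobSq E ≤ (E * A * E).trace := by
    rw [trace_mul_mul_eq _ _ hE, frobSq, Finset.sum_comm, Finset.mul_sum]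
    refine Finset.sum_le_sum fun j _ => (le_of_eq ?_).trans (h _)
    simp only [dotProduct, sq]
  have e5 : ∑ i, ∑ j, E i j * D i j ≤ α / 2 * frobSq E + 1 / (2 * α) * frobSq D := by
    unfold frobSq
    simp only [Finset.mul_sum, ← Finset.sum_add_distrib]
    refine Finset.sum_le_sum fun i _ => Finset.sum_le_sum fun j _ => ?_
    have : α / 2 * E i j ^ 2 + 1 / (2 * α) * D i j ^ 2 - E i j * D i j =
        (α * E i j - D i j) ^ 2 / (2 * α) := by field_simp; ring
    have h2 : 0 ≤ (α * E i j - D i j) ^ 2 / (2 * α) := by positivity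
    linarith
  have e6 : α / 2 * frobSq E ≤ 1 / (2 * α) * frobSq D := by linarith
  calc α ^ 2 * frobSq E = 2 * α * (α / 2 * frobSq E) := by ring
    _ ≤ 2 * α * (1 / (2 * α) * frobSq D) := by gcongr
    _ = _ := by field_simp

lemma dotProduct_sq_le (x y : Fin m → ℝ) : (x ⬝ᵥ y) ^ 2 ≤ (x ⬝ᵥ x) * (y ⬝ᵥ y) := by
  have := Finset.sum_mul_sq_le_sq_mul_sq Finset.univ x y
  simpa only [dotProduct, sq] using this

lemma dotProduct_self_nonneg' (x : Fin m → ℝ) : 0 ≤ x ⬝ᵥ x :=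
  Finset.sum_nonneg fun _ _ => mul_self_nonneg _

lemma mulVec_sq_le (E : Matrix (Fin m) (Fin m) ℝ) (x : Fin m → ℝ) :
    (E *ᵥ x) ⬝ᵥ (E *ᵥ x) ≤ frobSq E * (x ⬝ᵥ x) := by
  unfold frobSq
  rw [Finset.sum_mul]
  refine Finset.sum_le_sum fun i _ => ?_
  have := dotProduct_sq_le (E i) x
  have e : E i ⬝ᵥ E i = ∑ j, E i j ^ 2 := by simp only [dotProduct, sq]
  rw [e] at this
  rw [← sq]
  exact this

lemma abs_quadForm_le (E : Matrix (Fin m) (Fin m) ℝ) (y x : Fin m → ℝ) :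
    (y ⬝ᵥ (E *ᵥ x)) ^ 2 ≤ (y ⬝ᵥ y) * (frobSq E * (x ⬝ᵥ x)) :=
  (dotProduct_sq_le _ _).trans
    (mul_le_mul_of_nonneg_left (mulVec_sq_le E x) (dotProduct_self_nonneg' y))

lemma isUnit_of_quadForm {A : Matrix (Fin m) (Fin m) ℝ} {α : ℝ} (hα : 0 < α)
    (h : ∀ x, α * (x ⬝ᵥ x) ≤ x ⬝ᵥ (A *ᵥ x)) : IsUnit A.det := by
  rw [isUnit_iff_ne_zero]
  intro h0
  obtain ⟨x, hx, hAx⟩ := exists_mulVec_eq_zero_iff.2 h0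
  have := h x
  rw [hAx, dotProduct_zero] at this
  have h1 := dotProduct_self_nonneg' x
  have h2 : x ⬝ᵥ x = 0 := by nlinarith
  exact hx (dotProduct_self_eq_zero.1 h2)

/-- Perturbation of the standardization by the inverse square root. -/
theorem inv_sqrt_perturbation {V V' : Matrix (Fin m) (Fin m) ℝ} (hV : V.PosSemidef)
    (hV' : V'.PosSemidef) {a : ℝ} (ha : 0 < a) (hVa : ∀ x ∈ spectrum ℝ V, a ≤ x) {δ : ℝ}
    (hδ : ∀ i j, |V' i j - V i j| ≤ δ) (hδa : m * δ ≤ a / 2) (hδ0 : 0 ≤ δ) (S : Fin m → ℝ)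
    {r : ℝ} (hr : 0 ≤ r) (hW : ∀ j, |((cfc Real.sqrt V)⁻¹ *ᵥ S) j| ≤ r) (j : Fin m) :
    |((cfc Real.sqrt V')⁻¹ *ᵥ S) j - ((cfc Real.sqrt V)⁻¹ *ᵥ S) j| ≤ 2 * m ^ 2 / a * δ * r := by
  set A := cfc Real.sqrt V with hA
  set A' := cfc Real.sqrt V' with hA'
  have hm : (1:ℝ) ≤ m := by
    have := j.pos; exact_mod_cast this
  have hAT : Aᵀ = A := by simpa [IsHermitian] using isHermitian_sqrt V
  have hAT' : A'ᵀ = A' := by simpa [IsHermitian] using isHermitian_sqrt V'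
  have hs : 0 < √a := Real.sqrt_pos.2 ha
  have hAq := quadForm_sqrt_ge hV.1 hVa
  have hAq' : ∀ x, 0 ≤ x ⬝ᵥ (A' *ᵥ x) := fun x => by
    have := quadForm_sqrt_ge hV'.1 (a := 0)
      (fun x hx => (posSemidef_iff_isHermitian_and_spectrum_nonneg.1 hV').2 hx) x
    simpa using this
  have hE := frobSq_sub_le hAT hAT' hs hAq hAq'
  rw [sqrt_mul_sqrt hV, sqrt_mul_sqrt hV', Real.sq_sqrt ha.le] at hE
  have hD : frobSq (V' - V) ≤ (m * δ) ^ 2 := by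
    calc frobSq (V' - V) ≤ ∑ _i : Fin m, ∑ _j : Fin m, δ ^ 2 := by
          refine Finset.sum_le_sum fun i _ => Finset.sum_le_sum fun j _ => ?_
          rw [Matrix.sub_apply]
          exact sq_le_sq' (abs_le.1 (hδ i j)).1 (abs_le.1 (hδ i j)).2
      _ = _ := by simp; ring
  set E := A' - A with hEdef
  have hE1 : frobSq E ≤ (m * δ) ^ 2 / a := by
    rw [le_div_iff₀ ha]; linarith
  have hE2 : frobSq E ≤ (√a / 2) ^ 2 := by
    refine hE1.trans ?_
    rw [div_pow, Real.sq_sqrt ha.le, div_le_iff₀ ha]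
    have : (m * δ) ^ 2 ≤ (a / 2) ^ 2 := by gcongr
    linarith
  -- The smallness condition on `δ` makes the Frobenius norm of `E` at most `√a / 2`, so `A'` keeps
  -- half of the lower bound of `A`.
  have hq' : ∀ x, √a / 2 * (x ⬝ᵥ x) ≤ x ⬝ᵥ (A' *ᵥ x) := by
    intro x
    have h1 := hAq x
    have h2 := abs_quadForm_le E x x
    have h0 := dotProduct_self_nonneg' x
    have h3 : (x ⬝ᵥ (E *ᵥ x)) ^ 2 ≤ (√a / 2 * (x ⬝ᵥ x)) ^ 2 := by
      calc _ ≤ _ := h2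
        _ ≤ (x ⬝ᵥ x) * ((√a / 2) ^ 2 * (x ⬝ᵥ x)) := by gcongr
        _ = _ := by ring
    have h4 := (abs_le.1 (abs_le_of_sq_le_sq h3 (by positivity))).1
    have e : A' = A + E := by rw [hEdef]; abel
    rw [e, add_mulVec, dotProduct_add]
    linarith
  have hU := isUnit_of_quadForm hs hAq
  have hU' := isUnit_of_quadForm (by positivity) hq'
  set W := A⁻¹ *ᵥ S with hWdef
  set W' := A'⁻¹ *ᵥ S with hWdef'
  have hAW : A *ᵥ W = S := by rw [hWdef, mulVec_mulVec, mul_nonsing_inv _ hU, one_mulVec]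
  have hAW' : A' *ᵥ W' = S := by rw [hWdef', mulVec_mulVec, mul_nonsing_inv _ hU', one_mulVec]
  -- Both vectors solve a linear system with right-hand side `S`, so the difference solves a system
  -- for `A'` driven by `E *ᵥ W`. Testing it against the difference itself and using the lower bound
  -- of `A'` controls its length.
  have hy : A' *ᵥ (W' - W) = -(E *ᵥ W) := by
    rw [mulVec_sub, hAW', hEdef, sub_mulVec, hAW]; abel
  set y := W' - W with hydef
  have hy0 := dotProduct_self_nonneg' y
  have hWW : W ⬝ᵥ W ≤ m * r ^ 2 := by
    calc W ⬝ᵥ W ≤ ∑ _j : Fin m, r ^ 2 := by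
          refine Finset.sum_le_sum fun j _ => ?_
          rw [← sq]
          exact sq_le_sq' (abs_le.1 (hW j)).1 (abs_le.1 (hW j)).2
      _ = _ := by simp
  have hyy : y ⬝ᵥ y ≤ (2 * m ^ 2 / a * δ * r) ^ 2 := by
    have h1 := hq' y
    rw [hy, dotProduct_neg] at h1
    have h2 := abs_quadForm_le E y W
    have h3 : (√a / 2 * (y ⬝ᵥ y)) ^ 2 ≤ (y ⬝ᵥ y) * (frobSq E * (W ⬝ᵥ W)) := by
      refine le_trans ?_ h2
      rw [← neg_sq (y ⬝ᵥ (E *ᵥ W))]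
      gcongr
    rcases hy0.eq_or_lt with h0 | h0
    · rw [← h0]; positivity
    · have h4 : a / 4 * (y ⬝ᵥ y) ≤ frobSq E * (W ⬝ᵥ W) := by
        rw [mul_pow, div_pow, Real.sq_sqrt ha.le] at h3
        have : (y ⬝ᵥ y) * (a / 4 * (y ⬝ᵥ y)) ≤ (y ⬝ᵥ y) * (frobSq E * (W ⬝ᵥ W)) := by linarith
        exact le_of_mul_le_mul_left this h0
      have h5 : frobSq E * (W ⬝ᵥ W) ≤ (m * δ) ^ 2 / a * (m * r ^ 2) := by
        have := dotProduct_self_nonneg' W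
        gcongr
      calc y ⬝ᵥ y = 4 / a * (a / 4 * (y ⬝ᵥ y)) := by field_simp
        _ ≤ 4 / a * ((m * δ) ^ 2 / a * (m * r ^ 2)) :=
            mul_le_mul_of_nonneg_left (h4.trans h5) (by positivity)
        _ = 4 * δ ^ 2 * r ^ 2 / a ^ 2 * m ^ 3 := by ring
        _ ≤ 4 * δ ^ 2 * r ^ 2 / a ^ 2 * m ^ 4 := by
            have : (m:ℝ) ^ 3 ≤ m ^ 4 := pow_le_pow_right₀ hm (by norm_num)
            gcongr
        _ = _ := by ring
  have hj : y j ^ 2 ≤ y ⬝ᵥ y := by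
    rw [sq]
    exact Finset.single_le_sum (f := fun j => y j * y j) (fun i _ => mul_self_nonneg _)
      (Finset.mem_univ j)
  exact abs_le_of_sq_le_sq (hj.trans hyy) (by positivity)

open scoped Matrix.Norms.L2Operator in
/-- The square root is continuous on symmetric matrices. -/
lemma continuousOn_cfc_sqrt :
    ContinuousOn (fun V : Matrix (Fin m) (Fin m) ℝ => cfc Real.sqrt V) {V | V.IsHermitian} :=
  ContinuousOn.cfc_of_mem_nhdsSet (s := Set.univ) Real.sqrt Filter.univ_mem
    continuousOn_id (fun _ hV => hV) Real.continuous_sqrt.continuousOn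

end MatrixSqrt

/-! ### Empirical means and covariances of identically distributed bounded vectors -/

section Empirical

variable {m : ℕ} {ι κ : Type} [Fintype ι] [Fintype κ]

/-- The empirical mean. -/
noncomputable def empMean (x : ι → Fin m → ℝ) (j : Fin m) : ℝ := (Fintype.card ι : ℝ)⁻¹ * ∑ i, x i j

/-- The empirical covariance matrix. -/
noncomputable def empCov (x : ι → Fin m → ℝ) : Matrix (Fin m) (Fin m) ℝ := Matrix.of fun a b =>
  (Fintype.card ι : ℝ)⁻¹ * ∑ i, (x i a - empMean x a) * (x i b - empMean x b)

/-- The empirical covariance matrix as a correction of the mean of centred products. -/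
lemma empCov_eq [Nonempty ι] (x : ι → Fin m → ℝ) (c : Fin m → ℝ) (a b : Fin m) :
    empCov x a b = (Fintype.card ι : ℝ)⁻¹ * ∑ i, (x i a - c a) * (x i b - c b) -
      (empMean x a - c a) * (empMean x b - c b) := by
  have hN : (Fintype.card ι : ℝ) ≠ 0 := by exact_mod_cast Fintype.card_ne_zero
  have hm : ∀ j, ∑ i, x i j = Fintype.card ι * empMean x j := fun j => by
    unfold empMean; field_simp
  have e : ∀ i, (x i a - empMean x a) * (x i b - empMean x b) =
      (x i a - c a) * (x i b - c b) + (c a - empMean x a) * x i b + (c b - empMean x b) * x i a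
      + (empMean x a * empMean x b - c a * c b) := fun i => by ring
  simp only [empCov, of_apply, e, Finset.sum_add_distrib, ← Finset.mul_sum, hm, Finset.sum_const,
    Finset.card_univ, nsmul_eq_mul]
  field_simp
  ring

lemma posSemidef_empCov (x : ι → Fin m → ℝ) : (empCov x).PosSemidef := by
  set U : Matrix ι (Fin m) ℝ := Matrix.of fun i a => x i a - empMean x a with hU
  have e : empCov x = (Fintype.card ι : ℝ)⁻¹ • (Uᴴ * U) := by
    ext a b
    simp [empCov, hU, mul_apply]
  rw [e]
  exact (posSemidef_conjTranspose_mul_self U).smul (by positivity)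

/-- The weighted combination of the empirical covariance matrices of two samples. -/
noncomputable def pooledCov (x : ι → Fin m → ℝ) (y : κ → Fin m → ℝ) : Matrix (Fin m) (Fin m) ℝ :=
  ((Fintype.card κ : ℝ) / (Fintype.card ι + Fintype.card κ)) • empCov x +
    ((Fintype.card ι : ℝ) / (Fintype.card ι + Fintype.card κ)) • empCov y

lemma posSemidef_pooledCov (x : ι → Fin m → ℝ) (y : κ → Fin m → ℝ) :
    (pooledCov x y).PosSemidef :=
  ((posSemidef_empCov x).smul (by positivity)).add ((posSemidef_empCov y).smul (by positivity))

/-- The scaling factor of two samples. -/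
noncomputable def scaleOf (ι κ : Type) [Fintype ι] [Fintype κ] : ℝ :=
  √((Fintype.card ι : ℝ) * Fintype.card κ / (Fintype.card ι + Fintype.card κ))

/-- The two-sample test statistic. -/
noncomputable def twoSampleT (x : ι → Fin m → ℝ) (y : κ → Fin m → ℝ) : ℝ :=
  ⨆ j : Fin m, scaleOf ι κ *
    |((cfc Real.sqrt (pooledCov x y))⁻¹ *ᵥ fun j => empMean x j - empMean y j) j|

end Empirical

/-! ### Samples with a common mean and covariance matrix, and the event that their empirical moments
are accurate. -/

section IidArray

variable {Ω : Type*} {mΩ : MeasurableSpace Ω} {P : Measure Ω} [IsProbabilityMeasure P]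
  {m : ℕ} {ι κ : Type}

/-- Independent random vectors, bounded by `B` in each coordinate, with common mean `c` and common
covariance matrix `V`. -/
structure IidArray (P : Measure Ω) (x : ι → Ω → Fin m → ℝ) (B : ℝ) (c : Fin m → ℝ)
    (V : Matrix (Fin m) (Fin m) ℝ) : Prop where
  indep : iIndepFun x P
  meas : ∀ i, Measurable (x i)
  bound : ∀ i ω j, |x i ω j| ≤ B
  mean : ∀ i j, ∫ ω, x i ω j ∂P = c j
  cov : ∀ i j k, ∫ ω, (x i ω j - c j) * (x i ω k - c k) ∂P = V j k

namespace IidArray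

variable {x : ι → Ω → Fin m → ℝ} {B : ℝ} {c : Fin m → ℝ} {V : Matrix (Fin m) (Fin m) ℝ}

lemma precomp (h : IidArray P x B c V) {g : κ → ι} (hg : Function.Injective g) :
    IidArray P (fun i => x (g i)) B c V where
  indep := h.indep.precomp hg
  meas _ := h.meas _
  bound _ := h.bound _
  mean _ := h.mean _
  cov _ := h.cov _

lemma meas_coord (h : IidArray P x B c V) (i : ι) (j : Fin m) :
    Measurable fun ω => x i ω j := (measurable_pi_apply j).comp (h.meas i)

lemma integrable_coord (h : IidArray P x B c V) (i : ι) (j : Fin m) :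
    Integrable (fun ω => x i ω j) P :=
  integrable_of_abs_le (h.meas_coord i j) fun ω => h.bound i ω j

lemma mean_abs_le (h : IidArray P x B c V) [Nonempty ι] (j : Fin m) : |c j| ≤ B := by
  obtain ⟨i⟩ := ‹Nonempty ι›
  rw [← h.mean i j]
  calc _ ≤ ∫ ω, |x i ω j| ∂P := abs_integral_le_integral_abs
    _ ≤ ∫ _, B ∂P := integral_mono (h.integrable_coord i j).abs (integrable_const _)
        fun ω => h.bound i ω j
    _ = B := by simp

lemma centred_abs_le (h : IidArray P x B c V) (i : ι) (ω : Ω) (j : Fin m) :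
    |x i ω j - c j| ≤ 2 * B := by
  have : Nonempty ι := ⟨i⟩
  have h1 := h.bound i ω j
  have h2 := h.mean_abs_le j
  have := abs_sub (x i ω j) (c j)
  linarith

lemma centred_mean (h : IidArray P x B c V) (i : ι) (j : Fin m) :
    ∫ ω, (x i ω j - c j) ∂P = 0 := by
  rw [integral_sub (h.integrable_coord i j) (integrable_const _), h.mean]
  simp

lemma centred_sq (h : IidArray P x B c V) (i : ι) (j : Fin m) :
    ∫ ω, (x i ω j - c j) ^ 2 ∂P = V j j := by
  simp only [sq]; exact h.cov i j j

lemma integrable_prod (h : IidArray P x B c V) (i : ι) (j k : Fin m) :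
    Integrable (fun ω => (x i ω j - c j) * (x i ω k - c k)) P := by
  refine integrable_of_abs_le (C := 2 * B * (2 * B))
    (((h.meas_coord i j).sub_const _).mul ((h.meas_coord i k).sub_const _)) fun ω => ?_
  rw [abs_mul]
  exact mul_le_mul (h.centred_abs_le i ω j) (h.centred_abs_le i ω k) (abs_nonneg _)
    ((abs_nonneg _).trans (h.centred_abs_le i ω j))

lemma prod_abs_le (h : IidArray P x B c V) (i : ι) (ω : Ω) (j k : Fin m) :
    |(x i ω j - c j) * (x i ω k - c k)| ≤ 4 * B ^ 2 := by
  rw [abs_mul]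
  calc _ ≤ 2 * B * (2 * B) := mul_le_mul (h.centred_abs_le i ω j) (h.centred_abs_le i ω k)
        (abs_nonneg _) ((abs_nonneg _).trans (h.centred_abs_le i ω j))
    _ = _ := by ring

lemma cov_abs_le (h : IidArray P x B c V) [Nonempty ι] (j k : Fin m) : |V j k| ≤ 4 * B ^ 2 := by
  obtain ⟨i⟩ := ‹Nonempty ι›
  rw [← h.cov i j k]
  calc _ ≤ ∫ ω, |(x i ω j - c j) * (x i ω k - c k)| ∂P := abs_integral_le_integral_abs
    _ ≤ ∫ _, 4 * B ^ 2 ∂P := integral_mono (h.integrable_prod i j k).abs (integrable_const _)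
        fun ω => h.prod_abs_le i ω j k
    _ = _ := by simp

/-- The event on which the empirical means and second moments are accurate. -/
def Accurate [Fintype ι] (x : ι → Fin m → ℝ) (c : Fin m → ℝ) (V : Matrix (Fin m) (Fin m) ℝ)
    (p q : ℝ) : Prop :=
  (∀ k, |empMean x k - c k| ≤ p) ∧
    ∀ j k, |(Fintype.card ι : ℝ)⁻¹ * ∑ i, (x i j - c j) * (x i k - c k) - V j k| ≤ q

/-- Bernstein's inequality for each of the `m` coordinates and the `m ^ 2` centred products, and a
union bound. In a product one factor is bounded by `2 B` and the other has variance at most `b`, so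
its second moment is at most `4 B ^ 2 b`. The hypothesis `hLB` is exactly the Bernstein condition
for the products and implies the one for the coordinates. -/
theorem not_accurate_le [Fintype ι] [Nonempty ι] (h : IidArray P x B c V) {b : ℝ} (hb : 0 < b)
    (hVb : ∀ k, V k k ≤ b) (hB : 0 < B) {L : ℝ} (hL : 0 ≤ L)
    (hLB : 16 * L * B ^ 2 ≤ Fintype.card ι * b) :
    P.real {ω | ¬ Accurate (fun i => x i ω) c V (2 * √(b * L / Fintype.card ι))
      (2 * √(4 * B ^ 2 * b * L / Fintype.card ι))} ≤ 2 * (m + m ^ 2) * Real.exp (-L) := by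
  classical
  set N : ℝ := (Fintype.card ι : ℝ) with hN
  have hN0 : 0 < N := by rw [hN]; exact_mod_cast Fintype.card_pos
  have h1 : ∀ k, P.real {ω | 2 * √(b * L / N) ≤ |empMean (fun i => x i ω) k - c k|} ≤
      2 * Real.exp (-L) := by
    intro k
    have := bernstein_mean (h := fun i ω => x i ω k - c k)
      (h.indep.comp (fun _ x => x k - c k) fun _ => by fun_prop)
      (fun i => (h.meas_coord i k).sub_const _) (fun i ω => h.centred_abs_le i ω k)
      (fun i => h.centred_mean i k) hb (fun i => by rw [h.centred_sq]; exact hVb k)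
      (Finset.univ_nonempty (α := ι)) hL (by positivity)
      (by rw [Finset.card_univ]; nlinarith [mul_nonneg hL (sq_nonneg B)])
    rw [Finset.card_univ, ← hN] at this
    refine le_trans (le_of_eq ?_) this
    congr 1
    ext ω
    simp only [Set.mem_ofPred_eq, empMean, ← hN, Finset.sum_sub_distrib, Finset.sum_const,
      Finset.card_univ, nsmul_eq_mul, mul_sub]
    rw [inv_mul_cancel_left₀ hN0.ne']
  have h2 : ∀ j k, P.real {ω | 2 * √(4 * B ^ 2 * b * L / N) ≤
      |N⁻¹ * ∑ i, (x i ω j - c j) * (x i ω k - c k) - V j k|} ≤ 2 * Real.exp (-L) := by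
    intro j k
    have hm2 : ∀ i, Measurable fun ω => (x i ω j - c j) * (x i ω k - c k) - V j k := fun i =>
      (((h.meas_coord i j).sub_const _).mul ((h.meas_coord i k).sub_const _)).sub_const _
    have hsq : ∀ i, Integrable (fun ω => ((x i ω j - c j) * (x i ω k - c k)) ^ 2) P := fun i =>
      (memLp_of_abs_le (((h.meas_coord i j).sub_const _).mul ((h.meas_coord i k).sub_const _))
        (fun ω => h.prod_abs_le i ω j k) 2).integrable_sq
    have hsqk : ∀ i, Integrable (fun ω => (x i ω k - c k) ^ 2) P := fun i =>
      (memLp_of_abs_le ((h.meas_coord i k).sub_const _)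
        (fun ω => h.centred_abs_le i ω k) 2).integrable_sq
    have := bernstein_mean (P := P) (M := 8 * B ^ 2) (w := 4 * B ^ 2 * b)
      (h := fun i ω => (x i ω j - c j) * (x i ω k - c k) - V j k)
      (h.indep.comp (fun _ x => (x j - c j) * (x k - c k) - V j k) fun _ => by fun_prop) hm2
      (fun i ω => by
        have h1 := h.prod_abs_le i ω j k
        have h2 := h.cov_abs_le j k
        have := abs_sub ((x i ω j - c j) * (x i ω k - c k)) (V j k)
        linarith)
      (fun i => by
        rw [integral_sub (h.integrable_prod i j k) (integrable_const _), h.cov]; simp)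
      (by positivity)
      (fun i => by
        have e : ∀ ω, ((x i ω j - c j) * (x i ω k - c k) - V j k) ^ 2 =
            ((x i ω j - c j) * (x i ω k - c k)) ^ 2 -
            2 * V j k * ((x i ω j - c j) * (x i ω k - c k)) + V j k ^ 2 := fun ω => by ring
        simp only [e]
        have i1 : Integrable (fun ω => ((x i ω j - c j) * (x i ω k - c k)) ^ 2 -
            2 * V j k * ((x i ω j - c j) * (x i ω k - c k))) P :=
          (hsq i).sub ((h.integrable_prod i j k).const_mul _)
        rw [integral_add i1 (integrable_const _),
          integral_sub (hsq i) ((h.integrable_prod i j k).const_mul _), integral_const_mul, h.cov]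
        have : ∫ ω, ((x i ω j - c j) * (x i ω k - c k)) ^ 2 ∂P ≤ 4 * B ^ 2 * b := by
          calc _ ≤ ∫ ω, 4 * B ^ 2 * (x i ω k - c k) ^ 2 ∂P := by
                refine integral_mono (hsq i) ((hsqk i).const_mul _) fun ω => ?_
                simp only [mul_pow]
                have h3 := sq_le_sq' (abs_le.1 (h.centred_abs_le i ω j)).1
                  (abs_le.1 (h.centred_abs_le i ω j)).2
                have : (x i ω j - c j) ^ 2 ≤ 4 * B ^ 2 := by linarith [mul_pow 2 B 2]
                gcongr
            _ ≤ _ := by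
                rw [integral_const_mul, h.centred_sq]
                gcongr
                exact hVb k
        simp only [integral_const, probReal_univ, smul_eq_mul, one_mul]
        nlinarith [sq_nonneg (V j k)])
      (Finset.univ_nonempty (α := ι)) hL (by positivity)
      (by
        rw [Finset.card_univ, ← hN]
        have : 4 * B ^ 2 * (16 * L * B ^ 2) ≤ 4 * B ^ 2 * (N * b) := by gcongr
        linarith [this])
    rw [Finset.card_univ, ← hN] at this
    refine le_trans (le_of_eq ?_) this
    congr 1
    ext ω
    simp only [Set.mem_ofPred_eq, Finset.sum_sub_distrib, Finset.sum_const,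
      Finset.card_univ, nsmul_eq_mul, mul_sub]
    rw [← hN, inv_mul_cancel_left₀ hN0.ne']
  have hsub : {ω | ¬ Accurate (fun i => x i ω) c V (2 * √(b * L / N))
      (2 * √(4 * B ^ 2 * b * L / N))} ⊆
      (⋃ k ∈ (Finset.univ : Finset (Fin m)),
        {ω | 2 * √(b * L / N) ≤ |empMean (fun i => x i ω) k - c k|}) ∪
      ⋃ q ∈ (Finset.univ : Finset (Fin m × Fin m)), {ω | 2 * √(4 * B ^ 2 * b * L / N) ≤
        |N⁻¹ * ∑ i, (x i ω q.1 - c q.1) * (x i ω q.2 - c q.2) - V q.1 q.2|} := by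
    intro ω hω
    simp only [Set.mem_ofPred_eq, Accurate, not_and_or, not_forall, not_le] at hω
    simp only [Set.mem_union, Set.mem_iUnion, Set.mem_ofPred_eq, Finset.mem_univ, exists_prop,
      true_and]
    rcases hω with ⟨k, hk⟩ | ⟨j, k, hk⟩
    · exact Or.inl ⟨k, hk.le⟩
    · exact Or.inr ⟨(j, k), hk.le⟩
  calc _ ≤ _ := measureReal_mono hsub
    _ ≤ _ := measureReal_union_le _ _
    _ ≤ ∑ _k : Fin m, 2 * Real.exp (-L) + ∑ _q : Fin m × Fin m, 2 * Real.exp (-L) := by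
        refine add_le_add ?_ ?_
        · exact (measureReal_biUnion_finset_le _ _).trans (Finset.sum_le_sum fun k _ => h1 k)
        · exact (measureReal_biUnion_finset_le _ _).trans
            (Finset.sum_le_sum fun q _ => h2 q.1 q.2)
    _ = _ := by simp; ring

end IidArray

lemma IidArray.Accurate.empCov_sub_le [Fintype ι] [Nonempty ι] {x : ι → Fin m → ℝ} {c : Fin m → ℝ}
    {V : Matrix (Fin m) (Fin m) ℝ} {p q : ℝ} (h : IidArray.Accurate x c V p q) (j k : Fin m) :
    |empCov x j k - V j k| ≤ q + p ^ 2 := by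
  rw [empCov_eq x c j k]
  have h1 := h.2 j k
  have h2 := h.1 j
  have h3 := h.1 k
  have h4 : |(empMean x j - c j) * (empMean x k - c k)| ≤ p ^ 2 := by
    rw [abs_mul, sq]
    exact mul_le_mul h2 h3 (abs_nonneg _) ((abs_nonneg _).trans h2)
  set M := (Fintype.card ι : ℝ)⁻¹ * ∑ i, (x i j - c j) * (x i k - c k)
  set Q := (empMean x j - c j) * (empMean x k - c k)
  have e : M - Q - V j k = (M - V j k) - Q := by ring
  rw [e]
  exact (abs_sub _ _).trans (add_le_add h1 h4)

end IidArray

/-! ### Standardization -/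

section Standardize

variable {Ω : Type*} {mΩ : MeasurableSpace Ω} {P : Measure Ω} [IsProbabilityMeasure P]
  {m : ℕ} {ι κ : Type}

lemma transpose_sqrt (V : Matrix (Fin m) (Fin m) ℝ) : (cfc Real.sqrt V)ᵀ = cfc Real.sqrt V := by
  simpa [IsHermitian] using isHermitian_sqrt V

lemma posSemidef_of_spectrum_ge {V : Matrix (Fin m) (Fin m) ℝ} (hV : V.IsHermitian) {a : ℝ}
    (ha : 0 < a) (h : ∀ x ∈ spectrum ℝ V, a ≤ x) : V.PosSemidef :=
  posSemidef_iff_isHermitian_and_spectrum_nonneg.2 ⟨hV, fun x hx => ha.le.trans (h x hx)⟩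

lemma isUnit_det_sqrt {V : Matrix (Fin m) (Fin m) ℝ} (hV : V.IsHermitian) {a : ℝ}
    (ha : 0 < a) (h : ∀ x ∈ spectrum ℝ V, a ≤ x) : IsUnit (cfc Real.sqrt V).det :=
  isUnit_of_quadForm (Real.sqrt_pos.2 ha) (quadForm_sqrt_ge hV h)

/-- For `z` the standardized vector, `z ⬝ᵥ (V *ᵥ z) = y ⬝ᵥ y`, so the spectral lower bound gives `a
* (z ⬝ᵥ z) ≤ m * u ^ 2`. -/
lemma abs_inv_sqrt_mulVec_le {V : Matrix (Fin m) (Fin m) ℝ} (hV : V.IsHermitian) {a : ℝ}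
    (ha : 0 < a) (h : ∀ x ∈ spectrum ℝ V, a ≤ x) {y : Fin m → ℝ} {u : ℝ} (hu : ∀ j, |y j| ≤ u)
    (j : Fin m) : |((cfc Real.sqrt V)⁻¹ *ᵥ y) j| ≤ √(m / a) * u := by
  set A := cfc Real.sqrt V with hA
  have hU := isUnit_det_sqrt hV ha h
  set z := A⁻¹ *ᵥ y with hz
  have hAz : A *ᵥ z = y := by rw [hz, mulVec_mulVec, mul_nonsing_inv _ hU, one_mulVec]
  have h1 := quadForm_ge hV h z
  have hu0 : 0 ≤ u := (abs_nonneg _).trans (hu j)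
  have e : z ⬝ᵥ (V *ᵥ z) = y ⬝ᵥ y := by
    rw [← sqrt_mul_sqrt (posSemidef_of_spectrum_ge hV ha h), ← hA, ← mulVec_mulVec, hAz,
      dotProduct_mulVec, ← mulVec_transpose, transpose_sqrt, hAz]
  have h2 : y ⬝ᵥ y ≤ m * u ^ 2 := by
    calc y ⬝ᵥ y ≤ ∑ _j : Fin m, u ^ 2 := by
          refine Finset.sum_le_sum fun j _ => ?_
          rw [← sq]
          exact sq_le_sq' (abs_le.1 (hu j)).1 (abs_le.1 (hu j)).2
      _ = _ := by simp
  have hj : z j ^ 2 ≤ z ⬝ᵥ z := by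
    rw [sq]
    exact Finset.single_le_sum (f := fun j => z j * z j) (fun i _ => mul_self_nonneg _)
      (Finset.mem_univ j)
  refine abs_le_of_sq_le_sq ?_ (by positivity)
  rw [mul_pow, Real.sq_sqrt (by positivity)]
  rw [e] at h1
  calc z j ^ 2 ≤ z ⬝ᵥ z := hj
    _ = a * (z ⬝ᵥ z) / a := by field_simp
    _ ≤ m * u ^ 2 / a := div_le_div_of_nonneg_right (h1.trans h2) ha.le
    _ = _ := by ring

/-- Conjugating `V` by its inverse square root gives the identity, so only the squared weight
survives as the isotropic variance. This brings the data into the form required by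
`berry_esseen_box`. -/
theorem IidArray.standardize {x : ι → Ω → Fin m → ℝ} {B : ℝ} {c : Fin m → ℝ}
    {V : Matrix (Fin m) (Fin m) ℝ} (h : IidArray P x B c V) (hV : V.IsHermitian) {a : ℝ}
    (ha : 0 < a) (hVa : ∀ x ∈ spectrum ℝ V, a ≤ x) {ρ : ι → ℝ} {R : ℝ} (hρ : ∀ i, |ρ i| ≤ R) :
    IsotropicArray P (fun i ω => ρ i • ((cfc Real.sqrt V)⁻¹ *ᵥ (x i ω - c)))
      (R * (√(m / a) * (2 * B))) (fun i => ρ i ^ 2) where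
  indep := h.indep.comp (fun i x => ρ i • ((cfc Real.sqrt V)⁻¹ *ᵥ (x - c))) fun i =>
    Continuous.measurable (by fun_prop)
  meas i := by
    have : Measurable fun x : Fin m → ℝ => ρ i • ((cfc Real.sqrt V)⁻¹ *ᵥ (x - c)) :=
      Continuous.measurable (by fun_prop)
    exact this.comp (h.meas i)
  bound i ω j := by
    rw [Pi.smul_apply, smul_eq_mul, abs_mul]
    exact mul_le_mul (hρ i) (abs_inv_sqrt_mulVec_le hV ha hVa (fun k => h.centred_abs_le i ω k) j)
      (abs_nonneg _) ((abs_nonneg _).trans (hρ i))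
  mean i j := by
    have e : ∀ ω, (ρ i • ((cfc Real.sqrt V)⁻¹ *ᵥ (x i ω - c))) j =
        ρ i * ∑ k, (cfc Real.sqrt V)⁻¹ j k * (x i ω k - c k) := fun ω => rfl
    have hint : ∀ k, Integrable (fun ω => x i ω k - c k) P := fun k =>
      (h.integrable_coord i k).sub (integrable_const (c k))
    simp only [e]
    rw [integral_const_mul, integral_finsetSum _ fun k _ => (hint k).const_mul _]
    simp only [integral_const_mul, h.centred_mean]
    simp
  cov i j k := by
    set A := cfc Real.sqrt V with hA
    have hU : IsUnit A.det := isUnit_det_sqrt hV ha hVa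
    have e : ∀ ω, (ρ i • (A⁻¹ *ᵥ (x i ω - c))) j * (ρ i • (A⁻¹ *ᵥ (x i ω - c))) k =
        ρ i ^ 2 * ∑ p, ∑ q, A⁻¹ j p * A⁻¹ k q * ((x i ω p - c p) * (x i ω q - c q)) := by
      intro ω
      simp only [Pi.smul_apply, smul_eq_mul, mulVec, dotProduct, Pi.sub_apply]
      rw [mul_mul_mul_comm, Finset.sum_mul_sum, ← sq]
      congr 1
      exact Finset.sum_congr rfl fun p _ => Finset.sum_congr rfl fun q _ => by ring
    simp only [e]
    rw [integral_const_mul, integral_finsetSum _ fun p _ => integrable_finsetSum _ fun q _ =>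
      (h.integrable_prod i p q).const_mul _]
    have e2 : ∀ p, ∫ ω, ∑ q, A⁻¹ j p * A⁻¹ k q * ((x i ω p - c p) * (x i ω q - c q)) ∂P =
        ∑ q, A⁻¹ j p * A⁻¹ k q * V p q := fun p => by
      rw [integral_finsetSum _ fun q _ => (h.integrable_prod i p q).const_mul _]
      simp only [integral_const_mul, h.cov]
    simp only [e2]
    have e3 : ∑ p, ∑ q, A⁻¹ j p * A⁻¹ k q * V p q = (A⁻¹ * V * A⁻¹ᵀ) j k := by
      simp only [mul_apply, transpose_apply, Finset.sum_mul]
      rw [Finset.sum_comm]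
      exact Finset.sum_congr rfl fun p _ => Finset.sum_congr rfl fun q _ => by ring
    have e4 : A⁻¹ * V * A⁻¹ᵀ = 1 := by
      rw [transpose_nonsing_inv, hA, transpose_sqrt, ← hA,
        ← sqrt_mul_sqrt (posSemidef_of_spectrum_ge hV ha hVa), ← hA, ← mul_assoc,
        nonsing_inv_mul _ hU, one_mul, mul_nonsing_inv _ hU]
    rw [e3, e4, one_apply]
    split_ifs <;> simp

lemma gaussian_box_mono_bound (m : ℕ) {t t' : ℝ} (ht : 0 ≤ t) (h : t ≤ t') :
    |(gaussianReal 0 1).real (Set.Icc (-t') t') ^ m - (gaussianReal 0 1).real (Set.Icc (-t) t) ^ m| ≤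
      2 * m * (t' - t) := by
  have hp := abs_prod_sub_prod_le (Finset.univ : Finset (Fin m))
    (a := fun _ => (gaussianReal 0 1).real (Set.Icc (-t') t'))
    (b := fun _ => (gaussianReal 0 1).real (Set.Icc (-t) t))
    (fun _ => by rw [abs_of_nonneg measureReal_nonneg]; exact measureReal_le_one)
    (fun _ => by rw [abs_of_nonneg measureReal_nonneg]; exact measureReal_le_one)
  simp only [Finset.prod_const, Finset.card_univ, Fintype.card_fin, Finset.sum_const,
    nsmul_eq_mul] at hp
  refine hp.trans ?_
  rw [gaussianReal_Icc _ _ (by linarith), gaussianReal_Icc _ _ (by linarith), gaussE_neg, gaussE_neg,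
    abs_of_nonneg (by linarith [gaussE_mono h])]
  have := gaussE_sub_le h
  calc _ ≤ (m:ℝ) * (2 * (t' - t)) := by gcongr; linarith
    _ = _ := by ring

end Standardize

/-! ### The two-sample statistic as a weighted sum over the joint sample. -/

section TwoSample

variable {m : ℕ} {ι κ : Type} [Fintype ι] [Fintype κ]

/-- The signed weights of the two samples. -/
noncomputable def sampleWeight (ι κ : Type) [Fintype ι] [Fintype κ] : ι ⊕ κ → ℝ :=
  Sum.elim (fun _ => scaleOf ι κ * (Fintype.card ι : ℝ)⁻¹)
    (fun _ => -(scaleOf ι κ * (Fintype.card κ : ℝ)⁻¹))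

lemma scaleOf_sq : scaleOf ι κ ^ 2 =
    (Fintype.card ι : ℝ) * Fintype.card κ / (Fintype.card ι + Fintype.card κ) :=
  Real.sq_sqrt (by positivity)

lemma scaleOf_nonneg : 0 ≤ scaleOf ι κ := Real.sqrt_nonneg _

variable [Nonempty ι] [Nonempty κ]

lemma scaleOf_le_left : scaleOf ι κ ≤ √(Fintype.card ι) := by
  refine Real.sqrt_le_sqrt ?_
  have h2 : (0:ℝ) < Fintype.card κ := by exact_mod_cast Fintype.card_pos
  rw [div_le_iff₀ (by positivity)]
  nlinarith [sq_nonneg (Fintype.card ι : ℝ)]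

lemma scaleOf_le_right : scaleOf ι κ ≤ √(Fintype.card κ) := by
  refine Real.sqrt_le_sqrt ?_
  have h2 : (0:ℝ) < Fintype.card κ := by exact_mod_cast Fintype.card_pos
  rw [div_le_iff₀ (by positivity)]
  nlinarith [sq_nonneg (Fintype.card κ : ℝ)]

/-- The square of the scale is the reciprocal of `1 / card ι + 1 / card κ`. The total variance is
thus 1, as the Berry-Esseen bound for boxes requires. -/
lemma sum_sampleWeight_sq : ∑ s, sampleWeight ι κ s ^ 2 = 1 := by
  have h1 : (0:ℝ) < Fintype.card ι := by exact_mod_cast Fintype.card_pos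
  have h2 : (0:ℝ) < Fintype.card κ := by exact_mod_cast Fintype.card_pos
  rw [Fintype.sum_sum_type]
  simp only [sampleWeight, Sum.elim_inl, Sum.elim_inr, neg_sq, mul_pow, scaleOf_sq,
    Finset.sum_const, Finset.card_univ, nsmul_eq_mul]
  field_simp
  ring

lemma abs_sampleWeight_le {N : ℝ} (hN : 0 < N) (hι : N ≤ Fintype.card ι)
    (hκ : N ≤ Fintype.card κ) (s : ι ⊕ κ) : |sampleWeight ι κ s| ≤ 1 / √N := by
  have h1 : (0:ℝ) < Fintype.card ι := by exact_mod_cast Fintype.card_pos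
  have h2 : (0:ℝ) < Fintype.card κ := by exact_mod_cast Fintype.card_pos
  have h0 := scaleOf_nonneg (ι := ι) (κ := κ)
  rcases s with s | s
  · simp only [sampleWeight, Sum.elim_inl]
    rw [abs_of_nonneg (by positivity), ← div_eq_mul_inv, div_le_div_iff₀ h1 (by positivity), one_mul]
    calc scaleOf ι κ * √N ≤ √(Fintype.card ι) * √(Fintype.card ι) := by
          gcongr
          exact scaleOf_le_left
      _ = _ := Real.mul_self_sqrt h1.le
  · simp only [sampleWeight, Sum.elim_inr]
    rw [abs_neg, abs_of_nonneg (by positivity), ← div_eq_mul_inv,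
      div_le_div_iff₀ h2 (by positivity), one_mul]
    calc scaleOf ι κ * √N ≤ √(Fintype.card κ) * √(Fintype.card κ) := by
          gcongr
          exact scaleOf_le_right
      _ = _ := Real.mul_self_sqrt h2.le

/-- The signed weights sum to zero, so centring at a mean common to both samples does not change the
difference of the means. -/
lemma sum_sampleWeight_smul (x : ι ⊕ κ → Fin m → ℝ) (c : Fin m → ℝ)
    (A : Matrix (Fin m) (Fin m) ℝ) :
    ∑ s, sampleWeight ι κ s • (A *ᵥ (x s - c)) =
      A *ᵥ (scaleOf ι κ • fun j => empMean (fun i => x (Sum.inl i)) j -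
        empMean (fun i => x (Sum.inr i)) j) := by
  have h1 : (Fintype.card ι : ℝ) ≠ 0 := by exact_mod_cast Fintype.card_ne_zero
  have h2 : (Fintype.card κ : ℝ) ≠ 0 := by exact_mod_cast Fintype.card_ne_zero
  simp only [← mulVec_smul]
  rw [← mulVec_sum]
  congr 1
  ext j
  rw [Finset.sum_apply, Fintype.sum_sum_type]
  simp only [sampleWeight, Sum.elim_inl, Sum.elim_inr, Pi.smul_apply, Pi.sub_apply, smul_eq_mul,
    empMean, ← Finset.mul_sum, Finset.sum_sub_distrib, Finset.sum_const, Finset.card_univ,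
    nsmul_eq_mul]
  field_simp
  ring

lemma twoSampleT_le_iff (hm : 0 < m) (x : ι → Fin m → ℝ) (y : κ → Fin m → ℝ) (t : ℝ) :
    twoSampleT x y ≤ t ↔ ∀ j, |((cfc Real.sqrt (pooledCov x y))⁻¹ *ᵥ
      (scaleOf ι κ • fun j => empMean x j - empMean y j)) j| ≤ t := by
  have : Nonempty (Fin m) := ⟨⟨0, hm⟩⟩
  unfold twoSampleT
  rw [ciSup_le_iff (Set.finite_range _).bddAbove]
  refine forall_congr' fun j => ?_
  rw [mulVec_smul, Pi.smul_apply, smul_eq_mul, abs_mul, abs_of_nonneg scaleOf_nonneg]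

lemma pooledCov_sub_le {x : ι → Fin m → ℝ} {y : κ → Fin m → ℝ} {V : Matrix (Fin m) (Fin m) ℝ}
    {δ : ℝ} (hx : ∀ j k, |empCov x j k - V j k| ≤ δ) (hy : ∀ j k, |empCov y j k - V j k| ≤ δ)
    (j k : Fin m) : |pooledCov x y j k - V j k| ≤ δ := by
  have h1 : (0:ℝ) < Fintype.card ι := by exact_mod_cast Fintype.card_pos
  have h2 : (0:ℝ) < Fintype.card κ := by exact_mod_cast Fintype.card_pos
  set p : ℝ := (Fintype.card κ : ℝ) / (Fintype.card ι + Fintype.card κ) with hp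
  set q : ℝ := (Fintype.card ι : ℝ) / (Fintype.card ι + Fintype.card κ) with hq
  have hpq : p + q = 1 := by rw [hp, hq]; field_simp; ring
  have hp0 : 0 ≤ p := by positivity
  have hq0 : 0 ≤ q := by positivity
  have e : pooledCov x y j k - V j k =
      p * (empCov x j k - V j k) + q * (empCov y j k - V j k) := by
    simp only [pooledCov, Matrix.add_apply, Matrix.smul_apply, smul_eq_mul, ← hp, ← hq]
    linear_combination V j k * hpq
  rw [e]
  calc _ ≤ |p * (empCov x j k - V j k)| + |q * (empCov y j k - V j k)| := abs_add_le _ _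
    _ ≤ p * δ + q * δ := by
        rw [abs_mul, abs_mul, abs_of_nonneg hp0, abs_of_nonneg hq0]
        gcongr
        · exact hx j k
        · exact hy j k
    _ = δ := by rw [← add_mul, hpq, one_mul]

end TwoSample

/-! ### A Berry–Esseen bound for the studentized two-sample statistic -/

section TwoSampleBound

variable {Ω : Type*} {mΩ : MeasurableSpace Ω} {P : Measure Ω} [IsProbabilityMeasure P]
  {m : ℕ} {ι κ : Type} [Fintype ι] [Fintype κ] [Nonempty ι] [Nonempty κ]

lemma diag_ge_of_spectrum {V : Matrix (Fin m) (Fin m) ℝ} (hV : V.IsHermitian) {a : ℝ}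
    (h : ∀ x ∈ spectrum ℝ V, a ≤ x) (j : Fin m) : a ≤ V j j := by
  simpa using quadForm_ge hV h (Pi.single j 1)

lemma diag_le_of_spectrum {V : Matrix (Fin m) (Fin m) ℝ} (hV : V.IsHermitian) {b : ℝ}
    (h : ∀ x ∈ spectrum ℝ V, x ≤ b) (j : Fin m) : V j j ≤ b := by
  simpa using quadForm_le hV h (Pi.single j 1)

/-- The relative error of the covariance estimate is of order `β √(log (1 / β))`; this shows that it
is at most of order `√β`, hence small with `β`. -/
lemma sqrt_log_mul_sq_le {β : ℝ} (hβ : 0 < β) (hβ1 : β ≤ 1) :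
    0 ≤ Real.log (1 / β) ∧ (β * √(Real.log (1 / β))) ^ 2 ≤ β := by
  have h0 : 0 ≤ Real.log (1 / β) := Real.log_nonneg ((one_le_div hβ).2 hβ1)
  have h1 := Real.log_le_sub_one_of_pos (one_div_pos.2 hβ)
  refine ⟨h0, ?_⟩
  rw [mul_pow, Real.sq_sqrt h0]
  calc β ^ 2 * Real.log (1 / β) ≤ β ^ 2 * (1 / β) := by gcongr; linarith
    _ = β := by field_simp

/-- On the event that both samples are accurate, the pooled covariance matrix is accurate. -/
lemma accurate_pooledCov_sub_le {x : ι → Fin m → ℝ} {y : κ → Fin m → ℝ} {c : Fin m → ℝ}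
    {V : Matrix (Fin m) (Fin m) ℝ} {a b B N L s : ℝ} (ha : 0 < a) (hb : 0 < b) (hB : 0 < B)
    (hN : 0 < N) (hι : N ≤ Fintype.card ι) (hκ : N ≤ Fintype.card κ) (hL : 0 ≤ L)
    (haB : a ≤ 4 * B ^ 2) (hs : s = B / √N * √L) (hs1 : s ≤ 1)
    (hx : IidArray.Accurate x c V (2 * √(b * L / Fintype.card ι))
      (2 * √(4 * B ^ 2 * b * L / Fintype.card ι)))
    (hy : IidArray.Accurate y c V (2 * √(b * L / Fintype.card κ))
      (2 * √(4 * B ^ 2 * b * L / Fintype.card κ))) (j k : Fin m) :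
    |pooledCov x y j k - V j k| ≤ (4 * √b + 16 * b / a) * s := by
  have hs0 : 0 ≤ s := by rw [hs]; positivity
  have key : ∀ M : ℝ, N ≤ M → 2 * √(4 * B ^ 2 * b * L / M) + (2 * √(b * L / M)) ^ 2 ≤
      (4 * √b + 16 * b / a) * s := by
    intro M hM
    have hM0 : 0 < M := hN.trans_le hM
    have h1 : √(4 * B ^ 2 * b * L / M) ≤ 2 * √b * s := by
      refine Real.sqrt_le_iff.2 ⟨by positivity, ?_⟩
      rw [hs]
      simp only [mul_pow, div_pow, Real.sq_sqrt hb.le, Real.sq_sqrt hL, Real.sq_sqrt hN.le]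
      calc 4 * B ^ 2 * b * L / M ≤ 4 * B ^ 2 * b * L / N := by gcongr
        _ = _ := by ring
    -- The squared error of the means has size `b L / M` with no factor `B ^ 2`; the inequality `a ≤
    -- 4 B ^ 2` supplies one, and `s ≤ 1` reduces `s ^ 2` to `s`.
    have h2 : (2 * √(b * L / M)) ^ 2 ≤ 16 * b / a * s := by
      rw [mul_pow, Real.sq_sqrt (by positivity)]
      calc 2 ^ 2 * (b * L / M) ≤ 2 ^ 2 * (b * L / N) := by gcongr
        _ = a * (4 * b * L / N / a) := by field_simp; ring
        _ ≤ 4 * B ^ 2 * (4 * b * L / N / a) := by gcongr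
        _ = 16 * b / a * s ^ 2 := by
            rw [hs]
            simp only [mul_pow, div_pow, Real.sq_sqrt hL, Real.sq_sqrt hN.le]
            ring
        _ ≤ 16 * b / a * s := by
            gcongr
            nlinarith
    calc _ ≤ 2 * (2 * √b * s) + 16 * b / a * s := by gcongr
      _ = _ := by ring
  exact pooledCov_sub_le (fun j k => (hx.empCov_sub_le j k).trans (key _ hι))
    (fun j k => (hy.empCov_sub_le j k).trans (key _ hκ)) j k

/-- On the event that both samples are accurate, the scaled difference of the means is small. -/
lemma accurate_scaled_mean_le {x : ι → Fin m → ℝ} {y : κ → Fin m → ℝ} {c : Fin m → ℝ}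
    {V : Matrix (Fin m) (Fin m) ℝ} {b L q q' : ℝ}
    (hx : IidArray.Accurate x c V (2 * √(b * L / Fintype.card ι)) q)
    (hy : IidArray.Accurate y c V (2 * √(b * L / Fintype.card κ)) q') (k : Fin m) :
    |(scaleOf ι κ • fun j => empMean x j - empMean y j) k| ≤ 4 * √(b * L) := by
  have h1 : (0:ℝ) < Fintype.card ι := by exact_mod_cast Fintype.card_pos
  have h2 : (0:ℝ) < Fintype.card κ := by exact_mod_cast Fintype.card_pos
  have h0 := scaleOf_nonneg (ι := ι) (κ := κ)
  have key : ∀ M : ℝ, 0 < M → √M * (2 * √(b * L / M)) = 2 * √(b * L) := by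
    intro M hM
    rw [Real.sqrt_div' _ hM.le]
    have : 0 < √M := Real.sqrt_pos.2 hM
    field_simp
  have e : (scaleOf ι κ • fun j => empMean x j - empMean y j) k =
      scaleOf ι κ * (empMean x k - c k) - scaleOf ι κ * (empMean y k - c k) := by
    simp only [Pi.smul_apply, smul_eq_mul]; ring
  rw [e]
  calc _ ≤ |scaleOf ι κ * (empMean x k - c k)| + |scaleOf ι κ * (empMean y k - c k)| := abs_sub _ _
    _ ≤ √(Fintype.card ι) * (2 * √(b * L / Fintype.card ι)) +
        √(Fintype.card κ) * (2 * √(b * L / Fintype.card κ)) := by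
        rw [abs_mul, abs_mul, abs_of_nonneg h0]
        gcongr
        · exact scaleOf_le_left
        · exact hx.1 k
        · exact scaleOf_le_right
        · exact hy.1 k
    _ = _ := by rw [key _ h1, key _ h2]; ring

/-- Outside `G` the event `A` lies between the boxes of radius `t - k` and `t + k`, whose
probabilities are known up to `e`, while `F` varies by at most `l * k`. If `t < k` the inner box
gives no information, but then `F t ≤ l * k` because `F 0 = 0`. -/
lemma abs_measureReal_sub_le_of_sandwich {A : Set Ω} {F : ℝ → ℝ} {S : ℝ → Set Ω} {G : Set Ω}
    {t k e ε l : ℝ} (ht : 0 ≤ t) (hk : 0 ≤ k) (hF0 : F 0 = 0)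
    (hS : ∀ u, 0 ≤ u → |P.real (S u) - F u| ≤ e)
    (hF : ∀ u u', 0 ≤ u → u ≤ u' → |F u' - F u| ≤ l * (u' - u)) (hl : 0 ≤ l)
    (hG : P.real G ≤ ε) (h1 : A ⊆ S (t + k) ∪ G) (h2 : S (t - k) ⊆ A ∪ G) :
    |P.real A - F t| ≤ e + ε + l * k := by
  have u1 : P.real A ≤ P.real (S (t + k)) + P.real G :=
    (measureReal_mono h1).trans (measureReal_union_le _ _)
  have u2 : P.real (S (t - k)) ≤ P.real A + P.real G :=
    (measureReal_mono h2).trans (measureReal_union_le _ _)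
  have e0 := (abs_nonneg _).trans (hS 0 le_rfl)
  have ε0 := measureReal_nonneg.trans hG
  have a1 := abs_le.1 (hS (t + k) (by positivity))
  have f1 := abs_le.1 (hF t (t + k) ht (by linarith))
  rw [abs_le]
  constructor
  · rcases le_or_gt k t with h | h
    · have a2 := abs_le.1 (hS (t - k) (by linarith))
      have f2 := abs_le.1 (hF (t - k) t (by linarith) (by linarith))
      have : t - (t - k) = k := by ring
      rw [this] at f2
      linarith
    · have f2 := abs_le.1 (hF 0 t le_rfl ht)
      have := measureReal_nonneg (μ := P) (s := A)
      have : l * (t - 0) ≤ l * k := by gcongr; linarith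
      linarith
  · have : t + k - t = k := by ring
    rw [this] at f1
    linarith

/-- The constant in `two_sample_bound_of_small`. -/
noncomputable def studentConst (m : ℕ) (a b : ℝ) : ℝ :=
  berryConst m * (1 + 2 * √(m / a)) + 4 * (m + m ^ 2) +
    2 * m * (8 * m ^ 2 / a * (4 * √b + 16 * b / a) * √(m / a) * √b)

/-- The level `L = log (1 / β)` makes the exceptional probability of order `exp (-L) = β`. On the
good event the covariance error is of order `β √L` and the standardized mean of order `√L`.
Replacing the true by the estimated covariance thus moves the statistic by order `β L`, no more than
the Berry-Esseen error. -/
lemma IidArray.two_sample_bound_of_small {x : ι ⊕ κ → Ω → Fin m → ℝ} {B : ℝ} {c : Fin m → ℝ}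
    {V : Matrix (Fin m) (Fin m) ℝ} (h : IidArray P x B c V) (hm : 0 < m) (hV : V.IsHermitian)
    {a b : ℝ} (ha : 0 < a) (hb : 0 < b) (hVab : spectrum ℝ V ⊆ Set.Icc a b) {N : ℝ} (hN : 0 < N)
    (hι : N ≤ Fintype.card ι) (hκ : N ≤ Fintype.card κ) {β : ℝ} (hβ : β = B / √N) (hβ1 : β ≤ 1)
    (h1 : 16 * β ≤ b) (h2 : m * ((4 * √b + 16 * b / a) * √β) ≤ a / 2)
    (h3 : (1 + 2 * √(m / a)) * β ≤ 1) {t : ℝ} (ht : 0 ≤ t) :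
    |P.real {ω | twoSampleT (fun i => x (Sum.inl i) ω) (fun i => x (Sum.inr i) ω) ≤ t} -
      (gaussianReal 0 1).real (Set.Icc (-t) t) ^ m| ≤
      studentConst m a b * (β * (1 + Real.log (1 / β))) := by
  have hVa : ∀ x ∈ spectrum ℝ V, a ≤ x := fun x hx => (hVab hx).1
  have hVb : ∀ x ∈ spectrum ℝ V, x ≤ b := fun x hx => (hVab hx).2
  have hB0 : 0 ≤ B := (abs_nonneg _).trans (h.mean_abs_le ⟨0, hm⟩)
  have haB : a ≤ 4 * B ^ 2 := (diag_ge_of_spectrum hV hVa ⟨0, hm⟩).trans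
    ((le_abs_self _).trans (h.cov_abs_le _ _))
  have hB : 0 < B := hB0.lt_of_ne fun e => by subst e; norm_num at haB; linarith
  have hsN : 0 < √N := Real.sqrt_pos.2 hN
  have hβ0 : 0 < β := by rw [hβ]; positivity
  obtain ⟨hL, hsL⟩ := sqrt_log_mul_sq_le hβ0 hβ1
  set L := Real.log (1 / β) with hLdef
  set s := β * √L with hs
  have hs0 : 0 ≤ s := by positivity
  have hs1 : s ≤ √β := Real.le_sqrt_of_sq_le hsL
  have hsβ : s ≤ 1 := hs1.trans (Real.sqrt_le_one.2 hβ1)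
  -- Since `B ^ 2 * L = s ^ 2 * N` and `s ^ 2 ≤ β`, the Bernstein condition reduces to `16 * β ≤ b`.
  have hLB : ∀ M : ℝ, N ≤ M → 16 * L * B ^ 2 ≤ M * b := by
    intro M hM
    have e : B ^ 2 * L = s ^ 2 * N := by
      rw [hs, hβ, mul_pow, div_pow, Real.sq_sqrt hL, Real.sq_sqrt hN.le]; field_simp
    calc 16 * L * B ^ 2 = 16 * s ^ 2 * N := by rw [mul_assoc 16 (s ^ 2), ← e]; ring
      _ ≤ b * M := by gcongr; linarith
      _ = _ := mul_comm _ _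
  set K₁ := 4 * √b + 16 * b / a with hK₁
  have hK₁0 : 0 < K₁ := by positivity
  set A := cfc Real.sqrt V with hA
  set good : Set Ω := {ω | IidArray.Accurate (fun i => x (Sum.inl i) ω) c V
      (2 * √(b * L / Fintype.card ι)) (2 * √(4 * B ^ 2 * b * L / Fintype.card ι)) ∧
    IidArray.Accurate (fun i => x (Sum.inr i) ω) c V
      (2 * √(b * L / Fintype.card κ)) (2 * √(4 * B ^ 2 * b * L / Fintype.card κ))} with hgood
  have hexp : Real.exp (-L) = β := by
    rw [hLdef, one_div, Real.log_inv, neg_neg, Real.exp_log hβ0]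
  have hbad : P.real goodᶜ ≤ 4 * (m + m ^ 2) * β := by
    have g1 := (h.precomp Sum.inl_injective).not_accurate_le hb
      (fun k => diag_le_of_spectrum hV hVb k) hB hL (hLB _ hι)
    have g2 := (h.precomp Sum.inr_injective).not_accurate_le hb
      (fun k => diag_le_of_spectrum hV hVb k) hB hL (hLB _ hκ)
    rw [hexp] at g1 g2
    refine (measureReal_mono (fun ω hω => ?_)).trans ((measureReal_union_le _ _).trans
      ((add_le_add g1 g2).trans (le_of_eq (by ring))))
    rw [hgood, Set.mem_compl_iff, Set.mem_ofPred_eq, not_and_or] at hω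
    exact hω
  set w : Ω → Fin m → ℝ := fun ω => A⁻¹ *ᵥ (scaleOf ι κ • fun j =>
    empMean (fun i => x (Sum.inl i) ω) j - empMean (fun i => x (Sum.inr i) ω) j) with hw
  set k := 2 * m ^ 2 / a * (K₁ * s) * (√(m / a) * (4 * √(b * L))) with hk
  have hk0 : 0 ≤ k := by positivity
  have hclose : ∀ ω ∈ good, ∀ j, |((cfc Real.sqrt (pooledCov (fun i => x (Sum.inl i) ω)
      (fun i => x (Sum.inr i) ω)))⁻¹ *ᵥ (scaleOf ι κ • fun j =>
      empMean (fun i => x (Sum.inl i) ω) j - empMean (fun i => x (Sum.inr i) ω) j)) j - w ω j| ≤ k := by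
    rintro ω ⟨hx, hy⟩ j
    refine inv_sqrt_perturbation (posSemidef_of_spectrum_ge hV ha hVa) (posSemidef_pooledCov _ _) ha
      hVa (accurate_pooledCov_sub_le ha hb hB hN hι hκ hL haB (by rw [hs, hβ]) hsβ hx hy) ?_
      (by positivity) _ (by positivity) (fun j => ?_) j
    · refine le_trans ?_ h2
      gcongr
    · exact abs_inv_sqrt_mulVec_le hV ha hVa (accurate_scaled_mean_le hx hy) j
  have hR : 0 < √((m:ℝ) / a) := Real.sqrt_pos.2 (by positivity)
  -- The standardized summands are bounded by `2 √(m / a) β`. The additional 1 ensures `β ≤ β'`, so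
  -- that `log (1 / β')` is at most `L`.
  set β' := (1 + 2 * √(m / a)) * β with hβ'
  have hβ'0 : 0 < β' := by positivity
  have hiso : IsotropicArray P
      (fun i ω => sampleWeight ι κ i • (A⁻¹ *ᵥ (x i ω - c))) β' (fun i => sampleWeight ι κ i ^ 2) := by
    have := h.standardize hV ha hVa (abs_sampleWeight_le hN hι hκ)
    refine ⟨this.indep, this.meas, fun i ω j => (this.bound i ω j).trans ?_, this.mean, this.cov⟩
    calc 1 / √N * (√(m / a) * (2 * B)) = 2 * √(m / a) * β := by rw [hβ]; ring
      _ ≤ β' := by rw [hβ']; gcongr; linarith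
  have hbox : ∀ u, 0 ≤ u → |P.real {ω | ∀ j, |w ω j| ≤ u} -
      (gaussianReal 0 1).real (Set.Icc (-u) u) ^ m| ≤
        berryConst m * (1 + 2 * √(m / a)) * (β * (1 + L)) := by
    intro u hu
    have := berry_esseen_box hiso hm hu hβ'0 h3 sum_sampleWeight_sq
    simp only [sum_sampleWeight_smul] at this
    refine this.trans ?_
    have hlog : Real.log (1 / β') ≤ L := by
      refine Real.log_le_log (by positivity) (one_div_le_one_div_of_le hβ0 ?_)
      rw [hβ']
      nlinarith
    have := berryConst_pos hm
    calc _ ≤ berryConst m * β' * (1 + L) := by gcongr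
      _ = _ := by rw [hβ']; ring
  have hF0 : (gaussianReal 0 1).real (Set.Icc (-(0:ℝ)) 0) ^ m = 0 := by
    rw [gaussianReal_Icc _ _ (by simp)]
    simp [hm.ne']
  refine (abs_measureReal_sub_le_of_sandwich (S := fun u => {ω | ∀ j, |w ω j| ≤ u})
    (F := fun u => (gaussianReal 0 1).real (Set.Icc (-u) u) ^ m) (l := 2 * m) ht hk0 hF0 hbox
    (fun u u' hu huu => gaussian_box_mono_bound m hu huu) (by positivity) hbad ?_ ?_).trans ?_
  · intro ω hω
    by_cases hg : ω ∈ good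
    · left
      intro j
      have a1 := (twoSampleT_le_iff hm _ _ _).1 hω j
      have a2 := hclose ω hg j
      rw [abs_le] at *
      constructor <;> linarith
    · exact Or.inr hg
  · intro ω hω
    by_cases hg : ω ∈ good
    · left
      refine (twoSampleT_le_iff hm _ _ _).2 fun j => ?_
      have a1 := hω j
      have a2 := hclose ω hg j
      rw [abs_le] at *
      constructor <;> linarith
    · exact Or.inr hg
  · have ek : k = 8 * m ^ 2 / a * K₁ * √(m / a) * √b * (β * L) := by
      rw [hk, hs, Real.sqrt_mul hb.le]
      linear_combination (8 * m ^ 2 / a * K₁ * √(m / a) * √b * β) * Real.mul_self_sqrt hL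
    have hβL : 0 ≤ β * L := by positivity
    rw [ek, studentConst, ← hK₁]
    have t1 : 4 * ((m:ℝ) + m ^ 2) * β ≤ 4 * (m + m ^ 2) * (β * (1 + L)) := by
      gcongr; linarith
    have t2 : 2 * (m:ℝ) * (8 * m ^ 2 / a * K₁ * √(m / a) * √b * (β * L)) ≤
        2 * m * (8 * m ^ 2 / a * K₁ * √(m / a) * √b) * (β * (1 + L)) := by
      rw [mul_assoc (2 * (m:ℝ))]
      gcongr
      linarith
    linarith

/-- The error in the normal approximation of the studentized statistic of two samples of bounded
random vectors whose covariance matrix is well conditioned. -/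
theorem IidArray.two_sample_bound (m : ℕ) (hm : 0 < m) {a b : ℝ} (ha : 0 < a) (hb : 0 < b) :
    ∃ C : ℝ, 0 < C ∧ ∀ {Ω : Type} {_ : MeasurableSpace Ω} (P : Measure Ω) [IsProbabilityMeasure P]
      {ι κ : Type} [Fintype ι] [Fintype κ] [Nonempty ι] [Nonempty κ] {x : ι ⊕ κ → Ω → Fin m → ℝ}
      {B : ℝ} {c : Fin m → ℝ} {V : Matrix (Fin m) (Fin m) ℝ}, IidArray P x B c V → V.IsHermitian →
      spectrum ℝ V ⊆ Set.Icc a b → ∀ {N : ℝ}, 0 < N → N ≤ Fintype.card ι → N ≤ Fintype.card κ →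
      B / √N ≤ 1 → ∀ {t : ℝ}, 0 ≤ t →
      |P.real {ω | twoSampleT (fun i => x (Sum.inl i) ω) (fun i => x (Sum.inr i) ω) ≤ t} -
        (gaussianReal 0 1).real (Set.Icc (-t) t) ^ m| ≤
        C * (B / √N * (1 + Real.log (1 / (B / √N)))) := by
  set K₁ := 4 * √b + 16 * b / a with hK₁
  have hK₁0 : 0 < K₁ := by positivity
  -- One summand for each smallness condition of `two_sample_bound_of_small`: if a condition fails,
  -- then `1 ≤ C₀ * β` and the bound is trivial, a difference of probabilities being at most 1.
  set C₀ : ℝ := 16 / b + (2 * m * K₁ / a) ^ 2 + (1 + 2 * √(m / a)) with hC₀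
  have hC₀0 : 0 < C₀ := by positivity
  have hs0 : 0 < studentConst m a b := by
    have := berryConst_pos hm
    unfold studentConst; positivity
  refine ⟨C₀ + studentConst m a b, by positivity, ?_⟩
  intro Ω _ P hP ι κ _ _ _ _ x B c V h hV hVab N hN hι hκ hβ1 t ht
  have hB0 : 0 ≤ B := (abs_nonneg _).trans (h.mean_abs_le ⟨0, hm⟩)
  have haB : a ≤ 4 * B ^ 2 := (diag_ge_of_spectrum hV (fun x hx => (hVab hx).1) ⟨0, hm⟩).trans
    ((le_abs_self _).trans (h.cov_abs_le _ _))
  have hB : 0 < B := hB0.lt_of_ne fun e => by subst e; norm_num at haB; linarith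
  have hsN : 0 < √N := Real.sqrt_pos.2 hN
  set β := B / √N with hβ
  have hβ0 : 0 < β := by positivity
  have hL := (sqrt_log_mul_sq_le hβ0 hβ1).1
  by_cases hsmall : 16 * β ≤ b ∧ m * (K₁ * √β) ≤ a / 2 ∧ (1 + 2 * √(m / a)) * β ≤ 1
  · refine (h.two_sample_bound_of_small hm hV ha hb hVab hN hι hκ hβ hβ1 hsmall.1 hsmall.2.1
      hsmall.2.2 ht).trans ?_
    gcongr
    linarith
  · have hone : 1 ≤ C₀ * β := by
      rw [hC₀]
      by_contra! hlt
      have p1 : 0 ≤ 16 / b * β := by positivity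
      have p2 : 0 ≤ (2 * m * K₁ / a) ^ 2 * β := by positivity
      have p3 : 0 ≤ (1 + 2 * √(m / a)) * β := by positivity
      have hlt' : 16 / b * β + (2 * m * K₁ / a) ^ 2 * β + (1 + 2 * √(m / a)) * β < 1 := by
        linarith
      refine hsmall ⟨?_, ?_, by linarith⟩
      · have : 16 / b * β ≤ 1 := by linarith
        rwa [div_mul_eq_mul_div, div_le_one hb] at this
      · have : (2 * m * K₁ / a * √β) ^ 2 ≤ 1 := by
          rw [mul_pow, Real.sq_sqrt hβ0.le]; linarith
        have := (sq_le_one_iff₀ (by positivity)).1 this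
        have e : m * (K₁ * √β) = (2 * m * K₁ / a * √β) * (a / 2) := by field_simp
        rw [e]
        nlinarith
    have hg : (gaussianReal 0 1).real (Set.Icc (-t) t) ^ m ∈ Set.Icc (0:ℝ) 1 :=
      ⟨by positivity, pow_le_one₀ measureReal_nonneg measureReal_le_one⟩
    calc _ ≤ 1 := abs_sub_le_of_nonneg_of_le measureReal_nonneg measureReal_le_one hg.1 hg.2
      _ ≤ C₀ * β := hone
      _ ≤ (C₀ + studentConst m a b) * (β * (1 + Real.log (1 / β))) := by
          gcongr
          · linarith
          · nlinarith

end TwoSampleBound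

/-! ### Conditioning on an independent part of the data -/

section Conditioning

variable {Ω α β : Type*} {mΩ : MeasurableSpace Ω} {mα : MeasurableSpace α} {mβ : MeasurableSpace β}
  {P : Measure Ω} [IsProbabilityMeasure P] {Q : Measure β} [IsProbabilityMeasure Q]

/-- The freezing lemma: given `X`, the independent variable `Z` is integrated out with `X` held
fixed. It is Fubini's theorem for the product law of the pair, tested on sets `X ⁻¹' t`. -/
lemma condExp_comap_eq_integral {X : Ω → α} {Z : Ω → β} (hX : Measurable X) (hZ : Measurable Z)
    (hXZ : IndepFun X Z P) (hQ : P.map Z = Q) {H : α × β → ℝ} (hH : Measurable H) {C : ℝ}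
    (hC : ∀ p, |H p| ≤ C) :
    (fun ω => ∫ z, H (X ω, z) ∂Q) =ᵐ[P] P[fun ω => H (X ω, Z ω) | mα.comap X] := by
  have hlaw : P.map (fun ω => (X ω, Z ω)) = (P.map X).prod Q := by
    rw [hXZ.map_prod_eq_prod_map_map hX.aemeasurable hZ.aemeasurable, hQ]
  have : IsProbabilityMeasure (P.map X) := Measure.isProbabilityMeasure_map hX.aemeasurable
  have hg : StronglyMeasurable fun x => ∫ z, H (x, z) ∂Q :=
    hH.stronglyMeasurable.integral_prod_right'
  have hgb : ∀ x, |∫ z, H (x, z) ∂Q| ≤ C := fun x => by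
    simpa using norm_integral_le_of_norm_le_const (μ := Q) (f := fun z => H (x, z)) (C := C)
      (ae_of_all _ fun z => hC (x, z))
  refine ae_eq_condExp_of_forall_setIntegral_eq hX.comap_le
    (integrable_of_abs_le (hH.comp (hX.prodMk hZ)) fun ω => hC _)
    (fun s _ _ => (integrable_of_abs_le (hg.measurable.comp hX) fun ω => hgb _).integrableOn) ?_
    (hg.measurable.comp (comap_measurable X)).aestronglyMeasurable
  rintro s ⟨t, ht, rfl⟩ _
  have e1 : ∫ ω in X ⁻¹' t, (∫ z, H (X ω, z) ∂Q) ∂P = ∫ x in t, (∫ z, H (x, z) ∂Q) ∂(P.map X) :=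
    (setIntegral_map ht hg.aestronglyMeasurable hX.aemeasurable).symm
  have e2 : ∫ ω in X ⁻¹' t, H (X ω, Z ω) ∂P =
      ∫ p in t ×ˢ Set.univ, H p ∂((P.map X).prod Q) := by
    rw [← hlaw, setIntegral_map (ht.prod MeasurableSet.univ) hH.aestronglyMeasurable
      (hX.prodMk hZ).aemeasurable, Set.mk_preimage_prod, Set.preimage_univ, Set.inter_univ]
  rw [e1, e2, setIntegral_prod _ (integrable_of_abs_le hH hC).integrableOn, Measure.restrict_univ]

lemma abs_measureReal_sub_le_of_ae_slice {μ : Measure α} [IsProbabilityMeasure μ] {A : Set (α × β)}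
    (hA : MeasurableSet A) {g ε : ℝ}
    (h : ∀ᵐ x ∂μ, |Q.real {z | (x, z) ∈ A} - g| ≤ ε) : |(μ.prod Q).real A - g| ≤ ε := by
  have hm : Measurable fun x => Q.real {z | (x, z) ∈ A} :=
    (measurable_measure_prodMk_left hA).ennreal_toReal
  have hi : Integrable (fun x => Q.real {z | (x, z) ∈ A}) μ :=
    integrable_of_abs_le hm (C := 1) fun x => by
      rw [abs_of_nonneg measureReal_nonneg]; exact measureReal_le_one
  have e : (μ.prod Q).real A = ∫ x, Q.real {z | (x, z) ∈ A} ∂μ := by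
    rw [measureReal_def, Measure.prod_apply hA, ← integral_toReal
      (measurable_measure_prodMk_left hA).aemeasurable (ae_of_all _ fun x => measure_lt_top _ _)]
    rfl
  have e' : (μ.prod Q).real A - g = ∫ x, (Q.real {z | (x, z) ∈ A} - g) ∂μ := by
    rw [integral_sub hi (integrable_const _), e]; simp
  rw [e']
  simpa using norm_integral_le_of_norm_le_const (μ := μ)
    (f := fun x => Q.real {z | (x, z) ∈ A} - g) h

end Conditioning

/-! ### Measurability of the statistic -/

section Measurability

variable {Ω : Type*} {mΩ : MeasurableSpace Ω} {m : ℕ} {ι κ : Type} [Fintype ι] [Fintype κ]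

/-- Continuity of the matrix square root is known on symmetric matrices; precomposing with the
symmetrization gives a globally continuous map that agrees with it there, which yields measurability
from the entries alone. -/
lemma continuous_cfc_sqrt_symmetrization : Continuous fun W : Matrix (Fin m) (Fin m) ℝ =>
    cfc Real.sqrt ((1 / 2 : ℝ) • (W + Wᵀ)) := by
  refine continuousOn_cfc_sqrt.comp_continuous (by fun_prop) fun W => ?_
  change ((1 / 2 : ℝ) • (W + Wᵀ))ᴴ = _
  simp [add_comm]

lemma symmetrization_eq {W : Matrix (Fin m) (Fin m) ℝ} (hW : W.IsHermitian) :
    (1 / 2 : ℝ) • (W + Wᵀ) = W := by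
  have : Wᵀ = W := by simpa [IsHermitian] using hW
  rw [this, ← two_smul ℝ W, smul_smul]; norm_num

/-- Cramer's rule writes an entry of the inverse as adjugate over determinant. The convention `0⁻¹ =
0` on the reals agrees with the zero inverse of a singular matrix, so no case distinction is needed.
-/
lemma measurable_inv_cfc_sqrt {W : Ω → Matrix (Fin m) (Fin m) ℝ} (hW : ∀ ω, (W ω).IsHermitian)
    (hWm : ∀ i j, Measurable fun ω => W ω i j) (i j : Fin m) :
    Measurable fun ω => (cfc Real.sqrt (W ω))⁻¹ i j := by
  have hc := continuous_cfc_sqrt_symmetrization (m := m)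
  have e : ∀ ω, (cfc Real.sqrt (W ω))⁻¹ i j =
      ((cfc Real.sqrt ((1 / 2 : ℝ) • (W ω + (W ω)ᵀ))).det)⁻¹ *
        (cfc Real.sqrt ((1 / 2 : ℝ) • (W ω + (W ω)ᵀ))).adjugate i j := fun ω => by
    rw [symmetrization_eq (hW ω), Matrix.inv_def, Ring.inverse_eq_inv', Matrix.smul_apply,
      smul_eq_mul]
  have hWm' : Measurable fun ω => (fun i j => W ω i j : Fin m → Fin m → ℝ) :=
    measurable_pi_lambda _ fun i => measurable_pi_lambda _ fun j => hWm i j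
  have h1 : Continuous fun w : Fin m → Fin m → ℝ =>
      (cfc Real.sqrt ((1 / 2 : ℝ) • (Matrix.of w + (Matrix.of w)ᵀ))).det :=
    hc.matrix_det
  have h2 : Continuous fun w : Fin m → Fin m → ℝ =>
      (cfc Real.sqrt ((1 / 2 : ℝ) • (Matrix.of w + (Matrix.of w)ᵀ))).adjugate i j :=
    hc.matrix_adjugate.matrix_elem i j
  simp only [e]
  exact (h1.measurable.comp hWm').inv.mul (h2.measurable.comp hWm')

lemma measurable_empMean {x : Ω → ι → Fin m → ℝ} (hx : ∀ i j, Measurable fun ω => x ω i j)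
    (j : Fin m) : Measurable fun ω => empMean (x ω) j :=
  (Finset.measurable_sum _ fun i _ => hx i j).const_mul _

lemma measurable_empCov {x : Ω → ι → Fin m → ℝ} (hx : ∀ i j, Measurable fun ω => x ω i j)
    (j k : Fin m) : Measurable fun ω => empCov (x ω) j k :=
  (Finset.measurable_sum _ fun i _ => ((hx i j).sub (measurable_empMean hx j)).mul
    ((hx i k).sub (measurable_empMean hx k))).const_mul _

lemma measurable_twoSampleT {x : Ω → ι → Fin m → ℝ} {y : Ω → κ → Fin m → ℝ}
    (hx : ∀ i j, Measurable fun ω => x ω i j) (hy : ∀ i j, Measurable fun ω => y ω i j) :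
    Measurable fun ω => twoSampleT (x ω) (y ω) := by
  refine Measurable.iSup fun j => Measurable.const_mul (Measurable.abs ?_) _
  have e : ∀ ω, ((cfc Real.sqrt (pooledCov (x ω) (y ω)))⁻¹ *ᵥ
      fun j => empMean (x ω) j - empMean (y ω) j) j =
      ∑ k, (cfc Real.sqrt (pooledCov (x ω) (y ω)))⁻¹ j k *
        (empMean (x ω) k - empMean (y ω) k) := fun ω => rfl
  simp only [e]
  have hd : ∀ k, Measurable fun ω => empMean (x ω) k - empMean (y ω) k := fun k =>
    (measurable_empMean hx k).sub (measurable_empMean hy k)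
  refine Finset.measurable_sum _ fun k _ => Measurable.mul ?_ (hd k)
  refine measurable_inv_cfc_sqrt (fun ω => (posSemidef_pooledCov _ _).1) (fun j k => ?_) j k
  exact ((measurable_empCov hx j k).const_mul _).add ((measurable_empCov hy j k).const_mul _)

end Measurability

/-! ### The first two moments of the difference of the means -/

section Moments

variable {Ω : Type*} {mΩ : MeasurableSpace Ω} {P : Measure Ω} [IsProbabilityMeasure P]
  {m : ℕ} {ι κ : Type} [Fintype ι] [Fintype κ] [Nonempty ι] [Nonempty κ]

/-- The scaled difference of the means of the two samples. -/
noncomputable def scaledMeanDiff (x : ι ⊕ κ → Fin m → ℝ) (j : Fin m) : ℝ :=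
  scaleOf ι κ * (empMean (fun i => x (Sum.inl i)) j - empMean (fun i => x (Sum.inr i)) j)

lemma scaledMeanDiff_eq_sum (x : ι ⊕ κ → Fin m → ℝ) (c : Fin m → ℝ) (j : Fin m) :
    scaledMeanDiff x j = ∑ s, sampleWeight ι κ s * (x s j - c j) := by
  have := congrFun (sum_sampleWeight_smul x c 1) j
  simp only [one_mulVec, Finset.sum_apply, Pi.smul_apply, smul_eq_mul, Pi.sub_apply] at this
  exact this.symm

lemma measurable_scaledMeanDiff {x : Ω → ι ⊕ κ → Fin m → ℝ}
    (hx : ∀ i j, Measurable fun ω => x ω i j) (j : Fin m) :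
    Measurable fun ω => scaledMeanDiff (x ω) j :=
  ((measurable_empMean (fun i k => hx (Sum.inl i) k) j).sub
    (measurable_empMean (fun i k => hx (Sum.inr i) k) j)).const_mul _

lemma abs_scaledMeanDiff_le {x : ι ⊕ κ → Fin m → ℝ} {B : ℝ} (hx : ∀ s j, |x s j| ≤ B) (j : Fin m) :
    |scaledMeanDiff x j| ≤ ∑ s, |sampleWeight ι κ s| * B := by
  rw [scaledMeanDiff_eq_sum x 0]
  refine (Finset.abs_sum_le_sum_abs _ _).trans (Finset.sum_le_sum fun s _ => ?_)
  rw [abs_mul, Pi.zero_apply, sub_zero]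
  exact mul_le_mul_of_nonneg_left (hx s j) (abs_nonneg _)

variable {x : ι ⊕ κ → Ω → Fin m → ℝ} {B : ℝ} {c : Fin m → ℝ} {V : Matrix (Fin m) (Fin m) ℝ}

lemma IidArray.integral_scaledMeanDiff (h : IidArray P x B c V) (j : Fin m) :
    ∫ ω, scaledMeanDiff (fun s => x s ω) j ∂P = 0 := by
  have hint : ∀ s, Integrable (fun ω => x s ω j - c j) P := fun s =>
    (h.integrable_coord s j).sub (integrable_const (c j))
  simp only [fun ω => scaledMeanDiff_eq_sum (fun s => x s ω) c j]
  rw [integral_finsetSum _ fun s _ => (hint s).const_mul _]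
  simp [integral_const_mul, h.centred_mean]

lemma IidArray.integral_centred_mul_of_ne (h : IidArray P x B c V) {s s' : ι ⊕ κ} (hs : s ≠ s')
    (j k : Fin m) : ∫ ω, (x s ω j - c j) * (x s' ω k - c k) ∂P = 0 := by
  have hi : IndepFun (fun ω => x s ω j - c j) (fun ω => x s' ω k - c k) P :=
    (h.indep.indepFun hs).comp (φ := fun v : Fin m → ℝ => v j - c j)
      (ψ := fun v : Fin m → ℝ => v k - c k) (by fun_prop) (by fun_prop)
  rw [hi.integral_fun_mul_eq_mul_integral
    ((h.meas_coord s j).sub_const _).aestronglyMeasurable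
    ((h.meas_coord s' k).sub_const _).aestronglyMeasurable, h.centred_mean, zero_mul]

/-- Cross terms vanish by independence and the squared weights sum to one, so the scaled difference
of the means has exactly the covariance of a single observation. This identifies the conditional
covariance matrix in the eigenvalue condition. -/
lemma IidArray.integral_scaledMeanDiff_mul (h : IidArray P x B c V) (j k : Fin m) :
    ∫ ω, scaledMeanDiff (fun s => x s ω) j * scaledMeanDiff (fun s => x s ω) k ∂P = V j k := by
  classical
  have hint : ∀ s s', Integrable (fun ω => sampleWeight ι κ s * sampleWeight ι κ s' *
      ((x s ω j - c j) * (x s' ω k - c k))) P := fun s s' => by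
    refine Integrable.const_mul (integrable_of_abs_le (C := 2 * B * (2 * B))
      (((h.meas_coord s j).sub_const _).mul ((h.meas_coord s' k).sub_const _)) fun ω => ?_) _
    rw [Pi.mul_apply, abs_mul]
    have h1 := h.centred_abs_le s ω j
    exact mul_le_mul h1 (h.centred_abs_le s' ω k) (abs_nonneg _) ((abs_nonneg _).trans h1)
  have e : ∀ ω, scaledMeanDiff (fun s => x s ω) j * scaledMeanDiff (fun s => x s ω) k =
      ∑ s, ∑ s', sampleWeight ι κ s * sampleWeight ι κ s' *
        ((x s ω j - c j) * (x s' ω k - c k)) := fun ω => by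
    rw [scaledMeanDiff_eq_sum _ c, scaledMeanDiff_eq_sum _ c, Finset.sum_mul_sum]
    exact Finset.sum_congr rfl fun s _ => Finset.sum_congr rfl fun s' _ => by ring
  simp only [e]
  rw [integral_finsetSum _ fun s _ => integrable_finsetSum _ fun s' _ => hint s s']
  have e2 : ∀ s, ∫ ω, ∑ s', sampleWeight ι κ s * sampleWeight ι κ s' *
      ((x s ω j - c j) * (x s' ω k - c k)) ∂P = sampleWeight ι κ s ^ 2 * V j k := fun s => by
    rw [integral_finsetSum _ fun s' _ => hint s s', Finset.sum_eq_single s]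
    · rw [integral_const_mul, h.cov, sq]
    · intro s' _ hs
      rw [integral_const_mul, h.integral_centred_mul_of_ne hs.symm, mul_zero]
    · simp
  simp only [e2]
  rw [← Finset.sum_mul, sum_sampleWeight_sq, one_mul]

end Moments

/-! ### The statistic conditionally on the fitting data -/

namespace Experiment

variable {m : ℕ} (E : Experiment.{u} m)

/-- The indices of the test data. -/
abbrev TestIndex : Type := E.testX ⊕ E.testY

/-- The test data. -/
def testData (ω : E.Ω) : E.TestIndex → EuclideanSpace ℝ (Fin E.d) :=
  Sum.elim (fun i => E.X i ω) (fun i => E.Y i ω)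

/-- The vector of the estimated discriminative functions, as a function of the fitting data. -/
def feature (D : E.FitSpace) (x : EuclideanSpace ℝ (Fin E.d)) (j : Fin m) : ℝ :=
  E.f j D (project (E.U j D) x)

/-- The estimated discriminative functions on the test data. -/
def testFeature (D : E.FitSpace) (z : E.TestIndex → EuclideanSpace ℝ (Fin E.d))
    (s : E.TestIndex) : Fin m → ℝ :=
  E.feature D (z s)

lemma tX_eq : E.tX = Fintype.card E.testX := by simp [tX]

lemma tY_eq : E.tY = Fintype.card E.testY := by simp [tY]

lemma meanX_eq (j : Fin m) (ω : E.Ω) : E.meanX j ω =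
    empMean (fun i => E.testFeature (E.fitData ω) (E.testData ω) (Sum.inl i)) j := by
  rw [meanX, tX_eq, empMean, ← Finset.sum_coe_sort]
  rfl

lemma meanY_eq (j : Fin m) (ω : E.Ω) : E.meanY j ω =
    empMean (fun i => E.testFeature (E.fitData ω) (E.testData ω) (Sum.inr i)) j := by
  rw [meanY, tY_eq, empMean, ← Finset.sum_coe_sort]
  rfl

lemma scale_eq : E.scale = scaleOf E.testX E.testY := by
  rw [scale, tX_eq, tY_eq, scaleOf]

lemma sampleCov_eq (ω : E.Ω) : E.sampleCov ω =
    pooledCov (fun i => E.testFeature (E.fitData ω) (E.testData ω) (Sum.inl i))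
      (fun i => E.testFeature (E.fitData ω) (E.testData ω) (Sum.inr i)) := by
  ext a b
  simp only [sampleCov, of_apply, pooledCov, Matrix.add_apply, Matrix.smul_apply, smul_eq_mul,
    empCov, tX_eq, tY_eq, meanX_eq, meanY_eq]
  rw [← Finset.sum_coe_sort E.testX, ← Finset.sum_coe_sort E.testY]
  rfl

lemma T_eq (ω : E.Ω) : E.T ω =
    twoSampleT (fun i => E.testFeature (E.fitData ω) (E.testData ω) (Sum.inl i))
      (fun i => E.testFeature (E.fitData ω) (E.testData ω) (Sum.inr i)) := by
  have hS : E.S ω = fun j =>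
      empMean (fun i => E.testFeature (E.fitData ω) (E.testData ω) (Sum.inl i)) j -
      empMean (fun i => E.testFeature (E.fitData ω) (E.testData ω) (Sum.inr i)) j := by
    funext j; rw [S, meanX_eq, meanY_eq]
  rw [T, twoSampleT, scale_eq, sampleCov_eq, hS]

lemma scale_mul_S_eq (ω : E.Ω) (j : Fin m) : E.scale * E.S ω j =
    scaledMeanDiff (E.testFeature (E.fitData ω) (E.testData ω)) j := by
  rw [S, meanX_eq, meanY_eq, scale_eq, scaledMeanDiff]

variable {E}

lemma IsEll0Procedure.measurable_feature (h : E.IsEll0Procedure) (j : Fin m) :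
    Measurable fun p : E.FitSpace × EuclideanSpace ℝ (Fin E.d) => E.feature p.1 p.2 j := by
  refine (h.f_meas j).comp (measurable_fst.prodMk (measurable_pi_lambda _ fun l => ?_))
  have hx : ∀ a, Measurable fun p : E.FitSpace × EuclideanSpace ℝ (Fin E.d) => p.2 a := fun a => by
    fun_prop
  have hU : ∀ a, Measurable fun p : E.FitSpace × EuclideanSpace ℝ (Fin E.d) => E.U j p.1 a l :=
    fun a => (h.U_meas j a l).comp measurable_fst
  change Measurable fun p : E.FitSpace × EuclideanSpace ℝ (Fin E.d) => ∑ a, E.U j p.1 a l * p.2 a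
  exact Finset.measurable_sum _ fun a _ => (hU a).mul (hx a)

lemma IsEll0Procedure.abs_feature_le (h : E.IsEll0Procedure) (D : E.FitSpace)
    (x : EuclideanSpace ℝ (Fin E.d)) (j : Fin m) : |E.feature D x j| ≤ E.bound j :=
  let ⟨_, _, _, _, _, _, hb⟩ := h.f_mem j D
  hb _

lemma IsEll0Procedure.measurable_testFeature (h : E.IsEll0Procedure) (s : E.TestIndex) (j : Fin m) :
    Measurable fun p : E.FitSpace × (E.TestIndex → EuclideanSpace ℝ (Fin E.d)) =>
      E.testFeature p.1 p.2 s j :=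
  (h.measurable_feature j).comp
    (measurable_fst.prodMk ((measurable_pi_apply s).comp measurable_snd))

lemma IsSampling.measurable_fitData (h : E.IsSampling) : Measurable E.fitData := by
  change Measurable fun ω => ((fun i => E.X i ω, fun i => E.Y i ω) : E.FitSpace)
  exact (measurable_pi_lambda _ fun i : E.fitX => h.measX i).prodMk
    (measurable_pi_lambda _ fun i : E.fitY => h.measY i)

lemma IsSampling.measurable_testData (h : E.IsSampling) : Measurable E.testData :=
  measurable_pi_lambda _ fun s => match s with
    | Sum.inl i => h.measX i
    | Sum.inr i => h.measY i

lemma IsSampling.measurable_sample (h : E.IsSampling) (s : Fin E.nX ⊕ Fin E.nY) :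
    Measurable (Sum.elim E.X E.Y s) :=
  match s with
    | Sum.inl i => h.measX i
    | Sum.inr i => h.measY i

lemma IsSampling.indepFun_fitData_testData (h : E.IsSampling) :
    IndepFun E.fitData E.testData E.P := by
  have hd : Disjoint (E.fitX.disjSum E.fitY) (E.testX.disjSum E.testY) := by
    rw [Finset.disjoint_left]
    rintro (i | i) h1 h2 <;> simp_all [testX, testY]
  have hi := h.indep.indepFun_finset _ _ hd h.measurable_sample
  refine hi.comp
    (φ := fun v : E.fitX.disjSum E.fitY → EuclideanSpace ℝ (Fin E.d) =>
      ((fun i => v ⟨Sum.inl i, by simp⟩, fun i => v ⟨Sum.inr i, by simp⟩) : E.FitSpace))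
    (ψ := fun (v : E.testX.disjSum E.testY → EuclideanSpace ℝ (Fin E.d)) (s : E.TestIndex) =>
      v ⟨Sum.map Subtype.val Subtype.val s, by rcases s with s | s <;> simp⟩)
    (by fun_prop) (by fun_prop) |>.congr ?_ ?_
  · exact ae_of_all _ fun ω => rfl
  · refine ae_of_all _ fun ω => ?_
    funext s
    rcases s with s | s <;> rfl

/-- The null hypothesis enters here: both test samples merge into one product measure with equal
factors. -/
lemma IsSampling.map_testData (h : E.IsSampling) (h0 : E.Null) :
    E.P.map E.testData = Measure.pi fun _ : E.TestIndex => E.μ := by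
  have hinj : Function.Injective (Sum.map Subtype.val Subtype.val :
      E.TestIndex → Fin E.nX ⊕ Fin E.nY) :=
    Subtype.val_injective.sumMap Subtype.val_injective
  have hi := h.indep.precomp hinj
  rw [iIndepFun_iff_map_fun_eq_pi_map fun s => (h.measurable_sample _).aemeasurable] at hi
  have e : E.testData = fun ω s => Sum.elim E.X E.Y (Sum.map Subtype.val Subtype.val s) ω := by
    funext ω s
    rcases s with s | s <;> rfl
  rw [e]
  refine hi.trans (congrArg _ (funext fun s => ?_))
  rcases s with s | s
  · exact (h.lawX s).map_eq
  · exact (h.lawY s).map_eq.trans h0.symm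

variable (E)

/-- The mean of the discriminative functions. -/
noncomputable def featureMean (D : E.FitSpace) (j : Fin m) : ℝ := ∫ x, E.feature D x j ∂E.μ

/-- The covariance matrix of the discriminative functions. -/
noncomputable def featureCov (D : E.FitSpace) : Matrix (Fin m) (Fin m) ℝ := Matrix.of fun j k =>
  ∫ x, (E.feature D x j - E.featureMean D j) * (E.feature D x k - E.featureMean D k) ∂E.μ

lemma isHermitian_featureCov (D : E.FitSpace) : (E.featureCov D).IsHermitian := by
  ext j k
  simp [featureCov, mul_comm]

variable {E}

/-- With the fitting data frozen, the estimated functions are fixed measurable functions bounded by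
the network bound, evaluated at i.i.d. points. -/
lemma IsEll0Procedure.iidArray (h : E.IsEll0Procedure) [IsProbabilityMeasure E.μ] {B : ℝ}
    (hB : ∀ j, E.bound j ≤ B) (D : E.FitSpace) :
    IidArray (Measure.pi fun _ : E.TestIndex => E.μ) (fun s z => E.testFeature D z s) B
      (E.featureMean D) (E.featureCov D) where
  indep := by
    have hf : Measurable (E.feature D) :=
      measurable_pi_lambda _ fun j => (h.measurable_feature j).comp measurable_prodMk_left
    exact iIndepFun_pi fun _ => hf.aemeasurable
  meas s := measurable_pi_lambda _ fun j =>
    (h.measurable_testFeature s j).comp measurable_prodMk_left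
  bound s z j := (h.abs_feature_le D _ j).trans (hB j)
  mean s j := by
    have hf : Measurable fun x => E.feature D x j :=
      (h.measurable_feature j).comp measurable_prodMk_left
    exact integral_comp_eval (μ := fun _ : E.TestIndex => E.μ) (i := s) hf.aestronglyMeasurable
  cov s j k := by
    have hf : ∀ j, Measurable fun x => E.feature D x j := fun j =>
      (h.measurable_feature j).comp measurable_prodMk_left
    exact integral_comp_eval (μ := fun _ : E.TestIndex => E.μ) (i := s)
      (f := fun x => (E.feature D x j - E.featureMean D j) * (E.feature D x k - E.featureMean D k))
      (((hf j).sub_const _).mul ((hf k).sub_const _)).aestronglyMeasurable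

/-- The freezing lemma, applied first to the scaled differences, whose conditional means vanish
under the null hypothesis, and then to their products. It transfers the eigenvalue condition from
the conditional covariance to the covariance of the frozen features. -/
lemma condCov_ae_eq [Nonempty E.testX] [Nonempty E.testY] (hs : E.IsSampling)
    (h : E.IsEll0Procedure) (h0 : E.Null) :
    ∀ᵐ ω ∂E.P, E.condCov ω = E.featureCov (E.fitData ω) := by
  have := hs.probX
  set B := ∑ j, |E.bound j| with hB
  have hjB : ∀ j, E.bound j ≤ B := fun j => (le_abs_self _).trans
    (Finset.single_le_sum (f := fun j => |E.bound j|) (fun _ _ => abs_nonneg _) (Finset.mem_univ j))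
  set H : Fin m → E.FitSpace × (E.TestIndex → EuclideanSpace ℝ (Fin E.d)) → ℝ := fun j p =>
    scaledMeanDiff (E.testFeature p.1 p.2) j with hH
  have hHm : ∀ j, Measurable (H j) := fun j =>
    measurable_scaledMeanDiff (fun s j => h.measurable_testFeature s j) j
  set C := ∑ s, |sampleWeight E.testX E.testY s| * B with hC
  have hHb : ∀ j p, |H j p| ≤ C := fun j p =>
    abs_scaledMeanDiff_le (fun s j => (h.abs_feature_le p.1 _ j).trans (hjB j)) j
  have hmean : ∀ j, E.P[fun ω => E.scale * E.S ω j | E.fitSigma] =ᵐ[E.P] 0 := by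
    intro j
    have := condExp_comap_eq_integral hs.measurable_fitData hs.measurable_testData
      hs.indepFun_fitData_testData (hs.map_testData h0) (hHm j) (hHb j)
    simp only [scale_mul_S_eq]
    refine this.symm.trans (ae_of_all _ fun ω => ?_)
    exact (h.iidArray hjB (E.fitData ω)).integral_scaledMeanDiff j
  have hcov : ∀ j k, (fun ω => E.condCov ω j k) =ᵐ[E.P] fun ω => E.featureCov (E.fitData ω) j k := by
    intro j k
    have := condExp_comap_eq_integral hs.measurable_fitData hs.measurable_testData
      hs.indepFun_fitData_testData (hs.map_testData h0) (H := fun p => H j p * H k p)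
      ((hHm j).mul (hHm k)) (C := C * C) (fun p => by
        rw [abs_mul]
        exact mul_le_mul (hHb j p) (hHb k p) (abs_nonneg _) ((abs_nonneg _).trans (hHb j p)))
    have e1 : (fun ω => (E.scale * E.S ω j - (E.P[fun ω' => E.scale * E.S ω' j | E.fitSigma]) ω) *
        (E.scale * E.S ω k - (E.P[fun ω' => E.scale * E.S ω' k | E.fitSigma]) ω)) =ᵐ[E.P]
        fun ω => H j (E.fitData ω, E.testData ω) * H k (E.fitData ω, E.testData ω) := by
      filter_upwards [hmean j, hmean k] with ω hj hk
      rw [hj, hk, scale_mul_S_eq, scale_mul_S_eq]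
      simp [hH]
    refine (condExp_congr_ae e1).trans (this.symm.trans (ae_of_all _ fun ω => ?_))
    exact (h.iidArray hjB (E.fitData ω)).integral_scaledMeanDiff_mul j k
  have hall : ∀ᵐ ω ∂E.P, ∀ j k, E.condCov ω j k = E.featureCov (E.fitData ω) j k :=
    ae_all_iff.2 fun j => ae_all_iff.2 fun k => hcov j k
  filter_upwards [hall] with ω hω
  ext j k
  exact hω j k

lemma measurable_T (hs : E.IsSampling) (h : E.IsEll0Procedure) : Measurable E.T := by
  have hm : ∀ s j, Measurable fun ω => E.testFeature (E.fitData ω) (E.testData ω) s j := fun s j =>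
    (h.measurable_testFeature s j).comp (hs.measurable_fitData.prodMk hs.measurable_testData)
  simp only [funext E.T_eq]
  exact measurable_twoSampleT (fun i j => hm _ j) (fun i j => hm _ j)

/-! ### Sample sizes -/

lemma SampleSizes.n_pos {c₁ c₂ : ℝ} (h : E.SampleSizes c₁ c₂) (hc₁ : 0 < c₁) :
    0 < E.nX ∧ 0 < E.n := by
  have h1 := hc₁.trans_le h.ratio.1
  have : 0 < E.nX := Nat.pos_of_ne_zero fun h0 => by simp [h0] at h1
  exact ⟨this, by unfold n; omega⟩

/-- The first sample contains at least a fraction `c₁` and the second at least a fraction `1 - c₂`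
of all observations, and each keeps at least a fraction `1 - c₂` of its points for testing. -/
lemma SampleSizes.le_test {c₁ c₂ : ℝ} (h : E.SampleSizes c₁ c₂) (hc₁ : 0 < c₁) (hc₂ : c₂ < 1) :
    (1 - c₂) * min c₁ (1 - c₂) * E.n ≤ Fintype.card E.testX ∧
      (1 - c₂) * min c₁ (1 - c₂) * E.n ≤ Fintype.card E.testY := by
  obtain ⟨hX, hn⟩ := h.n_pos hc₁
  have hY : 0 < E.nY := Nat.pos_of_ne_zero fun h0 => by
    have := hc₁.trans_le h.fitY.1
    simp [h0] at this
  have hX' : (0:ℝ) < E.nX := by exact_mod_cast hX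
  have hY' : (0:ℝ) < E.nY := by exact_mod_cast hY
  have hnn : (E.n : ℝ) = E.nX + E.nY := by simp [n]
  have r1 := (le_div_iff₀ (by positivity)).1 h.ratio.1
  have r2 := (div_le_iff₀ (by positivity)).1 h.ratio.2
  have f1 := (div_le_iff₀ hX').1 h.fitX.2
  have f2 := (div_le_iff₀ hY').1 h.fitY.2
  have e1 : (Fintype.card E.testX : ℝ) = E.nX - E.fitX.card := by
    have := Finset.card_le_univ E.fitX
    rw [Fintype.card_coe, testX, Finset.card_compl, Nat.cast_sub this, Fintype.card_fin]
  have e2 : (Fintype.card E.testY : ℝ) = E.nY - E.fitY.card := by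
    have := Finset.card_le_univ E.fitY
    rw [Fintype.card_coe, testY, Finset.card_compl, Nat.cast_sub this, Fintype.card_fin]
  have hc : 0 < 1 - c₂ := by linarith
  have m1 : min c₁ (1 - c₂) * E.n ≤ E.nX := by
    rw [hnn]
    exact (mul_le_mul_of_nonneg_right (min_le_left _ _) (by positivity)).trans r1
  have m2 : min c₁ (1 - c₂) * E.n ≤ E.nY := by
    rw [hnn]
    refine (mul_le_mul_of_nonneg_right (min_le_right _ _) (by positivity)).trans ?_
    linarith
  constructor
  · rw [e1, mul_assoc]
    linarith [mul_le_mul_of_nonneg_left m1 hc.le]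
  · rw [e2, mul_assoc]
    linarith [mul_le_mul_of_nonneg_left m2 hc.le]

end Experiment

/-! ### The Berry–Esseen bound for the experiment -/

lemma abs_measureReal_sub_le_of_ae {Ω α β : Type*} {mΩ : MeasurableSpace Ω}
    {mα : MeasurableSpace α} {mβ : MeasurableSpace β} {P : Measure Ω} [IsProbabilityMeasure P]
    {Q : Measure β} [IsProbabilityMeasure Q] {X : Ω → α} {Z : Ω → β} (hX : Measurable X)
    (hZ : Measurable Z) (hXZ : IndepFun X Z P) (hQ : P.map Z = Q) {A : Set (α × β)}
    (hA : MeasurableSet A) {g ε : ℝ} (h : ∀ᵐ ω ∂P, |Q.real {z | (X ω, z) ∈ A} - g| ≤ ε) :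
    |P.real {ω | (X ω, Z ω) ∈ A} - g| ≤ ε := by
  have hlaw : P.map (fun ω => (X ω, Z ω)) = (P.map X).prod Q := by
    rw [hXZ.map_prod_eq_prod_map_map hX.aemeasurable hZ.aemeasurable, hQ]
  have : IsProbabilityMeasure (P.map X) := Measure.isProbabilityMeasure_map hX.aemeasurable
  have hm : Measurable fun x => Q.real {z | (x, z) ∈ A} :=
    (measurable_measure_prodMk_left hA).ennreal_toReal
  have h1 : ∀ᵐ x ∂(P.map X), |Q.real {z | (x, z) ∈ A} - g| ≤ ε :=
    (ae_map_iff hX.aemeasurable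
      (measurableSet_le (hm.sub_const g).abs measurable_const)).2 h
  have h2 := abs_measureReal_sub_le_of_ae_slice hA h1
  rwa [← hlaw, map_measureReal_apply (hX.prodMk hZ) hA] at h2

lemma maxAbs_le_iff {m : ℕ} (hm : 0 < m) (z : Fin m → ℝ) (t : ℝ) : maxAbs z ≤ t ↔ ∀ j, |z j| ≤ t := by
  have : Nonempty (Fin m) := ⟨⟨0, hm⟩⟩
  exact ciSup_le_iff (Set.finite_range _).bddAbove

lemma measurable_maxAbs {m : ℕ} : Measurable (maxAbs (m := m)) :=
  Measurable.iSup fun j => (measurable_pi_apply j).abs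

lemma stdNormal_maxAbs_le {m : ℕ} (hm : 0 < m) (t : ℝ) :
    (stdNormal m).real {z | maxAbs z ≤ t} = (gaussianReal 0 1).real (Set.Icc (-t) t) ^ m := by
  have e : {z : Fin m → ℝ | maxAbs z ≤ t} = Set.univ.pi fun _ => Set.Icc (-t) t := by
    ext z
    simp [maxAbs_le_iff hm, abs_le, Pi.le_def, forall_and]
  rw [e, stdNormal, measureReal_def, Measure.pi_pi]
  simp [measureReal_def]

namespace Experiment

variable {m : ℕ} {E : Experiment.{u} m}

lemma T_nonneg (ω : E.Ω) : 0 ≤ E.T ω :=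
  Real.iSup_nonneg fun _ => mul_nonneg (Real.sqrt_nonneg _) (abs_nonneg _)

lemma IsEll0Procedure.bound_nonneg (h : E.IsEll0Procedure) (j : Fin m) : 0 ≤ E.bound j :=
  (abs_nonneg _).trans (h.abs_feature_le (0, 0) 0 j)

lemma Admissible.nonempty_test {c₁ c₂ c₁' c₂' : ℝ} (h : E.Admissible c₁ c₂ c₁' c₂') (hc₁ : 0 < c₁)
    (hc₂ : c₂ < 1) : Nonempty E.testX ∧ Nonempty E.testY := by
  obtain ⟨h1, h2⟩ := h.sizes.le_test hc₁ hc₂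
  have hn : (0:ℝ) < E.n := by exact_mod_cast (h.sizes.n_pos hc₁).2
  have hc : 0 < 1 - c₂ := by linarith
  have hp : 0 < (1 - c₂) * min c₁ (1 - c₂) * E.n :=
    mul_pos (mul_pos hc (lt_min hc₁ hc)) hn
  constructor
  · exact Fintype.card_pos_iff.1 (by exact_mod_cast hp.trans_le h1)
  · exact Fintype.card_pos_iff.1 (by exact_mod_cast hp.trans_le h2)

lemma Admissible.ae_spectrum {c₁ c₂ c₁' c₂' : ℝ} (h : E.Admissible c₁ c₂ c₁' c₂') (hc₁ : 0 < c₁)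
    (hc₂ : c₂ < 1) : ∀ᵐ ω ∂E.P, spectrum ℝ (E.featureCov (E.fitData ω)) ⊆ Set.Icc c₁' c₂' := by
  obtain ⟨_, _⟩ := h.nonempty_test hc₁ hc₂
  filter_upwards [h.cov, condCov_ae_eq h.sampling h.procedure h.null] with ω h1 h2
  rwa [← h2]

/-- A lower bound on the network bound. -/
lemma Admissible.le_four_mul_sq {c₁ c₂ c₁' c₂' : ℝ} (h : E.Admissible c₁ c₂ c₁' c₂') (hm : 0 < m)
    (hc₁ : 0 < c₁) (hc₂ : c₂ < 1) {B : ℝ} (hB : ∀ j, E.bound j ≤ B) : c₁' ≤ 4 * B ^ 2 := by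
  obtain ⟨_, _⟩ := h.nonempty_test hc₁ hc₂
  have := h.sampling.probX
  obtain ⟨ω, hω⟩ := (h.ae_spectrum hc₁ hc₂).exists
  exact (diag_ge_of_spectrum (E.isHermitian_featureCov _) (fun x hx => (hω hx).1) ⟨0, hm⟩).trans
    ((le_abs_self _).trans ((h.procedure.iidArray hB (E.fitData ω)).cov_abs_le _ _))

/-- The conditional bound is uniform in the fitting data and the Gaussian limit does not depend on
them, so integrating over the fitting data preserves it. -/
theorem exists_berry_esseen (m : ℕ) (hm : 0 < m) {c₁ c₂ c₁' c₂' : ℝ} (hc₁ : 0 < c₁) (hc₂ : c₂ < 1)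
    (hc₁' : 0 < c₁') (hc₂' : 0 < c₂') : ∃ C : ℝ, 0 < C ∧ ∃ r : ℝ, 0 < r ∧
      ∀ E : Experiment.{u} m, E.Admissible c₁ c₂ c₁' c₂' → ∀ B : ℝ, (∀ j, E.bound j ≤ B) →
      B / √(r * E.n) ≤ 1 → ∀ t : ℝ,
      |E.P.real {ω | E.T ω ≤ t} - (stdNormal m).real {z | maxAbs z ≤ t}| ≤
        C * (B / √(r * E.n) * (1 + Real.log (1 / (B / √(r * E.n))))) := by
  obtain ⟨C, hC0, hC⟩ := IidArray.two_sample_bound m hm hc₁' hc₂'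
  have hc : 0 < 1 - c₂ := by linarith
  have hr : 0 < (1 - c₂) * min c₁ (1 - c₂) := mul_pos hc (lt_min hc₁ hc)
  refine ⟨C, hC0, _, hr, fun E hE B hB hβ t => ?_⟩
  obtain ⟨_, _⟩ := hE.nonempty_test hc₁ hc₂
  have := hE.sampling.probX
  have hn : (0:ℝ) < E.n := by exact_mod_cast (hE.sizes.n_pos hc₁).2
  obtain ⟨hsX, hsY⟩ := hE.sizes.le_test hc₁ hc₂
  set N := (1 - c₂) * min c₁ (1 - c₂) * (E.n : ℝ) with hN
  have hN0 : 0 < N := by positivity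
  have hB0 : 0 ≤ B := (hE.procedure.bound_nonneg ⟨0, hm⟩).trans (hB _)
  -- For negative `t` both events are empty; the two-sample bound concerns `0 ≤ t`.
  rcases lt_or_ge t 0 with ht | ht
  · have e1 : {ω | E.T ω ≤ t} = ∅ := by
      ext ω
      simpa using ht.trans_le (E.T_nonneg ω)
    have e2 : {z : Fin m → ℝ | maxAbs z ≤ t} = ∅ := by
      ext z
      have h0 : 0 ≤ maxAbs z := Real.iSup_nonneg fun j => abs_nonneg (z j)
      simpa using ht.trans_le h0
    rw [e1, e2]
    have hβ0 : 0 ≤ B / √N := by positivity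
    have hl : 0 ≤ Real.log (1 / (B / √N)) := by
      rcases hβ0.eq_or_lt with h0 | h0
      · simp [← h0]
      · exact Real.log_nonneg ((one_le_div h0).2 hβ)
    simp only [measureReal_empty, sub_zero, abs_zero]
    positivity
  rw [stdNormal_maxAbs_le hm]
  simp only [E.T_eq]
  have hmeas : Measurable fun p : E.FitSpace × (E.TestIndex → EuclideanSpace ℝ (Fin E.d)) =>
      twoSampleT (fun i => E.testFeature p.1 p.2 (Sum.inl i))
        (fun i => E.testFeature p.1 p.2 (Sum.inr i)) :=
    measurable_twoSampleT (fun _ j => hE.procedure.measurable_testFeature _ j)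
      (fun _ j => hE.procedure.measurable_testFeature _ j)
  refine abs_measureReal_sub_le_of_ae hE.sampling.measurable_fitData
    hE.sampling.measurable_testData hE.sampling.indepFun_fitData_testData
    (hE.sampling.map_testData hE.null)
    (A := {p | twoSampleT (fun i => E.testFeature p.1 p.2 (Sum.inl i))
        (fun i => E.testFeature p.1 p.2 (Sum.inr i)) ≤ t})
    (measurableSet_le hmeas measurable_const) ?_
  filter_upwards [hE.ae_spectrum hc₁ hc₂] with ω hω
  exact hC _ (hE.procedure.iidArray hB (E.fitData ω)) (E.isHermitian_featureCov _) hω hN0 hsX hsY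
    hβ ht

end Experiment

/-! ### Convergence of distribution functions -/

lemma measureReal_Ioc {μ : Measure ℝ} [IsProbabilityMeasure μ] {a b : ℝ} (hab : a ≤ b) :
    μ.real (Set.Ioc a b) = μ.real (Set.Iic b) - μ.real (Set.Iic a) := by
  rw [← measureReal_sdiff (Set.Iic_subset_Iic.2 hab) measurableSet_Iic, Set.Iic_sdiff_Iic]

/-- Half-open intervals form a π-system that contains small neighbourhoods of every point, and their
masses are differences of distribution functions. Convergence is assumed at every point, so atoms
need no separate treatment. -/
lemma tendsto_probabilityMeasure_of_cdf {ν : ℕ → ProbabilityMeasure ℝ} {ν' : ProbabilityMeasure ℝ}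
    (h : ∀ t, Tendsto (fun i => (ν i : Measure ℝ).real (Set.Iic t)) atTop
      (𝓝 ((ν' : Measure ℝ).real (Set.Iic t)))) : Tendsto ν atTop (𝓝 ν') := by
  refine IsPiSystem.tendsto_probabilityMeasure_of_tendsto_of_mem
    (isPiSystem_Ioc (id : ℝ → ℝ) (id : ℝ → ℝ)) ?_ ?_ ?_
  · rintro _ ⟨a, b, _, rfl⟩
    exact measurableSet_Ioc
  · intro U hU x hx
    obtain ⟨ε, hε, hεU⟩ := Metric.isOpen_iff.1 hU x hx
    refine ⟨_, ⟨x - ε / 2, x + ε / 2, by simp only [id]; linarith, rfl⟩,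
      Ioc_mem_nhds (by simp only [id]; linarith) (by simp only [id]; linarith), fun y hy => hεU ?_⟩
    rw [Metric.mem_ball, Real.dist_eq, abs_lt]
    simp only [id, Set.mem_Ioc] at hy
    constructor <;> linarith [hy.1, hy.2]
  · rintro _ ⟨a, b, hab, rfl⟩
    change a < b at hab
    rw [← NNReal.tendsto_coe]
    simp only [← ProbabilityMeasure.measureReal_eq_coe_coeFn, id, measureReal_Ioc hab.le]
    exact (h b).sub (h a)

lemma tendstoInDistribution_of_cdf {Ω' : Type*} {Ω : ℕ → Type*} {mΩ : ∀ i, MeasurableSpace (Ω i)}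
    {P : ∀ i, Measure (Ω i)} [∀ i, IsProbabilityMeasure (P i)] {mΩ' : MeasurableSpace Ω'}
    {Q : Measure Ω'} [IsProbabilityMeasure Q] {X : ∀ i, Ω i → ℝ} {Z : Ω' → ℝ}
    (hX : ∀ i, Measurable (X i)) (hZ : Measurable Z)
    (h : ∀ t, Tendsto (fun i => (P i).real {ω | X i ω ≤ t}) atTop (𝓝 (Q.real {z | Z z ≤ t}))) :
    TendstoInDistribution X atTop Z P Q where
  forall_aemeasurable i := (hX i).aemeasurable
  aemeasurable_limit := hZ.aemeasurable
  tendsto := by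
    refine tendsto_probabilityMeasure_of_cdf fun t => ?_
    change Tendsto (fun i => ((P i).map (X i)).real (Set.Iic t)) atTop
      (𝓝 ((Q.map Z).real (Set.Iic t)))
    rw [map_measureReal_apply hZ measurableSet_Iic]
    exact (h t).congr fun i => (map_measureReal_apply (hX i) measurableSet_Iic).symm

lemma tendsto_mul_one_add_log_inv : Tendsto (fun β : ℝ => β * (1 + Real.log (1 / β))) (𝓝 0) (𝓝 0) := by
  have e : (fun β : ℝ => β * (1 + Real.log (1 / β))) = fun β => β + Real.negMulLog β := by
    funext β
    rw [one_div, Real.log_inv, Real.negMulLog]; ring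
  have h : Continuous fun β : ℝ => β + Real.negMulLog β :=
    continuous_id.add Real.continuous_negMulLog
  rw [e]
  simpa using h.tendsto 0

lemma tendsto_log_mul_div {c : ℝ} (hc : 0 < c) :
    Tendsto (fun n : ℕ => Real.log (c * n) / n) atTop (𝓝 0) := by
  have h := (Real.tendsto_pow_log_div_mul_add_atTop c⁻¹ 0 1 (by positivity)).comp
    ((tendsto_natCast_atTop_atTop (R := ℝ)).const_mul_atTop hc)
  refine h.congr fun n => ?_
  simp only [Function.comp, pow_one, add_zero]
  rw [inv_mul_cancel_left₀ hc.ne']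

/-! ### Convergence in distribution of the statistic and the logarithmic rate. -/

namespace Experiment

variable {m : ℕ}

theorem tendstoInDistribution_T (hm : 0 < m) {c₁ c₂ c₁' c₂' : ℝ} (hc₁ : 0 < c₁) (hc₂ : c₂ < 1)
    (hc₁' : 0 < c₁') (hc₂' : 0 < c₂') {E : ℕ → Experiment.{u} m}
    (hE : ∀ i, (E i).Admissible c₁ c₂ c₁' c₂')
    (hb : ∀ j, Tendsto (fun i => (E i).bound j / √((E i).n)) atTop (𝓝 0)) :
    TendstoInDistribution (fun i => (E i).T) atTop maxAbs (fun i => (E i).P) (stdNormal m) := by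
  obtain ⟨C, hC0, r, hr, hC⟩ := exists_berry_esseen.{u} m hm hc₁ hc₂ hc₁' hc₂'
  refine tendstoInDistribution_of_cdf (fun i => measurable_T (hE i).sampling (hE i).procedure)
    measurable_maxAbs fun t => ?_
  set B : ℕ → ℝ := fun i => ∑ j, (E i).bound j with hB
  set β : ℕ → ℝ := fun i => B i / √(r * (E i).n) with hβ
  have hβ0 : Tendsto β atTop (𝓝 0) := by
    have h1 := (tendsto_finsetSum Finset.univ fun j _ => hb j).div_const √r
    simp only [Finset.sum_const_zero, zero_div] at h1
    refine h1.congr fun i => ?_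
    simp only [hβ, hB]
    rw [Real.sqrt_mul hr.le, ← Finset.sum_div, div_div, mul_comm √r]
  have hβ1 : ∀ᶠ i in atTop, β i ≤ 1 := by
    filter_upwards [hβ0.eventually (gt_mem_nhds one_pos)] with i hi using hi.le
  have h2 := (tendsto_mul_one_add_log_inv.comp hβ0).const_mul C
  rw [mul_zero] at h2
  rw [tendsto_iff_dist_tendsto_zero]
  refine squeeze_zero' (Eventually.of_forall fun _ => dist_nonneg) ?_ h2
  filter_upwards [hβ1] with i hi
  exact hC (E i) (hE i) (B i) (fun j => Finset.single_le_sum (f := fun j => (E i).bound j)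
    (fun j _ => (hE i).procedure.bound_nonneg j) (Finset.mem_univ j)) hi t

/-- The eigenvalue condition forces `c₁' ≤ 4 B ^ 2`. Hence `B` may be replaced by a multiple of `B ^
2`, and `1 / β ^ 2` is at most a multiple of `n`, so `log (1 / β)` is at most a constant plus `log
n`. -/
theorem exists_berry_esseen_log (m : ℕ) (hm : 0 < m) {c₁ c₂ c₁' c₂' : ℝ} (hc₁ : 0 < c₁)
    (hc₂ : c₂ < 1) (hc₁' : 0 < c₁') (hc₂' : 0 < c₂') : ∃ C : ℝ, 0 < C ∧
      ∀ E : Experiment.{u} m, E.Admissible c₁ c₂ c₁' c₂' → ∀ B : ℝ, (∀ j, E.bound j ≤ B) → ∀ t : ℝ,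
      |E.P.real {ω | E.T ω ≤ t} - (stdNormal m).real {z | maxAbs z ≤ t}| ≤
        C * (B ^ 2 * Real.log E.n / √E.n) := by
  obtain ⟨C, hC0, r, hr, hC⟩ := exists_berry_esseen.{u} m hm hc₁ hc₂ hc₁' hc₂'
  have hl2 : 0 < Real.log 2 := Real.log_pos one_lt_two
  set K := |Real.log (4 * r / c₁')| with hK
  have hK0 : 0 ≤ K := abs_nonneg _
  set C₁ := 1 + (1 + K) / Real.log 2 with hC₁
  have hC₁0 : 0 < C₁ := by positivity
  have hs : 0 < √c₁' := Real.sqrt_pos.2 hc₁'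
  have hsr : 0 < √r := Real.sqrt_pos.2 hr
  refine ⟨(1 + C) * C₁ * (2 / (√c₁' * √r)), by positivity, fun E hE B hB t => ?_⟩
  have hB0 : 0 ≤ B := (hE.procedure.bound_nonneg ⟨0, hm⟩).trans (hB _)
  have haB := hE.le_four_mul_sq hm hc₁ hc₂ hB
  have hBpos : 0 < B := hB0.lt_of_ne fun e => by subst e; norm_num at haB; linarith
  -- Both samples are nonempty. This keeps `log n` at least `log 2`, so that it can absorb additive
  -- constants.
  have hn2 : (2:ℝ) ≤ E.n := by
    have h1 := (hE.sizes.n_pos hc₁).1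
    have h2 : 0 < E.nY := Nat.pos_of_ne_zero fun h0 => by
      have := hc₁.trans_le hE.sizes.fitY.1
      simp [h0] at this
    have : 2 ≤ E.n := by unfold n; omega
    exact_mod_cast this
  have hn0 : (0:ℝ) < E.n := by linarith
  have hlog : Real.log 2 ≤ Real.log E.n := Real.log_le_log two_pos hn2
  have hlog0 : 0 < Real.log E.n := hl2.trans_le hlog
  have hsn : 0 < √(E.n : ℝ) := Real.sqrt_pos.2 hn0
  set β := B / √(r * E.n) with hβ
  have hβ0 : 0 < β := by positivity
  have hβle : β ≤ 2 / (√c₁' * √r) * (B ^ 2 / √E.n) := by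
    have h1 : √c₁' ≤ 2 * B := Real.sqrt_le_iff.2 ⟨by positivity, by linarith⟩
    rw [hβ, Real.sqrt_mul hr.le]
    calc B / (√r * √E.n) = √c₁' * (B / (√c₁' * (√r * √E.n))) := by field_simp
      _ ≤ 2 * B * (B / (√c₁' * (√r * √E.n))) := by gcongr
      _ = _ := by field_simp
  have hone : 1 ≤ C₁ * Real.log E.n := by
    calc (1:ℝ) = 1 / Real.log 2 * Real.log 2 := by field_simp
      _ ≤ C₁ * Real.log E.n := by
          gcongr
          rw [hC₁, add_div]
          have : 0 ≤ K / Real.log 2 := by positivity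
          linarith
  have hdiff : |E.P.real {ω | E.T ω ≤ t} - (stdNormal m).real {z | maxAbs z ≤ t}| ≤
      (1 + C) * (β * (C₁ * Real.log E.n)) := by
    rcases le_or_gt β 1 with h1 | h1
    · refine (hC E hE B hB h1 t).trans ?_
      have hL : 1 + Real.log (1 / β) ≤ C₁ * Real.log E.n := by
        have h3 : Real.log (1 / β) ≤ K + Real.log E.n := by
          have h4 : 1 / β ^ 2 ≤ 4 * r / c₁' * E.n := by
            rw [hβ, div_pow, Real.sq_sqrt (by positivity), one_div_div,
              div_mul_eq_mul_div, div_le_div_iff₀ (by positivity) hc₁']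
            nlinarith [mul_pos hr hn0]
          have h5 : Real.log (1 / β ^ 2) ≤ Real.log (4 * r / c₁') + Real.log E.n := by
            rw [← Real.log_mul (by positivity) hn0.ne']
            exact Real.log_le_log (by positivity) h4
          have h6 : Real.log (1 / β ^ 2) = 2 * Real.log (1 / β) := by
            rw [← _root_.one_div_pow, Real.log_pow]; norm_num
          have h7 := le_abs_self (Real.log (4 * r / c₁'))
          linarith
        have h8 : 1 + K ≤ (1 + K) / Real.log 2 * Real.log E.n := by
          calc 1 + K = (1 + K) / Real.log 2 * Real.log 2 := by field_simp
            _ ≤ _ := by gcongr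
        rw [hC₁, add_mul, one_mul]
        linarith
      have : 0 ≤ β * (C₁ * Real.log E.n) := by positivity
      calc _ ≤ C * (β * (C₁ * Real.log E.n)) := by gcongr
        _ ≤ _ := by linarith
    -- For `β > 1` the bound is trivial, as `C₁ * log n` is at least 1.
    · calc _ ≤ (1:ℝ) := abs_sub_le_of_nonneg_of_le measureReal_nonneg measureReal_le_one
            measureReal_nonneg measureReal_le_one
        _ ≤ 1 * (1 * 1) := by norm_num
        _ ≤ _ := by gcongr; linarith
  calc _ ≤ (1 + C) * (β * (C₁ * Real.log E.n)) := hdiff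
    _ ≤ (1 + C) * (2 / (√c₁' * √r) * (B ^ 2 / √E.n) * (C₁ * Real.log E.n)) := by gcongr
    _ = _ := by ring

lemma Admissible.one_le_d {c₁ c₂ c₁' c₂' : ℝ} {E : Experiment.{u} m}
    (h : E.Admissible c₁ c₂ c₁' c₂') (hm : 0 < m) : 1 ≤ E.d := by
  have h1 := h.procedure.k_le ⟨0, hm⟩
  have h2 := h.procedure.le_kd ⟨0, hm⟩
  have h3 : (1:ℝ) ≤ E.k ⟨0, hm⟩ := by exact_mod_cast h.procedure.one_le_k ⟨0, hm⟩
  by_contra! h0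
  have : E.d = 0 := by omega
  rw [this] at h2
  norm_num at h2
  linarith

end Experiment

end NeuralWasserstein

/-! ### Assembly of the three claims. -/

open NeuralWasserstein in
theorem corollary2 (m : ℕ) (hm : 0 < m) (c₁ c₂ c₁' c₂' : ℝ)
    (hc₁ : 0 < c₁) (hc₁₂ : c₁ ≤ c₂) (hc₂ : c₂ < 1) (hc₁' : 0 < c₁') (hc₂' : 0 < c₂') :
    -- fixed dimension, candidate set and `η`
    (∀ (d : ℕ) (k : Fin m → ℕ) (ϖ : Fin m → ℝ) (η : ℝ) (E : ℕ → Experiment.{u} m),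
      0 < η →
      (∀ i, (E i).Admissible c₁ c₂ c₁' c₂' ∧ (E i).HasEll0Bound η ∧
        (E i).d = d ∧ (E i).k = k ∧ (E i).ϖ = ϖ) →
      Tendsto (fun i => (E i).n) atTop atTop →
      TendstoInDistribution (fun i => (E i).T) atTop maxAbs (fun i => (E i).P) (stdNormal m)) ∧
    -- everything may vary with the sample size, for arbitrary networks bounded by `o(√n)`
    (∀ E : ℕ → Experiment.{u} m,
      (∀ i, (E i).Admissible c₁ c₂ c₁' c₂') →
      Tendsto (fun i => (E i).n) atTop atTop →
      (∀ j, Tendsto (fun i => (E i).bound j / Real.sqrt (E i).n) atTop (𝓝 0)) →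
      TendstoInDistribution (fun i => (E i).T) atTop maxAbs (fun i => (E i).P) (stdNormal m)) ∧
    -- the Berry-Esseen type bound
    ∃ c : ℝ, 0 < c ∧ ∀ (η : ℝ) (E : Experiment.{u} m), 0 < η →
      E.Admissible c₁ c₂ c₁' c₂' → E.HasEll0Bound η → ∀ t : ℝ,
      |E.P.real {ω | E.T ω ≤ t} - (stdNormal m).real {z | maxAbs z ≤ t}| ≤
        c * ((E.kMax ^ (3 / 2 : ℝ) * η ^ 3 *
              (E.ϖMax * Real.log ((E.d : ℝ) * E.n)) ^ (3 / 2 : ℝ) +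
            E.kMax * η ^ 2 * E.ϖMax * Real.log ((E.d : ℝ) * E.n) * Real.log E.n) /
          Real.sqrt E.n) := by
  refine ⟨?_, fun E hE _ hb => Experiment.tendstoInDistribution_T hm hc₁ hc₂ hc₁' hc₂' hE hb, ?_⟩
  · intro d k ϖ η E _ hE hn
    refine Experiment.tendstoInDistribution_T hm hc₁ hc₂ hc₁' hc₂' (fun i => (hE i).1) fun j => ?_
    have hd : (0:ℝ) < d := by
      have := (hE 0).1.one_le_d hm
      rw [(hE 0).2.2.1] at this
      exact_mod_cast this
    -- With `d`, `η` and the candidate pairs fixed, the bound divided by `√n` is a constant times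
    -- `√(2 log (d n) / n)`, so the first claim is a case of the second.
    have h1 := (((tendsto_log_mul_div hd).comp hn).const_mul 2).sqrt.const_mul
      (4 * √(k j * ϖ j) * η)
    rw [mul_zero, Real.sqrt_zero, mul_zero] at h1
    refine h1.congr fun i => ?_
    obtain ⟨_, hb, h2, h3, h4⟩ := hE i
    rw [hb j, h2, h3, h4]
    simp only [Function.comp]
    rw [← mul_div_assoc, Real.sqrt_div' _ (Nat.cast_nonneg _)]
    ring
  · obtain ⟨C, hC0, hC⟩ := Experiment.exists_berry_esseen_log.{u} m hm hc₁ hc₂ hc₁' hc₂'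
    refine ⟨C * 32, by positivity, fun η E hη hE hb t => ?_⟩
    have hn : (1:ℝ) ≤ E.n := by exact_mod_cast (hE.sizes.n_pos hc₁).2
    have hd : (1:ℝ) ≤ E.d := by exact_mod_cast hE.one_le_d hm
    have hk : ∀ j, (E.k j : ℝ) ≤ E.kMax := le_ciSup (Set.finite_range _).bddAbove
    have hϖ : ∀ j, E.ϖ j ≤ E.ϖMax := le_ciSup (Set.finite_range _).bddAbove
    have hϖ0 : ∀ j, 0 ≤ E.ϖ j := fun j => (Nat.cast_nonneg _).trans (hE.procedure.k_le j)
    have hK : 0 ≤ E.kMax := (Nat.cast_nonneg _).trans (hk ⟨0, hm⟩)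
    have hW : 0 ≤ E.ϖMax := (hϖ0 _).trans (hϖ ⟨0, hm⟩)
    set Λ := Real.log ((E.d : ℝ) * E.n) with hΛ
    have hΛ0 : 0 ≤ Λ := Real.log_nonneg (by nlinarith)
    have hln : 0 ≤ Real.log E.n := Real.log_nonneg hn
    -- The squared network bound is `16 k ϖ η ^ 2 * 2 log (d n)`, whence the factor 32.
    have hB : ∀ j, E.bound j ≤ √(32 * (E.kMax * η ^ 2 * E.ϖMax * Λ)) := by
      intro j
      refine Real.le_sqrt_of_sq_le ?_
      rw [hb j, mul_pow, mul_pow, mul_pow, Real.sq_sqrt (mul_nonneg (Nat.cast_nonneg _) (hϖ0 j)),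
        Real.sq_sqrt (by positivity)]
      calc _ = 32 * (E.k j * η ^ 2 * E.ϖ j * Λ) := by ring
        _ ≤ _ := by
          gcongr
          · exact hϖ0 j
          · exact hk j
          · exact hϖ j
    refine (hC E hE _ hB t).trans ?_
    rw [Real.sq_sqrt (by positivity)]
    -- The bound `B ^ 2 log n / √n` is already 32 times the second summand of the rate; the first
    -- summand is nonnegative and is merely added.
    have h1 : 0 ≤ E.kMax ^ (3 / 2 : ℝ) * η ^ 3 * (E.ϖMax * Λ) ^ (3 / 2 : ℝ) := by positivity
    calc _ = C * 32 * ((0 + E.kMax * η ^ 2 * E.ϖMax * Λ * Real.log E.n) / √E.n) := by ring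
      _ ≤ _ := by gcongr
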